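/- **Definitions.** For a metric space $X$, order $X\times\mathbb R$ by the causal order $(x,t)\le(x',t')\iff d(x,x')\le t'-t$. For $\ell\ge 0$ and $a,b\in X$ let $\mathrm{Cau}^\ell(X;a,b)$ be the interval between $(a,0)$ and $(b,\ell)$, and let $\mathrm{Cau}^\ell(X)=\bigsqcup_{a,b\in X}\mathrm{Cau}^\ell(X;a,b)$ (disjoint union of posets). Let $\Delta\mathrm{Cau}^\ell(X)$ be its order complex and $\Delta'\mathrm{Cau}^\ell(X)$ the subcomplex of the simplices $(x_0,t_0)<\dots<(x_n,t_n)$ with $d(x_0,x_1)+\dots+d(x_{n-1},x_n)<\ell$. The magnitude homotopy type is the quotient of geometric realizations (with the weak topology) $$\mathcal M^\ell(X)=|\Delta\mathrm{Cau}^\ell(X)|\,/\,|\Delta'\mathrm{Cau}^\ell(X)|,$$ where the quotient by the empty set adds a disjoint base point. For a space $M$ put $\widetilde\chi(M)=\sum_{k\ge0}(-1)^k\operatorname{rank}\widetilde H_k(M)$, with $\widetilde H_k$ reduced integral singular homology. For a finite metric space $X$, let $Z_X=(q^{d(x,y)})_{x,y\in X}$, an invertible matrix over the ring of Hahn series $\sum_{r\in\mathbb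 R_{\ge0}}c_rq^r$ (with $c_r\in\mathbb C$ and well-ordered support); the magnitude is $\mathrm{Mag}(X)=\sum_{x,y\in X}Z_X^{-1}(x,y)$. Let $G,H,K$ be metric spaces with $K$ nonempty, with isometric embeddings $i_G:K\to G$ and $i_H:K\to H$. A point $y\in H$ projects to $i_H(K)$ if there is $p\in i_H(K)$ with $d(k,y)=d(k,p)+d(p,y)$ for all $k\in i_H(K)$. Let $H_0$ be the set of points of $H\setminus i_H(K)$ that do not project to $i_H(K)$. Let $\alpha:K\to K$ be an isometry with $d(h,i_H(k))=d(h,i_H(\alpha(k)))$ for all $h\in H_0$, $k\in K$. Let $X$ be the metric space obtained from $G\sqcup H$ by identifying $i_G(k)$ with $i_H(k)$ for all $k\in K$, and $Y$ the one obtained by identifying $i_G(k)$ with $i_H(\alpha(k))$, each with the metric that restricts to those of $G$ and $H$ and in which the distance of $x\in G$ and $y\in H$ is the infimum over $k\in K$ of $d(x,i_G(k))+d(i_H(k),y)$, respectively $d(x,i_G(k))+d(i_H(\alpha(k)),y)$. Then $X$ and $Y$ are said to differ by a sycamore twist. **Statement.** Let $G$ and $H$ be finite, and let $X$ and $Y$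 differ by a sycamore twist as above. Then: 1. for every real $\ell\ge0$, the groups $\widetilde H_k(\mathcal M^\ell(X))$ and $\widetilde H_k(\mathcal M^\ell(Y))$ are finitely generated and vanish for all large $k$, and $\widetilde\chi(\mathcal M^\ell(X))=\widetilde\chi(\mathcal M^\ell(Y))$; 2. $\mathrm{Mag}(X)=\mathrm{Mag}(Y)$ in the ring of Hahn series. -/

import Mathlib

open scoped NNReal

universe u

/-! ### Magnitude of a finite metric space -/

section Magnitude

/-- The matrix `Z_X = (q ^ d(x, y))` over the ring of Hahn series with complex coefficients and
exponents in `[0, ∞)`. -/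
noncomputable def zetaMatrix (X : Type*) [MetricSpace X] : Matrix X X (HahnSeries ℝ≥0 ℂ) :=
  Matrix.of fun x y => HahnSeries.single (nndist x y) (1 : ℂ)

/-- The magnitude of a finite metric space: the sum of all entries of the inverse of `Z_X`
(which exists, see `isUnit_zetaMatrix`). -/
noncomputable def magnitude (X : Type*) [MetricSpace X] [Finite X] : HahnSeries ℝ≥0 ℂ :=
  letI := Fintype.ofFinite X
  letI := Classical.decEq X
  ∑ x : X, ∑ y : X, (zetaMatrix X)⁻¹ x y

/-- The coefficient of `q ^ 0`, as a ring homomorphism. -/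
noncomputable def hahnCoeffZero : HahnSeries ℝ≥0 ℂ →+* ℂ where
  toFun f := f.coeff 0
  map_one' := by simp
  map_zero' := by simp
  map_add' f g := by simp
  map_mul' f g := by
    rw [HahnSeries.coeff_mul]
    by_cases hf : f.coeff 0 = 0
    · rw [hf, zero_mul]
      refine Finset.sum_eq_zero fun ij hij => ?_
      have h := (Finset.mem_antidiagonal.1 hij)
      have h0 : ij.1 = 0 := by have := h.2.2; exact (add_eq_zero.1 this).1
      rw [h0, hf, zero_mul]
    by_cases hg : g.coeff 0 = 0
    · rw [hg, mul_zero]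
      refine Finset.sum_eq_zero fun ij hij => ?_
      have h := (Finset.mem_antidiagonal.1 hij)
      have h0 : ij.2 = 0 := by have := h.2.2; exact (add_eq_zero.1 this).2
      rw [h0, hg, mul_zero]
    rw [Finset.sum_eq_single (0, 0)]
    · intro ij hij hne
      have h := (Finset.mem_antidiagonal.1 hij)
      have := add_eq_zero.1 h.2.2
      exact absurd (Prod.ext this.1 this.2) hne
    · intro h
      exact absurd (Finset.mem_antidiagonal.2 ⟨hf, hg, add_zero 0⟩) h

/-- The matrix `Z_X` of a finite metric space is invertible. -/
theorem isUnit_zetaMatrix (X : Type*) [MetricSpace X] [Fintype X] [DecidableEq X] :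
    IsUnit (zetaMatrix X) := by
  rw [Matrix.isUnit_iff_isUnit_det]
  have h1 : hahnCoeffZero (zetaMatrix X).det = 1 := by
    rw [RingHom.map_det]
    have : hahnCoeffZero.mapMatrix (zetaMatrix X) = 1 := by
      ext x y
      by_cases h : x = y
      · subst h
        simp [zetaMatrix, hahnCoeffZero]
      · have h' : (0 : ℝ≥0) ≠ nndist x y := fun e => h (nndist_eq_zero.1 e.symm)
        simp [zetaMatrix, hahnCoeffZero, HahnSeries.coeff_single_of_ne h', Matrix.one_apply_ne h]
    rw [this, Matrix.det_one]
  have h2 : (zetaMatrix X).det.coeff 0 = 1 := h1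
  have h3 : (zetaMatrix X).det.order = 0 :=
    le_antisymm (HahnSeries.order_le_of_coeff_ne_zero (by rw [h2]; exact one_ne_zero)) zero_le
  refine HahnSeries.isUnit_of_isUnit_leadingCoeff_AddUnitOrder ?_ ?_
  · rw [HahnSeries.leadingCoeff_eq, h3, h2]
    exact isUnit_one
  · rw [h3]
    exact isAddUnit_zero

end Magnitude

/-! ### Simplicial complexes: realization, quotients, order complexes -/

section Complexes

variable {V : Type u}

/-- Geometric realization of a simplicial complex: points are given by their barycentric
coordinates. -/
def Realization (K : PreAbstractSimplicialComplex V) : Type u :=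
  {x : V →₀ ℝ // x.support ∈ K ∧ (∀ v, 0 ≤ x v) ∧ x.sum (fun _ r => r) = 1}

/-- The closed simplex spanned by the finite set `σ` of vertices. -/
def ClosedSimplex (K : PreAbstractSimplicialComplex V) (σ : Finset V) : Type u :=
  {x : Realization K // x.1.support ⊆ σ}

/-- A closed simplex carries the Euclidean topology of the barycentric coordinates. -/
instance (K : PreAbstractSimplicialComplex V) (σ : Finset V) :
    TopologicalSpace (ClosedSimplex K σ) :=
  TopologicalSpace.induced (fun x v => x.1.1 v) (inferInstanceAs (TopologicalSpace (V → ℝ)))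

/-- The weak (CW) topology: the finest one for which all inclusions of closed simplices, over the
faces of the complex, are continuous. -/
instance (K : PreAbstractSimplicialComplex V) : TopologicalSpace (Realization K) :=
  ⨆ σ : {σ : Finset V // σ ∈ K},
    TopologicalSpace.coinduced (fun x : ClosedSimplex K σ.1 => x.1) inferInstance

/-- The relation on `|K| ⊔ {∗}` identifying each point of `|L|` with the base point `∗`. -/
inductive CollapseRel (K L : PreAbstractSimplicialComplex V) :
    Realization K ⊕ Unit → Realization K ⊕ Unit → Prop
  | collapse (x : Realization K) (hx : x.1.support ∈ L) :
      CollapseRel K L (Sum.inl x) (Sum.inr ())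

/-- The quotient space `|K| / |L|` for a subcomplex `L` of `K`; for empty `L`, this is `|K|` with
a disjoint base point added. -/
def RealizationQuotient (K L : PreAbstractSimplicialComplex V) : Type u :=
  Quot (CollapseRel K L)

instance (K L : PreAbstractSimplicialComplex V) : TopologicalSpace (RealizationQuotient K L) :=
  inferInstanceAs (TopologicalSpace (Quot (CollapseRel K L)))

/-- The order complex `ΔP`: its simplices are the nonempty finite chains of the poset `P`. -/
def orderComplex (P : Type u) [PartialOrder P] : PreAbstractSimplicialComplex P where
  faces := {σ | σ.Nonempty ∧ IsChain (· ≤ ·) (σ : Set P)}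
  isRelLowerSet_faces := fun {_} hσ =>
    ⟨hσ.1, fun _ hτ hne => ⟨hne, hσ.2.mono (Finset.coe_subset.2 hτ)⟩⟩

end Complexes

/-! ### The causal order and the magnitude homotopy type -/

section Causal

/-- Points of `X × ℝ`, to be equipped with the causal order. -/
@[ext]
structure Spacetime (X : Type u) where
  /-- The space coordinate. -/
  point : X
  /-- The time coordinate. -/
  time : ℝ

/-- The causal order on `X × ℝ`: `(x, t) ≤ (x', t')` iff `d(x, x') ≤ t' - t`. -/
instance (X : Type u) [MetricSpace X] : PartialOrder (Spacetime X) where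
  le p q := dist p.point q.point ≤ q.time - p.time
  le_refl p := by simp
  le_trans p q r hpq hqr := by
    have := dist_triangle p.point q.point r.point
    linarith
  le_antisymm p q hpq hqp := by
    rw [dist_comm] at hqp
    have h0 := dist_nonneg (x := p.point) (y := q.point)
    have hd : dist p.point q.point = 0 := by linarith
    exact Spacetime.ext (dist_eq_zero.1 hd) (by linarith)

/-- The causal interval `Cau^ℓ(X; a, b)` between `(a, 0)` and `(b, ℓ)`. -/
def causalInterval (X : Type u) [MetricSpace X] (ℓ : ℝ) (a b : X) : Set (Spacetime X) :=
  Set.Icc ⟨a, 0⟩ ⟨b, ℓ⟩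

/-- The total causal poset `Cau^ℓ(X)`, the disjoint union of the posets `Cau^ℓ(X; a, b)`. -/
abbrev TotalCausalPoset (X : Type u) [MetricSpace X] (ℓ : ℝ) : Type u :=
  Σ ab : X × X, causalInterval X ℓ ab.1 ab.2

/-- The point of `X` underlying an element of the total causal poset. -/
def TotalCausalPoset.point {X : Type u} [MetricSpace X] {ℓ : ℝ} (p : TotalCausalPoset X ℓ) : X :=
  p.2.1.point

/-- The length `d(x₀, x₁) + ⋯ + d(xₙ₋₁, xₙ)` of a finite sequence of points. -/
def seqLength {X : Type u} [MetricSpace X] : List X → ℝ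
  | [] => 0
  | [_] => 0
  | x :: y :: l => dist x y + seqLength (y :: l)

theorem seqLength_cons_le {X : Type u} [MetricSpace X] (x y : X) (l : List X) :
    seqLength (x :: l) ≤ dist x y + seqLength (y :: l) := by
  cases l with
  | nil => simp [seqLength]
  | cons z l =>
    have := dist_triangle x y z
    simp only [seqLength]
    linarith

theorem seqLength_le_cons {X : Type u} [MetricSpace X] (x : X) (l : List X) :
    seqLength l ≤ seqLength (x :: l) := by
  cases l with
  | nil => simp [seqLength]
  | cons y l =>
    have := dist_nonneg (x := x) (y := y)
    simp only [seqLength]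
    linarith

theorem seqLength_cons_sublist {X : Type u} [MetricSpace X] {l₁ l₂ : List X}
    (h : l₁.Sublist l₂) (x : X) : seqLength (x :: l₁) ≤ seqLength (x :: l₂) := by
  induction h generalizing x with
  | slnil => exact le_rfl
  | cons y _ ih =>
    refine (ih x).trans ((seqLength_cons_le x y _).trans ?_)
    simp [seqLength]
  | cons_cons y _ ih =>
    have := ih y
    simp only [seqLength]
    linarith

theorem seqLength_sublist {X : Type u} [MetricSpace X] {l₁ l₂ : List X}
    (h : l₁.Sublist l₂) : seqLength l₁ ≤ seqLength l₂ := by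
  induction h with
  | slnil => exact le_rfl
  | cons y _ ih => exact ih.trans (seqLength_le_cons y _)
  | cons_cons y h _ => exact seqLength_cons_sublist h y

/-- The subcomplex of `ΔCau^ℓ(X)` of all simplices `((x₀, t₀) < ⋯ < (xₙ, tₙ))` with
`d(x₀, …, xₙ) < ℓ`. The list `c` is the increasing enumeration of the simplex `σ`. -/
def shortComplex (X : Type u) [MetricSpace X] (ℓ : ℝ) :
    PreAbstractSimplicialComplex (TotalCausalPoset X ℓ) where
  faces := {σ | σ.Nonempty ∧ ∃ c : List (TotalCausalPoset X ℓ), c.Pairwise (· < ·) ∧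
    (∀ p, p ∈ c ↔ p ∈ σ) ∧ seqLength (c.map TotalCausalPoset.point) < ℓ}
  isRelLowerSet_faces := by
    classical
    rintro σ ⟨hne, c, hc, hmem, hlen⟩
    refine ⟨hne, fun τ hτ hτne => ⟨hτne, c.filter (· ∈ τ), hc.filter _, fun p => ?_, ?_⟩⟩
    · rw [List.mem_filter, hmem]
      simpa using fun hp => hτ hp
    · exact (seqLength_sublist (List.filter_sublist.map _)).trans_lt hlen

/-- The simplices of `shortComplex X ℓ` are simplices of the order complex. -/
theorem shortComplex_le (X : Type u) [MetricSpace X] (ℓ : ℝ) :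
    shortComplex X ℓ ≤ orderComplex (TotalCausalPoset X ℓ) := by
  rintro σ ⟨hne, c, hc, hmem, -⟩
  refine ⟨hne, fun p hp q hq hpq => ?_⟩
  have hp' := (hmem p).2 hp
  have hq' := (hmem q).2 hq
  have : Std.Symm (fun a b : TotalCausalPoset X ℓ => a ≤ b ∨ b ≤ a) := ⟨fun _ _ h => h.symm⟩
  exact List.Pairwise.forall_of_forall (R := fun a b : TotalCausalPoset X ℓ => a ≤ b ∨ b ≤ a)
    (fun _ _ => Or.inl le_rfl) (hc.imp fun h => Or.inl h.le) hp' hq'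

/-- The (total) magnitude homotopy type `M^ℓ(X) = |ΔCau^ℓ(X)| / |Δ'Cau^ℓ(X)|`, where
`Δ'Cau^ℓ(X)` is `shortComplex X ℓ`. -/
abbrev MagnitudeHomotopyType (X : Type u) [MetricSpace X] (ℓ : ℝ) : Type u :=
  RealizationQuotient (orderComplex (TotalCausalPoset X ℓ)) (shortComplex X ℓ)

end Causal

/-! ### Reduced homology and the reduced Euler characteristic -/

section Homology

open CategoryTheory

/-- The integral singular homology functor in degree `k`. -/
noncomputable def integralHomology (k : ℕ) : TopCat.{u} ⥤ ModuleCat.{u} ℤ :=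
  (AlgebraicTopology.singularHomologyFunctor (ModuleCat.{u} ℤ) k).obj
    (ModuleCat.of ℤ (ULift.{u} ℤ))

/-- The reduced integral singular homology group in degree `k` of a (nonempty) space `M`: the
kernel of the map to the homology of a point. -/
noncomputable def reducedHomology (M : Type u) [TopologicalSpace M] (k : ℕ) :
    Submodule ℤ ((integralHomology k).obj (TopCat.of M)) :=
  LinearMap.ker ((integralHomology k).map
    (TopCat.ofHom (ContinuousMap.const M PUnit.unit) :
      TopCat.of M ⟶ TopCat.of PUnit.{u + 1})).hom

/-- All reduced homology groups are finitely generated and almost all of them vanish, so that the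
reduced Euler characteristic makes sense. -/
def HasFiniteReducedHomology (M : Type u) [TopologicalSpace M] : Prop :=
  (∀ k, Module.Finite ℤ (reducedHomology M k)) ∧ ∃ N, ∀ k, N ≤ k → reducedHomology M k = ⊥

/-- The reduced Euler characteristic: the alternating sum of the ranks of the reduced homology
groups. -/
noncomputable def reducedEulerChar (M : Type u) [TopologicalSpace M] : ℤ :=
  ∑ᶠ k : ℕ, (-1) ^ k * (Module.finrank ℤ (reducedHomology M k) : ℤ)

end Homology

/-! ### Gluing and sycamore twists -/

section Gluing

/-- `y` projects to the subspace `K`. -/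
def ProjectsTo {H : Type*} [MetricSpace H] (K : Set H) (y : H) : Prop :=
  ∃ p ∈ K, ∀ k ∈ K, dist k y = dist k p + dist p y

/-- The biased points with respect to a subspace `K`: the points outside `K` that project to
`K`. -/
def biasedPoints {H : Type*} [MetricSpace H] (K : Set H) : Set H :=
  {y | y ∉ K ∧ ProjectsTo K y}

/-- The neutral (non-biased) points: the complement of `K` and of the biased points. -/
def neutralPoints {H : Type*} [MetricSpace H] (K : Set H) : Set H :=
  (K ∪ biasedPoints K)ᶜ

/-- The gluing of two finite metric spaces is finite. Here `Metric.GlueSpace hG hH` is Mathlib's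
gluing of `G` and `H` along `iG k ∼ iH k`, `k : K`, with
`d(x, y) = inf_k (d(x, iG k) + d(iH k, y))` for `x` in `G` and `y` in `H`. -/
instance finite_glueSpace {G H K : Type*} [MetricSpace G] [MetricSpace H] [MetricSpace K]
    [Nonempty K] [Finite G] [Finite H] {iG : K → G} {iH : K → H}
    (hG : Isometry iG) (hH : Isometry iH) : Finite (Metric.GlueSpace hG hH) :=
  Finite.of_surjective (Sum.elim (Metric.toGlueL hG hH) (Metric.toGlueR hG hH)) (by
    rintro ⟨x | y⟩
    · exact ⟨Sum.inl x, rfl⟩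
    · exact ⟨Sum.inr y, rfl⟩)

end Gluing

/-! The first claim reduces to the second: for every finite metric space and every ℓ ≥ 0, the
reduced Euler characteristic of the magnitude homotopy type is the coefficient of q^ℓ in the
magnitude (`reducedEulerChar_magnitudeHomotopyType`).

Both numbers count, with sign (-1)^n, the sequences x_0, …, x_n of length exactly ℓ in which
consecutive points are distinct; there are finitely many, since nonzero distances are bounded below.
On the magnitude side, the magnitude is the total of a weighting w, and w(x) = 1 - ∑_{y ≠ x}
q^{d(x,y)} w(y) can be iterated (`exists_finset_pathsFrom`). On the topological side, a chain
between (a, 0) and (b, ℓ) has length at most ℓ, and equality forces it to run from (a, 0) to (b, ℓ)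
with every time step equal to the distance covered. The simplices that survive in the quotient are
therefore determined by their points in X (`exists_finset_longSimplices`).

It remains to see that attaching an n-cell changes the Euler characteristic of singular homology by
(-1)^n (`CellAttachment.hasEuler`). This is Mayer–Vietoris for the open cell and the complement of
its center, which meet in a copy of ℝⁿ minus the origin; the Euler characteristic of that space
follows inductively, again from Mayer–Vietoris. Mayer–Vietoris itself rests on replacing singular
chains by small ones through barycentric subdivision (`exists_small_add_boundary`).

For the invariance of the magnitude (`magnitude_sycamoreTwist`), a weighting of X is turned into one
of Y with the same total. Let b be a point of H outside K. If b projects to k, then on G the column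
of b in the matrix is q^{d(k,b)} times the column of k, and the twist only replaces k by α⁻¹(k). If
b is neutral, its column does not change on G. So it suffices to keep the weights outside G and to
move the mass q^{d(k,b)} w(b), for each biased b, from the point α⁻¹(k) of G to the point k
(`exists_twisted_weighting`). -/

/-! ### Euler characteristics of graded abelian groups and of chain complexes -/

section EulerAlgebra

open CategoryTheory

universe v

set_option linter.unusedSectionVars false

variable {R : Type} [CommRing R] [IsDomain R] [IsNoetherianRing R]

/-- A graded abelian group, finitely generated in each degree and zero in large degrees, whose
alternating sum of ranks is `χ`. -/
def HasEulerNumber (A : ℕ → ModuleCat.{v} R) (χ : ℤ) : Prop :=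
  (∀ k, Module.Finite R (A k)) ∧ ∃ N, ∀ n, N ≤ n → Subsingleton (A n) ∧
    ∑ k ∈ Finset.range n, (-1 : ℤ) ^ k * (Module.finrank R (A k) : ℤ) = χ

theorem HasEulerNumber.congr {A : ℕ → ModuleCat.{v} R} {B : ℕ → ModuleCat.{u} R} {χ : ℤ}
    (h : HasEulerNumber A χ) (e : ∀ k, A k ≃ₗ[R] B k) : HasEulerNumber B χ := by
  obtain ⟨hf, N, hN⟩ := h
  refine ⟨fun k => ?_, N, fun n hn => ⟨?_, ?_⟩⟩
  · have := hf k
    exact Module.Finite.equiv (e k)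
  · have := (hN n hn).1
    exact (e n).symm.injective.subsingleton
  · rw [← (hN n hn).2]
    exact Finset.sum_congr rfl fun k _ => by rw [(e k).finrank_eq]

theorem HasEulerNumber.of_subsingleton {A : ℕ → ModuleCat.{v} R} (h : ∀ k, Subsingleton (A k)) :
    HasEulerNumber A 0 := by
  refine ⟨fun k => ?_, 0, fun n _ => ⟨h n, Finset.sum_eq_zero fun k _ => ?_⟩⟩
  · have := h k
    infer_instance
  · have := h k
    rw [Module.finrank_zero_of_subsingleton]
    simp

/-- A long exact sequence `⋯ → A k → B k → C k → A (k - 1) → ⋯ → C 0 → 0`. -/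
structure LongExact (A B C : ℕ → ModuleCat.{v} R) where
  f : ∀ k, A k →ₗ[R] B k
  g : ∀ k, B k →ₗ[R] C k
  δ : ∀ k, C (k + 1) →ₗ[R] A k
  exact_fg : ∀ k, Function.Exact (f k) (g k)
  exact_gδ : ∀ k, Function.Exact (g (k + 1)) (δ k)
  exact_δf : ∀ k, Function.Exact (δ k) (f k)
  surjective : Function.Surjective (g 0)

/-- Over a Noetherian ring the range of `g` is again finite, so `N` is an extension of one finite
module by a quotient of another. -/
theorem Module.Finite.of_exact_of_isNoetherian {M N P : Type*} [AddCommGroup M] [AddCommGroup N]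
    [AddCommGroup P] [Module R M] [Module R N] [Module R P] [Module.Finite R M] [Module.Finite R P] {f : M →ₗ[R] N}
    {g : N →ₗ[R] P} (h : Function.Exact f g) : Module.Finite R N :=
  Module.Finite.of_exact (g := g.rangeRestrict)
    (fun x => by rw [← h x]; simp [Subtype.ext_iff]) g.surjective_rangeRestrict

theorem finrank_eq_range_add_range {M N P : Type*} [AddCommGroup M] [AddCommGroup N]
    [AddCommGroup P] [Module R M] [Module R N] [Module R P] [Module.Finite R N] {f : M →ₗ[R] N}
    {g : N →ₗ[R] P} (h : Function.Exact f g) :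
    Module.finrank R N = Module.finrank R (LinearMap.range f) +
      Module.finrank R (LinearMap.range g) := by
  have h1 := Submodule.finrank_quotient_add_finrank (LinearMap.ker g)
  rw [g.quotKerEquivRange.finrank_eq, LinearMap.exact_iff.1 h] at h1
  omega

namespace LongExact

variable {A B C : ℕ → ModuleCat.{v} R} (S : LongExact A B C)
include S

theorem finite_middle (hA : ∀ k, Module.Finite R (A k)) (hC : ∀ k, Module.Finite R (C k)) (k : ℕ) :
    Module.Finite R (B k) :=
  have := hA k
  have := hC k
  Module.Finite.of_exact_of_isNoetherian (R := R) (S.exact_fg k)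

theorem finite_right (hA : ∀ k, Module.Finite R (A k)) (hB : ∀ k, Module.Finite R (B k)) (k : ℕ) :
    Module.Finite R (C k) := by
  have := hB k
  cases k with
  | zero => exact Module.Finite.of_surjective _ S.surjective
  | succ k =>
    have := hA k
    exact Module.Finite.of_exact_of_isNoetherian (R := R) (S.exact_gδ k)

/-- Writing each rank as a sum of the ranks of two adjacent images makes the alternating sum
telescope. Truncation in degree `n` leaves only the image of the connecting map that enters `A n`.
-/
theorem sum_rank (hA : ∀ k, Module.Finite R (A k)) (hB : ∀ k, Module.Finite R (B k))
    (hC : ∀ k, Module.Finite R (C k)) (n : ℕ) :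
    ∑ k ∈ Finset.range (n + 1), (-1 : ℤ) ^ k * (Module.finrank R (A k) : ℤ) -
      ∑ k ∈ Finset.range (n + 1), (-1 : ℤ) ^ k * (Module.finrank R (B k) : ℤ) +
      ∑ k ∈ Finset.range (n + 1), (-1 : ℤ) ^ k * (Module.finrank R (C k) : ℤ) =
    (-1) ^ n * (Module.finrank R (LinearMap.range (S.δ n)) : ℤ) := by
  induction n with
  | zero =>
    have := hA 0
    have := hB 0
    have := hC 0
    have e1 := finrank_eq_range_add_range (f := S.δ 0) (g := S.f 0) (S.exact_δf 0)
    have e2 := finrank_eq_range_add_range (S.exact_fg 0)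
    have e3 : Module.finrank R (LinearMap.range (S.g 0)) = Module.finrank R (C 0) := by
      rw [LinearMap.range_eq_top.2 S.surjective]
      exact finrank_top R (C 0)
    simp
    omega
  | succ n ih =>
    have := hA (n + 1)
    have := hB (n + 1)
    have := hC (n + 1)
    have e1 := finrank_eq_range_add_range (f := S.δ (n + 1)) (S.exact_δf (n + 1))
    have e2 := finrank_eq_range_add_range (S.exact_fg (n + 1))
    have e3 := finrank_eq_range_add_range (S.exact_gδ n)
    rw [Finset.sum_range_succ _ (n + 1), Finset.sum_range_succ _ (n + 1),
      Finset.sum_range_succ _ (n + 1), e1, e2, e3]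
    push_cast
    rw [pow_succ]
    linear_combination ih

theorem euler_right {a b : ℤ} (hA : HasEulerNumber A a) (hB : HasEulerNumber B b) :
    HasEulerNumber C (b - a) := by
  have hfC := S.finite_right hA.1 hB.1
  have hsum := S.sum_rank hA.1 hB.1 hfC
  obtain ⟨hfA, N, hN⟩ := hA
  obtain ⟨hfB, M, hM⟩ := hB
  -- The extra 1 is needed because `C (n + 1)` lies between `B (n + 1)` and `A n`: the vanishing of
  -- `A` is used one degree lower.
  refine ⟨hfC, max N M + 1, fun n hn => ?_⟩
  obtain ⟨n, rfl⟩ : ∃ m, n = m + 1 := ⟨n - 1, by omega⟩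
  have hA := hN (n + 1) (by omega)
  have hB := hM (n + 1) (by omega)
  have hA' := (hN n (by omega)).1
  have hB' := hB.1
  constructor
  · refine ⟨fun x y => ?_⟩
    have key : ∀ z : C (n + 1), z = 0 := fun z => by
      obtain ⟨w, rfl⟩ := (S.exact_gδ n z).1 (Subsingleton.elim _ _)
      rw [Subsingleton.elim w 0, map_zero]
    rw [key x, key y]
  · have h := hsum n
    have h0 : Module.finrank R (LinearMap.range (S.δ n)) = 0 :=
      Module.finrank_zero_of_subsingleton
    rw [hA.2, hB.2, h0] at h
    push_cast at h
    linarith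

theorem euler_middle {a c : ℤ} (hA : HasEulerNumber A a) (hC : HasEulerNumber C c) :
    HasEulerNumber B (a + c) := by
  have hfB := S.finite_middle hA.1 hC.1
  have hsum := S.sum_rank hA.1 hfB hC.1
  obtain ⟨hfA, N, hN⟩ := hA
  obtain ⟨hfC, M, hM⟩ := hC
  refine ⟨hfB, max N M + 1, fun n hn => ?_⟩
  obtain ⟨n, rfl⟩ : ∃ m, n = m + 1 := ⟨n - 1, by omega⟩
  have hA := hN (n + 1) (by omega)
  have hC := hM (n + 1) (by omega)
  have hA' := (hN n (by omega)).1
  have hA'' := hA.1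
  have hC' := hC.1
  constructor
  · refine ⟨fun x y => ?_⟩
    have key : ∀ z : B (n + 1), z = 0 := fun z => by
      obtain ⟨w, rfl⟩ := (S.exact_fg (n + 1) z).1 (Subsingleton.elim _ _)
      rw [Subsingleton.elim w 0, map_zero]
    rw [key x, key y]
  · have h := hsum n
    have h0 : Module.finrank R (LinearMap.range (S.δ n)) = 0 :=
      Module.finrank_zero_of_subsingleton
    rw [hA.2, hC.2, h0] at h
    push_cast at h
    linarith

end LongExact

/-- The long exact homology sequence of a short exact sequence of chain complexes. -/
noncomputable def LongExact.ofShortExact {S : ShortComplex (ChainComplex (ModuleCat.{v} R) ℕ)}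
    (hS : S.ShortExact) :
    LongExact (fun k => S.X₁.homology k) (fun k => S.X₂.homology k) (fun k => S.X₃.homology k) where
  f k := (HomologicalComplex.homologyMap S.f k).hom
  g k := (HomologicalComplex.homologyMap S.g k).hom
  δ k := (hS.δ (k + 1) k rfl).hom
  exact_fg k := (ShortComplex.ShortExact.moduleCat_exact_iff_function_exact _).1
    (hS.homology_exact₂ k)
  exact_gδ k := (ShortComplex.ShortExact.moduleCat_exact_iff_function_exact _).1
    (hS.homology_exact₃ (k + 1) k rfl)
  exact_δf k := (ShortComplex.ShortExact.moduleCat_exact_iff_function_exact _).1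
    (hS.homology_exact₁ (k + 1) k rfl)
  surjective := by
    have := hS.epi_g
    have h : Epi (HomologicalComplex.homologyMap S.g 0) :=
      HomologicalComplex.epi_homologyMap_of_epi_of_not_rel S.g 0 (by simp)
    exact (ModuleCat.epi_iff_surjective _).1 h

end EulerAlgebra

/-! ### Barycentric subdivision of singular chains -/

section Subdivision

open Finsupp

/-- The affine map between standard simplices with prescribed images of the vertices. -/
noncomputable def affineMap {m n : ℕ} (v : Fin m → stdSimplex ℝ (Fin n)) :
    C(stdSimplex ℝ (Fin m), stdSimplex ℝ (Fin n)) where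
  toFun w := ⟨fun j => ∑ i, w i * v i j, fun j => Finset.sum_nonneg fun i _ =>
    mul_nonneg (w.2.1 i) ((v i).2.1 j), by
      rw [Finset.sum_comm]
      simp_rw [← Finset.mul_sum]
      rw [← w.2.2]
      exact Finset.sum_congr rfl fun i _ => by
        rw [show ∑ j, v i j = 1 from (v i).2.2, mul_one]; rfl⟩
  continuous_toFun := by
    refine Continuous.subtype_mk (continuous_pi fun j => continuous_finsetSum _ fun i _ => ?_) _
    exact ((continuous_apply i).comp continuous_subtype_val).mul continuous_const

theorem affineMap_apply {m n : ℕ} (v : Fin m → stdSimplex ℝ (Fin n))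
    (w : stdSimplex ℝ (Fin m)) (j : Fin n) : affineMap v w j = ∑ i, w i * v i j := rfl

theorem affineMap_affineMap {l m n : ℕ} (v : Fin m → stdSimplex ℝ (Fin n))
    (u : Fin l → stdSimplex ℝ (Fin m)) (w : stdSimplex ℝ (Fin l)) :
    affineMap v (affineMap u w) = affineMap (fun i => affineMap v (u i)) w := by
  ext j
  simp_rw [affineMap_apply, Finset.mul_sum, Finset.sum_mul]
  rw [Finset.sum_comm]
  simp_rw [mul_assoc]

theorem affineMap_vertex {m n : ℕ} (v : Fin m → stdSimplex ℝ (Fin n)) (i : Fin m) :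
    affineMap v (stdSimplex.vertex i) = v i := by
  ext j
  simp [affineMap_apply, Pi.single_apply]

theorem affineMap_vertices {n : ℕ} :
    affineMap (fun i : Fin n => stdSimplex.vertex i) = ContinuousMap.id _ := by
  ext w j
  simp [affineMap_apply, Pi.single_apply]

theorem stdSimplex_map_eq_affineMap {m n : ℕ} (g : Fin m → Fin n) (w : stdSimplex ℝ (Fin m)) :
    stdSimplex.map g w = affineMap (fun i => stdSimplex.vertex (g i)) w := by
  ext j
  simp [affineMap_apply, Pi.single_apply, stdSimplex.map_coe, FunOnFinite.linearMap_apply_apply,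
    Finset.sum_filter, eq_comm]

/-- Integral combinations of tuples of `m` points of the standard simplex on `n` vertices. -/
abbrev TupleChain (n m : ℕ) : Type := (Fin m → stdSimplex ℝ (Fin n)) →₀ ℤ

/-- Integral combinations of singular simplices with `m` vertices. -/
abbrev SingChain (X : Type u) [TopologicalSpace X] (m : ℕ) : Type u :=
  C(stdSimplex ℝ (Fin m), X) →₀ ℤ

/-- The inclusion of a face of the standard simplex. -/
noncomputable def faceInclusion {m : ℕ} (i : Fin (m + 1)) :
    C(stdSimplex ℝ (Fin m), stdSimplex ℝ (Fin (m + 1))) :=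
  ⟨stdSimplex.map i.succAbove, stdSimplex.continuous_map _⟩

variable {X : Type u} [TopologicalSpace X] {n m : ℕ}

/-- The boundary operator of singular chains (with augmentation). -/
noncomputable def singBoundary : SingChain X (m + 1) →ₗ[ℤ] SingChain X m :=
  linearCombination ℤ fun σ => ∑ i : Fin (m + 1), (-1 : ℤ) ^ (i : ℕ) •
    single (σ.comp (faceInclusion i)) (1 : ℤ)

/-- The boundary operator of combinations of tuples. -/
noncomputable def tupleBoundary : TupleChain n (m + 1) →ₗ[ℤ] TupleChain n m :=
  linearCombination ℤ fun v => ∑ i : Fin (m + 1), (-1 : ℤ) ^ (i : ℕ) •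
    single (fun j => v (i.succAbove j)) (1 : ℤ)

theorem singBoundary_single (σ : C(stdSimplex ℝ (Fin (m + 1)), X)) :
    singBoundary (single σ 1) = ∑ i : Fin (m + 1), (-1 : ℤ) ^ (i : ℕ) •
      single (σ.comp (faceInclusion i)) (1 : ℤ) := by
  simp [singBoundary]

theorem tupleBoundary_single (v : Fin (m + 1) → stdSimplex ℝ (Fin n)) :
    tupleBoundary (single v 1) = ∑ i : Fin (m + 1), (-1 : ℤ) ^ (i : ℕ) •
      single (fun j => v (i.succAbove j)) (1 : ℤ) := by
  simp [tupleBoundary]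

/-- The cone with apex `b`. -/
noncomputable def cone (b : stdSimplex ℝ (Fin n)) : TupleChain n m →ₗ[ℤ] TupleChain n (m + 1) :=
  lmapDomain ℤ ℤ fun v => (Fin.cons b v : Fin (m + 1) → stdSimplex ℝ (Fin n))

theorem cone_single (b : stdSimplex ℝ (Fin n)) (v : Fin m → stdSimplex ℝ (Fin n)) :
    cone b (single v 1) = single (Fin.cons b v : Fin (m + 1) → stdSimplex ℝ (Fin n)) 1 := by
  simp [cone]

/-- Deleting the apex returns the tuple; deleting any other vertex shifts its index by one, whence
the minus sign. -/
theorem tupleBoundary_cone (b : stdSimplex ℝ (Fin n)) (c : TupleChain n (m + 1)) :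
    tupleBoundary (cone b c) = c - cone b (tupleBoundary c) := by
  induction c using Finsupp.induction_linear with
  | zero => simp
  | add x y hx hy => rw [map_add, map_add, hx, hy, map_add, map_add]; abel
  | single v r =>
    rw [← mul_one r, ← smul_eq_mul, ← smul_single]
    simp only [map_smul]
    rw [← smul_sub]
    congr 1
    rw [cone_single, tupleBoundary_single, Fin.sum_univ_succ, tupleBoundary_single, map_sum,
      sub_eq_add_neg, ← Finset.sum_neg_distrib]
    congr 1
    · simp
    · refine Finset.sum_congr rfl fun i _ => ?_
      rw [map_smul, cone_single, Fin.val_succ, pow_succ, mul_neg_one, neg_smul]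
      congr 3
      ext j : 1
      refine Fin.cases ?_ (fun j => ?_) j <;> simp

/-- Degrees count vertices, so degree zero is the augmentation, spanned by the empty tuple. There
the correction term of the cone formula is absent. -/
theorem tupleBoundary_cone_zero (b : stdSimplex ℝ (Fin n)) (c : TupleChain n 0) :
    tupleBoundary (cone b c) = c := by
  induction c using Finsupp.induction_linear with
  | zero => simp
  | add x y hx hy => rw [map_add, map_add, hx, hy]
  | single v r =>
    rw [← mul_one r, ← smul_eq_mul, ← smul_single]
    simp only [map_smul]
    rw [cone_single, tupleBoundary_single]
    simp

/-- Every nonempty tuple is a cone over its tail, so that the cone formula and induction give ∂∂ =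
0. -/
theorem single_eq_cone (v : Fin (m + 1) → stdSimplex ℝ (Fin n)) :
    single v (1 : ℤ) = cone (v 0) (single (Fin.tail v) 1) := by
  rw [cone_single, Fin.cons_self_tail]

theorem tupleBoundary_tupleBoundary (c : TupleChain n (m + 2)) :
    tupleBoundary (tupleBoundary c) = 0 := by
  induction m with
  | zero =>
    induction c using Finsupp.induction_linear with
    | zero => simp
    | add x y hx hy => rw [map_add, map_add, hx, hy, add_zero]
    | single v r =>
      rw [← mul_one r, ← smul_eq_mul, ← smul_single]
      simp only [map_smul]
      rw [single_eq_cone, tupleBoundary_cone, map_sub, tupleBoundary_cone_zero, sub_self, smul_zero]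
  | succ m ih =>
    induction c using Finsupp.induction_linear with
    | zero => simp
    | add x y hx hy => rw [map_add, map_add, hx, hy, add_zero]
    | single v r =>
      rw [← mul_one r, ← smul_eq_mul, ← smul_single]
      simp only [map_smul]
      rw [single_eq_cone, tupleBoundary_cone, map_sub, tupleBoundary_cone, ih, map_zero, sub_zero,
        sub_self, smul_zero]

/-- The barycenter of a nonempty tuple. -/
noncomputable def bary (v : Fin (m + 1) → stdSimplex ℝ (Fin n)) : stdSimplex ℝ (Fin n) :=
  affineMap v stdSimplex.barycenter

/-- Barycentric subdivision of tuples. -/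
noncomputable def subdiv (n : ℕ) : ∀ m, TupleChain n m →ₗ[ℤ] TupleChain n m
  | 0 => LinearMap.id
  | m + 1 => linearCombination ℤ fun v =>
      cone (bary v) (subdiv n m (tupleBoundary (single v 1)))

/-- The chain homotopy between barycentric subdivision and the identity. -/
noncomputable def subdivHomotopy (n : ℕ) : ∀ m, TupleChain n m →ₗ[ℤ] TupleChain n (m + 1)
  | 0 => 0
  | m + 1 => linearCombination ℤ fun v =>
      cone (bary v) (subdiv n (m + 1) (single v 1) - single v 1 -
        subdivHomotopy n m (tupleBoundary (single v 1)))

theorem subdiv_single (v : Fin (m + 1) → stdSimplex ℝ (Fin n)) :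
    subdiv n (m + 1) (single v 1) =
      cone (bary v) (subdiv n m (tupleBoundary (single v 1))) := by
  simp [subdiv]

theorem subdivHomotopy_single (v : Fin (m + 1) → stdSimplex ℝ (Fin n)) :
    subdivHomotopy n (m + 1) (single v 1) =
      cone (bary v) (subdiv n (m + 1) (single v 1) - single v 1 -
        subdivHomotopy n m (tupleBoundary (single v 1))) := by
  simp [subdivHomotopy]

theorem tupleBoundary_subdiv (c : TupleChain n (m + 1)) :
    tupleBoundary (subdiv n (m + 1) c) = subdiv n m (tupleBoundary c) := by
  induction m with
  | zero =>
    induction c using Finsupp.induction_linear with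
    | zero => simp
    | add x y hx hy => simp only [map_add, hx, hy]
    | single v r =>
      rw [← mul_one r, ← smul_eq_mul, ← smul_single]
      simp only [map_smul]
      rw [subdiv_single, tupleBoundary_cone_zero]
  | succ m ih =>
    induction c using Finsupp.induction_linear with
    | zero => simp
    | add x y hx hy => simp only [map_add, hx, hy]
    | single v r =>
      rw [← mul_one r, ← smul_eq_mul, ← smul_single]
      simp only [map_smul]
      rw [subdiv_single, tupleBoundary_cone, ih, tupleBoundary_tupleBoundary, map_zero, map_zero,
        sub_zero]

/-- The chain coned off in the definition of `subdivHomotopy` is the prescribed boundary. It is a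
cycle by the same formula one degree lower, so the error term of the cone formula vanishes. -/
theorem tupleBoundary_subdivHomotopy (c : TupleChain n (m + 1)) :
    tupleBoundary (subdivHomotopy n (m + 1) c) + subdivHomotopy n m (tupleBoundary c) =
      subdiv n (m + 1) c - c := by
  induction m with
  | zero =>
    induction c using Finsupp.induction_linear with
    | zero => simp
    | add x y hx hy => simp only [map_add]; rw [add_sub_add_comm, ← hx, ← hy]; abel
    | single v r =>
      rw [← mul_one r, ← smul_eq_mul, ← smul_single]
      simp only [map_smul]
      rw [← smul_add, ← smul_sub]
      congr 1
      rw [subdivHomotopy_single, tupleBoundary_cone]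
      simp [subdivHomotopy, subdiv, tupleBoundary_cone_zero]
  | succ m ih =>
    induction c using Finsupp.induction_linear with
    | zero => simp
    | add x y hx hy => simp only [map_add]; rw [add_sub_add_comm, ← hx, ← hy]; abel
    | single v r =>
      rw [← mul_one r, ← smul_eq_mul, ← smul_single]
      simp only [map_smul]
      rw [← smul_add, ← smul_sub]
      congr 1
      have h := ih (tupleBoundary (single v 1))
      rw [tupleBoundary_tupleBoundary, map_zero, add_zero] at h
      rw [subdivHomotopy_single, tupleBoundary_cone, map_sub tupleBoundary, map_sub tupleBoundary,
        tupleBoundary_subdiv, h, sub_self, map_zero]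
      abel

/-- The chain map induced by an affine map. -/
noncomputable def pushTuple {l : ℕ} (v : Fin n → stdSimplex ℝ (Fin l)) :
    TupleChain n m →ₗ[ℤ] TupleChain l m :=
  lmapDomain ℤ ℤ fun u i => affineMap v (u i)

theorem pushTuple_single {l : ℕ} (v : Fin n → stdSimplex ℝ (Fin l))
    (u : Fin m → stdSimplex ℝ (Fin n)) :
    pushTuple v (single u 1) = single (fun i => affineMap v (u i)) 1 := by
  simp [pushTuple]

theorem pushTuple_cone {l : ℕ} (v : Fin n → stdSimplex ℝ (Fin l)) (b : stdSimplex ℝ (Fin n))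
    (c : TupleChain n m) : pushTuple v (cone b c) = cone (affineMap v b) (pushTuple v c) := by
  induction c using Finsupp.induction_linear with
  | zero => simp
  | add x y hx hy => simp only [map_add, hx, hy]
  | single u r =>
    rw [← mul_one r, ← smul_eq_mul, ← smul_single]
    simp only [map_smul]
    rw [cone_single, pushTuple_single, pushTuple_single, cone_single]
    congr 2
    ext j : 1
    refine Fin.cases ?_ (fun j => ?_) j <;> simp

theorem tupleBoundary_pushTuple {l : ℕ} (v : Fin n → stdSimplex ℝ (Fin l))
    (c : TupleChain n (m + 1)) :
    tupleBoundary (pushTuple v c) = pushTuple v (tupleBoundary c) := by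
  induction c using Finsupp.induction_linear with
  | zero => simp
  | add x y hx hy => simp only [map_add, hx, hy]
  | single u r =>
    rw [← mul_one r, ← smul_eq_mul, ← smul_single]
    simp only [map_smul]
    rw [pushTuple_single, tupleBoundary_single, tupleBoundary_single, map_sum]
    simp_rw [map_smul, pushTuple_single]

theorem affineMap_bary {l : ℕ} (v : Fin n → stdSimplex ℝ (Fin l))
    (u : Fin (m + 1) → stdSimplex ℝ (Fin n)) :
    affineMap v (bary u) = bary fun i => affineMap v (u i) :=
  affineMap_affineMap _ _ _

/-- Affine maps preserve barycenters and cones. This naturality is what lets the subdivision of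
tuples descend to singular simplices. -/
theorem subdiv_pushTuple {l : ℕ} (v : Fin n → stdSimplex ℝ (Fin l)) (c : TupleChain n m) :
    subdiv l m (pushTuple v c) = pushTuple v (subdiv n m c) := by
  induction m with
  | zero => simp [subdiv]
  | succ m ih =>
    induction c using Finsupp.induction_linear with
    | zero => simp
    | add x y hx hy => simp only [map_add, hx, hy]
    | single u r =>
      rw [← mul_one r, ← smul_eq_mul, ← smul_single]
      simp only [map_smul]
      rw [subdiv_single, pushTuple_cone, ← ih, ← tupleBoundary_pushTuple, pushTuple_single,
        subdiv_single, affineMap_bary]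

theorem subdivHomotopy_pushTuple {l : ℕ} (v : Fin n → stdSimplex ℝ (Fin l))
    (c : TupleChain n m) :
    subdivHomotopy l m (pushTuple v c) = pushTuple v (subdivHomotopy n m c) := by
  induction m with
  | zero => simp [subdivHomotopy]
  | succ m ih =>
    induction c using Finsupp.induction_linear with
    | zero => simp
    | add x y hx hy => simp only [map_add, hx, hy]
    | single u r =>
      rw [← mul_one r, ← smul_eq_mul, ← smul_single]
      simp only [map_smul]
      rw [subdivHomotopy_single, pushTuple_cone, map_sub (pushTuple v), map_sub (pushTuple v), ← ih,
        ← tupleBoundary_pushTuple, ← subdiv_pushTuple, pushTuple_single, subdivHomotopy_single,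
        affineMap_bary]

/-- The singular chain obtained by applying a singular simplex to a combination of tuples. -/
noncomputable def realize (σ : C(stdSimplex ℝ (Fin n), X)) : TupleChain n m →ₗ[ℤ] SingChain X m :=
  lmapDomain ℤ ℤ fun v => σ.comp (affineMap v)

theorem realize_single (σ : C(stdSimplex ℝ (Fin n), X)) (v : Fin m → stdSimplex ℝ (Fin n)) :
    realize σ (single v 1) = single (σ.comp (affineMap v)) 1 := by
  simp [realize]

theorem singBoundary_realize (σ : C(stdSimplex ℝ (Fin n), X)) (c : TupleChain n (m + 1)) :
    singBoundary (realize σ c) = realize σ (tupleBoundary c) := by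
  induction c using Finsupp.induction_linear with
  | zero => simp
  | add x y hx hy => simp only [map_add, hx, hy]
  | single u r =>
    rw [← mul_one r, ← smul_eq_mul, ← smul_single]
    simp only [map_smul]
    rw [realize_single, singBoundary_single, tupleBoundary_single, map_sum]
    simp_rw [map_smul, realize_single]
    congr 1
    refine Finset.sum_congr rfl fun i _ => ?_
    congr 2
    ext w : 1
    simp only [ContinuousMap.comp_apply, faceInclusion, ContinuousMap.coe_mk]
    rw [stdSimplex_map_eq_affineMap, affineMap_affineMap]
    simp_rw [affineMap_vertex]

/-- The tuple of all vertices. -/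
noncomputable def vertexTuple (n : ℕ) : TupleChain n n :=
  single (fun i => stdSimplex.vertex i) 1

theorem realize_vertexTuple (σ : C(stdSimplex ℝ (Fin n), X)) :
    realize σ (vertexTuple n) = single σ 1 := by
  rw [vertexTuple, realize_single, affineMap_vertices, ContinuousMap.comp_id]

theorem singBoundary_singBoundary (c : SingChain X (m + 2)) :
    singBoundary (singBoundary c) = 0 := by
  induction c using Finsupp.induction_linear with
  | zero => simp
  | add x y hx hy => rw [map_add, map_add, hx, hy, add_zero]
  | single v r =>
    rw [← mul_one r, ← smul_eq_mul, ← smul_single]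
    simp only [map_smul]
    rw [← realize_vertexTuple, singBoundary_realize, singBoundary_realize,
      tupleBoundary_tupleBoundary, map_zero, smul_zero]

/-- The operator on singular chains given by a combination of tuples in the standard simplex. -/
noncomputable def singOperator (c : TupleChain n m) : SingChain X n →ₗ[ℤ] SingChain X m :=
  linearCombination ℤ fun σ => realize σ c

theorem singOperator_single (c : TupleChain n m) (σ : C(stdSimplex ℝ (Fin n), X)) :
    singOperator c (single σ 1) = realize σ c := by
  simp [singOperator]

theorem realize_pushTuple {l : ℕ} (σ : C(stdSimplex ℝ (Fin l), X))
    (v : Fin n → stdSimplex ℝ (Fin l)) (c : TupleChain n m) :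
    realize σ (pushTuple v c) = realize (σ.comp (affineMap v)) c := by
  induction c using Finsupp.induction_linear with
  | zero => simp
  | add x y hx hy => simp only [map_add, hx, hy]
  | single u r =>
    rw [← mul_one r, ← smul_eq_mul, ← smul_single]
    simp only [map_smul]
    rw [pushTuple_single, realize_single, realize_single]
    congr 2
    ext w : 1
    simp [affineMap_affineMap]

theorem pushTuple_vertexTuple {l : ℕ} (v : Fin n → stdSimplex ℝ (Fin l)) :
    pushTuple v (vertexTuple n) = single v 1 := by
  rw [vertexTuple, pushTuple_single]
  simp_rw [affineMap_vertex]

/-- Every tuple is an affine image of the tuple of vertices, so an operator natural in affine maps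
is determined by its value there. Identities proved for tuples thereby carry over to singular
chains. -/
theorem singOperator_realize {l k : ℕ} (F : ∀ l, TupleChain l m →ₗ[ℤ] TupleChain l k)
    (hF : ∀ (l : ℕ) (v : Fin m → stdSimplex ℝ (Fin l)) (c : TupleChain m m),
      F l (pushTuple v c) = pushTuple v (F m c))
    (σ : C(stdSimplex ℝ (Fin l), X)) (c : TupleChain l m) :
    singOperator (F m (vertexTuple m)) (realize σ c) = realize σ (F l c) := by
  induction c using Finsupp.induction_linear with
  | zero => simp
  | add x y hx hy => simp only [map_add, hx, hy]
  | single v r =>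
    rw [← mul_one r, ← smul_eq_mul, ← smul_single]
    simp only [map_smul]
    rw [realize_single, singOperator_single, ← realize_pushTuple, ← hF, pushTuple_vertexTuple]

/-- Barycentric subdivision of singular chains. -/
noncomputable def singSubdiv (m : ℕ) : SingChain X m →ₗ[ℤ] SingChain X m :=
  singOperator (subdiv m m (vertexTuple m))

/-- The chain homotopy between barycentric subdivision of singular chains and the identity. -/
noncomputable def singSubdivHomotopy (m : ℕ) : SingChain X m →ₗ[ℤ] SingChain X (m + 1) :=
  singOperator (subdivHomotopy m m (vertexTuple m))

theorem singSubdiv_realize (σ : C(stdSimplex ℝ (Fin n), X)) (c : TupleChain n m) :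
    singSubdiv m (realize σ c) = realize σ (subdiv n m c) :=
  singOperator_realize (fun l => subdiv l m) (fun _ v c => subdiv_pushTuple v c) σ c

theorem singSubdivHomotopy_realize (σ : C(stdSimplex ℝ (Fin n), X)) (c : TupleChain n m) :
    singSubdivHomotopy m (realize σ c) = realize σ (subdivHomotopy n m c) :=
  singOperator_realize (fun l => subdivHomotopy l m)
    (fun _ v c => subdivHomotopy_pushTuple v c) σ c

theorem singBoundary_singSubdiv (c : SingChain X (m + 1)) :
    singBoundary (singSubdiv (m + 1) c) = singSubdiv m (singBoundary c) := by
  induction c using Finsupp.induction_linear with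
  | zero => simp
  | add x y hx hy => simp only [map_add, hx, hy]
  | single v r =>
    rw [← mul_one r, ← smul_eq_mul, ← smul_single]
    simp only [map_smul]
    rw [← realize_vertexTuple, singSubdiv_realize, singBoundary_realize, singBoundary_realize,
      singSubdiv_realize, tupleBoundary_subdiv]

theorem singBoundary_singSubdivHomotopy (c : SingChain X (m + 1)) :
    singBoundary (singSubdivHomotopy (m + 1) c) + singSubdivHomotopy m (singBoundary c) =
      singSubdiv (m + 1) c - c := by
  induction c using Finsupp.induction_linear with
  | zero => simp
  | add x y hx hy => simp only [map_add]; rw [add_sub_add_comm, ← hx, ← hy]; abel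
  | single v r =>
    rw [← mul_one r, ← smul_eq_mul, ← smul_single]
    simp only [map_smul]
    rw [← smul_add, ← smul_sub]
    congr 1
    rw [← realize_vertexTuple, singSubdivHomotopy_realize, singBoundary_realize,
      singBoundary_realize, singSubdivHomotopy_realize, singSubdiv_realize, ← map_add,
      tupleBoundary_subdivHomotopy, map_sub]

end Subdivision

/-! ### Small chains -/

section SmallChains

open Finsupp

variable {X : Type u} [TopologicalSpace X] {n m : ℕ}

/-- The chains whose simplices are each contained in a member of the family `𝒰`. -/
def smallChains (𝒰 : Set (Set X)) (m : ℕ) : Submodule ℤ (SingChain X m) :=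
  supported ℤ ℤ {σ | ∃ U ∈ 𝒰, Set.range σ ⊆ U}

theorem linearMap_mem_of_supported {ι M : Type*} [AddCommGroup M] {s : Set ι} {N : Submodule ℤ M}
    (f : (ι →₀ ℤ) →ₗ[ℤ] M) (h : ∀ i ∈ s, f (single i 1) ∈ N) {c : ι →₀ ℤ}
    (hc : c ∈ supported ℤ ℤ s) : f c ∈ N := by
  have : supported ℤ ℤ s ≤ N.comap f := by
    rw [supported_eq_span_single, Submodule.span_le]
    rintro _ ⟨i, hi, rfl⟩
    exact h i hi
  exact this hc

theorem single_mem_smallChains {𝒰 : Set (Set X)} {σ : C(stdSimplex ℝ (Fin m), X)}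
    {U : Set X} (hU : U ∈ 𝒰) (h : Set.range σ ⊆ U) : single σ (1 : ℤ) ∈ smallChains 𝒰 m :=
  single_mem_supported ℤ 1 ⟨U, hU, h⟩

theorem realize_mem_smallChains {𝒰 : Set (Set X)} {σ : C(stdSimplex ℝ (Fin n), X)}
    {U : Set X} (hU : U ∈ 𝒰) (h : Set.range σ ⊆ U) (c : TupleChain n m) :
    realize σ c ∈ smallChains 𝒰 m := by
  refine linearMap_mem_of_supported (s := Set.univ) _ (fun v _ => ?_) (by simp)
  rw [realize_single]
  exact single_mem_smallChains hU ((Set.range_comp_subset_range _ σ).trans h)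

theorem singOperator_mem_smallChains {𝒰 : Set (Set X)} (t : TupleChain n m) {c : SingChain X n}
    (hc : c ∈ smallChains 𝒰 n) : singOperator t c ∈ smallChains 𝒰 m := by
  refine linearMap_mem_of_supported _ ?_ hc
  rintro σ ⟨U, hU, h⟩
  rw [singOperator_single]
  exact realize_mem_smallChains hU h t

theorem singBoundary_mem_smallChains {𝒰 : Set (Set X)} {c : SingChain X (m + 1)}
    (hc : c ∈ smallChains 𝒰 (m + 1)) : singBoundary c ∈ smallChains 𝒰 m := by
  refine linearMap_mem_of_supported _ ?_ hc
  rintro σ ⟨U, hU, h⟩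
  rw [singBoundary_single]
  refine Submodule.sum_mem _ fun i _ => Submodule.smul_mem _ _ ?_
  exact single_mem_smallChains hU ((Set.range_comp_subset_range _ σ).trans h)

theorem dist_affineMap_le {x : stdSimplex ℝ (Fin n)} {v : Fin m → stdSimplex ℝ (Fin n)} {r : ℝ}
    (hr : 0 ≤ r) (h : ∀ i, dist x (v i) ≤ r) (p : stdSimplex ℝ (Fin m)) :
    dist x (affineMap v p) ≤ r := by
  rw [Subtype.dist_eq, dist_pi_le_iff hr]
  intro j
  have h1 : ∑ i, p i = 1 := p.2.2
  have h2 : x.1 j - (affineMap v p).1 j = ∑ i, p i * (x.1 j - (v i).1 j) := by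
    simp_rw [mul_sub, Finset.sum_sub_distrib, ← Finset.sum_mul, h1, one_mul]
    rfl
  rw [Real.dist_eq, h2]
  calc |∑ i, p i * (x.1 j - (v i).1 j)| ≤ ∑ i, |p i * (x.1 j - (v i).1 j)| :=
        Finset.abs_sum_le_sum_abs _ _
    _ ≤ ∑ i, p i * r := by
        refine Finset.sum_le_sum fun i _ => ?_
        rw [abs_mul, abs_of_nonneg (show (0 : ℝ) ≤ p i from p.2.1 i)]
        refine mul_le_mul_of_nonneg_left ?_ (p.2.1 i)
        have := (dist_pi_le_iff hr).1 (h i) j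
        rwa [Real.dist_eq] at this
    _ = r := by rw [← Finset.sum_mul, h1, one_mul]

/-- The difference between `v i` and the barycenter is the average of the `m + 1` differences `v i -
v k`; the one with `k = i` vanishes, which leaves `m` terms of size at most `r`. -/
theorem dist_bary_le {v : Fin (m + 1) → stdSimplex ℝ (Fin n)} {r : ℝ}
    (hr : 0 ≤ r) (h : ∀ i j, dist (v i) (v j) ≤ r) (i : Fin (m + 1)) :
    dist (bary v) (v i) ≤ m / (m + 1) * r := by
  have hm : (0 : ℝ) < m + 1 := by positivity
  rw [dist_comm, Subtype.dist_eq, dist_pi_le_iff (by positivity)]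
  intro j
  have h2 : (v i).1 j - (bary v).1 j = (∑ k : Fin (m + 1), ((v i).1 j - (v k).1 j)) / (m + 1) := by
    have : (bary v).1 j = (∑ k : Fin (m + 1), (v k).1 j) / (m + 1) := by
      have h3 : (bary v).1 j = ∑ k : Fin (m + 1), ((m : ℝ) + 1)⁻¹ * (v k).1 j := by
        change ∑ k : Fin (m + 1), (Fintype.card (Fin (m + 1)) : ℝ)⁻¹ * (v k).1 j = _
        simp
      rw [h3, ← Finset.mul_sum]
      ring
    rw [this, Finset.sum_sub_distrib]
    simp
    field_simp
  rw [Real.dist_eq, h2, abs_div, abs_of_pos hm, div_le_iff₀ hm]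
  calc |∑ k, ((v i).1 j - (v k).1 j)| ≤ ∑ k, |(v i).1 j - (v k).1 j| :=
        Finset.abs_sum_le_sum_abs _ _
    _ = ∑ k ∈ Finset.univ.erase i, |(v i).1 j - (v k).1 j| := by
        rw [← Finset.add_sum_erase _ _ (Finset.mem_univ i)]
        simp
    _ ≤ ∑ k ∈ Finset.univ.erase i, r := by
        refine Finset.sum_le_sum fun k _ => ?_
        have := (dist_pi_le_iff hr).1 (h i k) j
        rwa [Real.dist_eq] at this
    _ = m / (m + 1) * r * (m + 1) := by
        simp
        field_simp

/-- The tuples of points in the affine hull of `v` with mutual distances at most `r`. -/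
def closeTuples (v : Fin m → stdSimplex ℝ (Fin n)) (l : ℕ) (r : ℝ) :
    Set (Fin l → stdSimplex ℝ (Fin n)) :=
  {w | (∀ j, ∃ p, w j = affineMap v p) ∧ ∀ i j, dist (w i) (w j) ≤ r}

/-- A tuple in the subdivision is the barycenter followed by a tuple in a subdivided face, whose
points are convex combinations of the `v i` and so are no farther from the barycenter than the
farthest vertex. The bound `N` on the dimension makes the contraction factor the same for all faces
in the induction. -/
theorem subdiv_mem_closeTuples {N : ℕ} (hm : m ≤ N + 1) (v : Fin m → stdSimplex ℝ (Fin n))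
    {r : ℝ} (hr : 0 ≤ r) (h : ∀ i j, dist (v i) (v j) ≤ r) :
    subdiv n m (single v 1) ∈ supported ℤ ℤ (closeTuples v m (N / (N + 1) * r)) := by
  induction m with
  | zero => exact single_mem_supported ℤ 1 ⟨fun j => j.elim0, fun j => j.elim0⟩
  | succ m ih =>
    have hle : (m : ℝ) / (m + 1) * r ≤ N / (N + 1) * r := by
      refine mul_le_mul_of_nonneg_right ?_ hr
      rw [div_le_div_iff₀ (by positivity) (by positivity)]
      have : (m : ℝ) ≤ N := by exact_mod_cast Nat.le_of_succ_le_succ hm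
      linarith
    have hr' : 0 ≤ (N : ℝ) / (N + 1) * r := by positivity
    rw [subdiv_single, tupleBoundary_single, map_sum, map_sum]
    refine Submodule.sum_mem _ fun i _ => ?_
    rw [map_smul, map_smul]
    refine Submodule.smul_mem _ _ ?_
    refine linearMap_mem_of_supported _ ?_
      (ih (by omega) (fun j => v (i.succAbove j)) fun _ _ => h _ _)
    rintro w ⟨hw1, hw2⟩
    have hw1' : ∀ j, ∃ p, w j = affineMap v p := fun j => by
      obtain ⟨p, hp⟩ := hw1 j
      refine ⟨affineMap (fun j => stdSimplex.vertex (i.succAbove j)) p, ?_⟩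
      rw [hp, affineMap_affineMap]
      simp_rw [affineMap_vertex]
    have hb : ∀ j, dist (bary v) (w j) ≤ N / (N + 1) * r := fun j => by
      obtain ⟨p, hp⟩ := hw1' j
      rw [hp]
      exact dist_affineMap_le hr' (fun k => (dist_bary_le hr h k).trans hle) p
    rw [cone_single]
    refine single_mem_supported ℤ 1 ⟨fun j => ?_, fun j k => ?_⟩
    · refine Fin.cases ⟨stdSimplex.barycenter, rfl⟩ (fun j => ?_) j
      simpa using hw1' j
    · refine Fin.cases ?_ (fun j => ?_) j
      · refine Fin.cases ?_ (fun k => ?_) k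
        · simpa using hr'
        · simpa using hb k
      · refine Fin.cases ?_ (fun k => ?_) k
        · simpa [dist_comm] using hb j
        · simpa using hw2 j k

theorem subdiv_iterate_mem_closeTuples {N : ℕ} (hm : m ≤ N + 1)
    (v : Fin m → stdSimplex ℝ (Fin n)) {r : ℝ} (hr : 0 ≤ r) (h : ∀ i j, dist (v i) (v j) ≤ r)
    (k : ℕ) : (subdiv n m)^[k] (single v 1) ∈
      supported ℤ ℤ (closeTuples v m ((N / (N + 1) : ℝ) ^ k * r)) := by
  induction k with
  | zero =>
    refine single_mem_supported ℤ 1 ⟨fun j => ⟨stdSimplex.vertex j, (affineMap_vertex v j).symm⟩, ?_⟩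
    simpa using h
  | succ k ih =>
    rw [Function.iterate_succ_apply']
    refine linearMap_mem_of_supported _ ?_ ih
    rintro w ⟨hw1, hw2⟩
    refine supported_mono ?_ (subdiv_mem_closeTuples hm w (by positivity) hw2)
    rintro u ⟨hu1, hu2⟩
    refine ⟨fun j => ?_, fun i j => (hu2 i j).trans (le_of_eq (by ring))⟩
    obtain ⟨p, hp⟩ := hu1 j
    choose q hq using hw1
    refine ⟨affineMap q p, ?_⟩
    rw [hp, affineMap_affineMap]
    congr 2
    exact funext hq

theorem singSubdiv_iterate_realize (σ : C(stdSimplex ℝ (Fin n), X)) (c : TupleChain n m) (k : ℕ) :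
    (singSubdiv m)^[k] (realize σ c) = realize σ ((subdiv n m)^[k] c) := by
  induction k with
  | zero => rfl
  | succ k ih =>
    rw [Function.iterate_succ_apply', Function.iterate_succ_apply', ih, singSubdiv_realize]

theorem exists_singSubdiv_iterate_single_mem {𝒰 : Set (Set X)} (ho : ∀ U ∈ 𝒰, IsOpen U)
    (hc : ⋃₀ 𝒰 = Set.univ) (σ : C(stdSimplex ℝ (Fin (m + 1)), X)) :
    ∃ k, (singSubdiv (m + 1))^[k] (single σ 1) ∈ smallChains 𝒰 (m + 1) := by
  -- A Lebesgue number for the cover pulled back to the simplex: once the mesh is below `δ`, every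
  -- piece lies in one member.
  obtain ⟨δ, hδ, h⟩ := lebesgue_number_lemma_of_metric_sUnion (s := Set.univ)
    (c := (fun U => σ ⁻¹' U) '' 𝒰) isCompact_univ
    (by rintro _ ⟨U, hU, rfl⟩; exact (ho U hU).preimage σ.continuous)
    (by
      intro x _
      have : σ x ∈ ⋃₀ 𝒰 := hc ▸ Set.mem_univ _
      obtain ⟨U, hU, hx⟩ := this
      exact ⟨_, ⟨U, hU, rfl⟩, hx⟩)
  obtain ⟨r, hr0, hr⟩ : ∃ r : ℝ, 0 ≤ r ∧ ∀ i j : Fin (m + 1),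
      dist (stdSimplex.vertex i : stdSimplex ℝ (Fin (m + 1))) (stdSimplex.vertex j) ≤ r := by
    refine ⟨Metric.diam (Set.univ : Set (stdSimplex ℝ (Fin (m + 1)))), Metric.diam_nonneg,
      fun i j => Metric.dist_le_diam_of_mem isCompact_univ.isBounded trivial trivial⟩
  obtain ⟨k, hk⟩ : ∃ k : ℕ, ((m : ℝ) / (m + 1)) ^ k * r < δ := by
    have h1 : (m : ℝ) / (m + 1) < 1 := by
      rw [div_lt_one (by positivity)]
      linarith
    have := (tendsto_pow_atTop_nhds_zero_of_lt_one (by positivity) h1).mul_const r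
    rw [zero_mul] at this
    exact (this.eventually_lt_const hδ).exists
  refine ⟨k, ?_⟩
  rw [← realize_vertexTuple, singSubdiv_iterate_realize]
  refine linearMap_mem_of_supported _ ?_
    (subdiv_iterate_mem_closeTuples (N := m) le_rfl _ hr0 hr k)
  rintro w ⟨-, hw⟩
  -- The ball around the first vertex contains the whole piece, since its convex combinations are no
  -- farther away than its vertices.
  obtain ⟨_, ⟨U, hU, rfl⟩, hball⟩ := h (w 0) trivial
  rw [realize_single]
  refine single_mem_smallChains hU ?_
  rintro _ ⟨p, rfl⟩
  refine hball ?_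
  rw [Metric.mem_ball, dist_comm]
  exact (dist_affineMap_le (by positivity) (fun i => hw 0 i) p).trans_lt hk

theorem exists_singSubdiv_iterate_mem {𝒰 : Set (Set X)} (ho : ∀ U ∈ 𝒰, IsOpen U)
    (hc : ⋃₀ 𝒰 = Set.univ) (c : SingChain X (m + 1)) :
    ∃ k, (singSubdiv (m + 1))^[k] c ∈ smallChains 𝒰 (m + 1) := by
  -- Subdivision keeps small chains small, so the exponents of two summands can be raised to their
  -- maximum.
  have hmono : ∀ (c : SingChain X (m + 1)) (k l : ℕ), k ≤ l →
      (singSubdiv (m + 1))^[k] c ∈ smallChains 𝒰 (m + 1) →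
      (singSubdiv (m + 1))^[l] c ∈ smallChains 𝒰 (m + 1) := by
    intro c k l hkl h
    induction l, hkl using Nat.le_induction with
    | base => exact h
    | succ l _ ih =>
      rw [Function.iterate_succ_apply']
      exact singOperator_mem_smallChains _ ih
  induction c using Finsupp.induction_linear with
  | zero =>
    exact ⟨0, Submodule.zero_mem _⟩
  | add x y hx hy =>
    obtain ⟨k, hk⟩ := hx
    obtain ⟨l, hl⟩ := hy
    refine ⟨max k l, ?_⟩
    rw [iterate_map_add]
    exact Submodule.add_mem _ (hmono _ _ _ (le_max_left _ _) hk)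
      (hmono _ _ _ (le_max_right _ _) hl)
  | single σ r =>
    obtain ⟨k, hk⟩ := exists_singSubdiv_iterate_single_mem ho hc σ
    refine ⟨k, ?_⟩
    have h1 : single σ r = r • single σ (1 : ℤ) := by simp
    rw [h1, ← Module.End.pow_apply, map_smul, Module.End.pow_apply]
    exact Submodule.smul_mem _ _ hk

/-- A chain with small boundary is small up to a boundary. -/
theorem exists_small_add_boundary {𝒰 : Set (Set X)} (ho : ∀ U ∈ 𝒰, IsOpen U)
    (hc : ⋃₀ 𝒰 = Set.univ) (c : SingChain X (m + 1)) (hb : singBoundary c ∈ smallChains 𝒰 m) :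
    ∃ c' ∈ smallChains 𝒰 (m + 1), ∃ e, c = c' + singBoundary e := by
  -- Iterated subdivision differs from the identity by a boundary plus homotopy operators applied to
  -- subdivisions of ∂c. The latter are small because ∂c is and these operators preserve smallness.
  have key : ∀ k : ℕ, singBoundary ((singSubdiv (m + 1))^[k] c) ∈ smallChains 𝒰 m ∧
      ∃ s ∈ smallChains 𝒰 (m + 1), ∃ e, (singSubdiv (m + 1))^[k] c - c = s + singBoundary e := by
    intro k
    induction k with
    | zero => exact ⟨hb, 0, Submodule.zero_mem _, 0, by simp⟩
    | succ k ih =>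
      obtain ⟨h1, s, hs, e, he⟩ := ih
      rw [Function.iterate_succ_apply']
      constructor
      · rw [singBoundary_singSubdiv]
        exact singOperator_mem_smallChains _ h1
      · refine ⟨s + singSubdivHomotopy m (singBoundary ((singSubdiv (m + 1))^[k] c)),
          Submodule.add_mem _ hs (singOperator_mem_smallChains _ h1),
          e + singSubdivHomotopy (m + 1) ((singSubdiv (m + 1))^[k] c), ?_⟩
        have := singBoundary_singSubdivHomotopy ((singSubdiv (m + 1))^[k] c)
        rw [map_add, ← sub_add_sub_cancel _ ((singSubdiv (m + 1))^[k] c) c, ← this, he]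
        abel
  obtain ⟨k, hk⟩ := exists_singSubdiv_iterate_mem ho hc c
  obtain ⟨-, s, hs, e, he⟩ := key k
  refine ⟨(singSubdiv (m + 1))^[k] c - s, Submodule.sub_mem _ hk hs, -e, ?_⟩
  rw [map_neg, ← sub_eq_add_neg, sub_sub, ← he]
  abel

end SmallChains

/-! ### Chain complexes of modules -/

section ModuleComplex

open CategoryTheory

universe v

variable {R : Type} [CommRing R] [IsDomain R] [IsNoetherianRing R]

set_option linter.unusedSectionVars false

variable {M N P : ℕ → Type v} [∀ n, AddCommGroup (M n)] [∀ n, Module R (M n)]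
  [∀ n, AddCommGroup (N n)] [∀ n, Module R (N n)] [∀ n, AddCommGroup (P n)] [∀ n, Module R (P n)]

/-- The chain complex given by a sequence of modules and differentials. -/
noncomputable def moduleComplex (d : ∀ n, M (n + 1) →ₗ[R] M n) (hd : ∀ n x, d n (d (n + 1) x) = 0) :
    ChainComplex (ModuleCat.{v} R) ℕ :=
  ChainComplex.of (fun n => ModuleCat.of R (M n)) (fun n => ModuleCat.ofHom (d n)) fun n => by
    ext x
    exact hd n x

theorem moduleComplex_d (d : ∀ n, M (n + 1) →ₗ[R] M n) (hd : ∀ n x, d n (d (n + 1) x) = 0)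
    (n : ℕ) : (moduleComplex d hd).d (n + 1) n = ModuleCat.ofHom (d n) :=
  ChainComplex.of_d (fun n => ModuleCat.of R (M n)) (fun n => ModuleCat.ofHom (d n)) n

/-- The homology of a chain complex of modules. -/
noncomputable abbrev moduleHomology (d : ∀ n, M (n + 1) →ₗ[R] M n)
    (hd : ∀ n x, d n (d (n + 1) x) = 0) (k : ℕ) : ModuleCat.{v} R :=
  (moduleComplex d hd).homology k

/-- The chain map given by a sequence of linear maps. -/
noncomputable def moduleComplexMap {dM : ∀ n, M (n + 1) →ₗ[R] M n} {dN : ∀ n, N (n + 1) →ₗ[R] N n}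
    {hM : ∀ n x, dM n (dM (n + 1) x) = 0} {hN : ∀ n x, dN n (dN (n + 1) x) = 0}
    (f : ∀ n, M n →ₗ[R] N n) (hf : ∀ n x, dN n (f (n + 1) x) = f n (dM n x)) :
    moduleComplex dM hM ⟶ moduleComplex dN hN :=
  ChainComplex.ofHom (fun n => ModuleCat.ofHom (f n)) fun n => by
    rw [moduleComplex_d, moduleComplex_d]
    ext x
    exact hf n x

/-- The long exact sequence of a short exact sequence of chain complexes of modules. -/
noncomputable def LongExact.ofModules {dM : ∀ n, M (n + 1) →ₗ[R] M n}
    {dN : ∀ n, N (n + 1) →ₗ[R] N n} {dP : ∀ n, P (n + 1) →ₗ[R] P n}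
    (hM : ∀ n x, dM n (dM (n + 1) x) = 0) (hN : ∀ n x, dN n (dN (n + 1) x) = 0)
    (hP : ∀ n x, dP n (dP (n + 1) x) = 0)
    (f : ∀ n, M n →ₗ[R] N n) (hf : ∀ n x, dN n (f (n + 1) x) = f n (dM n x))
    (g : ∀ n, N n →ₗ[R] P n) (hg : ∀ n x, dP n (g (n + 1) x) = g n (dN n x))
    (hi : ∀ n, Function.Injective (f n)) (hs : ∀ n, Function.Surjective (g n))
    (he : ∀ n, Function.Exact (f n) (g n)) :
    LongExact (moduleHomology dM hM) (moduleHomology dN hN) (moduleHomology dP hP) :=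
  LongExact.ofShortExact (S := ShortComplex.mk (moduleComplexMap (hM := hM) (hN := hN) f hf)
    (moduleComplexMap (hM := hN) (hN := hP) g hg) (by
      ext n : 1
      refine ModuleCat.hom_ext (LinearMap.ext fun x => ?_)
      exact (he n).apply_apply_eq_zero x))
    (HomologicalComplex.shortExact_of_degreewise_shortExact _ fun n =>
      { exact := (ShortComplex.ShortExact.moduleCat_exact_iff_function_exact _).2 (he n)
        mono_f := (ModuleCat.mono_iff_injective _).2 (hi n)
        epi_g := (ModuleCat.epi_iff_surjective _).2 (hs n) })

theorem HasEulerNumber.congr_modules {dM : ∀ n, M (n + 1) →ₗ[R] M n}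
    {dN : ∀ n, N (n + 1) →ₗ[R] N n}
    {hM : ∀ n x, dM n (dM (n + 1) x) = 0} {hN : ∀ n x, dN n (dN (n + 1) x) = 0}
    (e : ∀ n, M n ≃ₗ[R] N n) (he : ∀ n x, dN n (e (n + 1) x) = e n (dM n x)) {χ : ℤ}
    (h : HasEulerNumber (moduleHomology dM hM) χ) : HasEulerNumber (moduleHomology dN hN) χ := by
  let e' : moduleComplex dM hM ≅ moduleComplex dN hN :=
    { hom := moduleComplexMap (fun n => (e n).toLinearMap) he
      inv := moduleComplexMap (fun n => (e n).symm.toLinearMap) fun n x => by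
        apply (e n).injective
        change e n (dM n ((e (n + 1)).symm x)) = e n ((e n).symm (dN n x))
        rw [← he, LinearEquiv.apply_symm_apply, LinearEquiv.apply_symm_apply]
      hom_inv_id := by
        ext n : 1
        refine ModuleCat.hom_ext (LinearMap.ext fun x => ?_)
        exact (e n).symm_apply_apply x
      inv_hom_id := by
        ext n : 1
        refine ModuleCat.hom_ext (LinearMap.ext fun x => ?_)
        exact (e n).apply_symm_apply x }
  exact h.congr fun k => ((HomologicalComplex.homologyFunctor _ _ k).mapIso e').toLinearEquiv

theorem subsingleton_moduleHomology {d : ∀ n, M (n + 1) →ₗ[R] M n}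
    (hd : ∀ n x, d n (d (n + 1) x) = 0) (h0 : Function.Surjective (d 0))
    (h : ∀ n x, d n x = 0 → ∃ y, d (n + 1) y = x) (k : ℕ) :
    Subsingleton (moduleHomology d hd k) := by
  rw [← ModuleCat.isZero_iff_subsingleton, ← HomologicalComplex.exactAt_iff_isZero_homology]
  cases k with
  | zero =>
    rw [HomologicalComplex.exactAt_iff' _ 1 0 0 (by simp) (by simp),
      ShortComplex.moduleCat_exact_iff]
    intro x _
    obtain ⟨y, hy⟩ := h0 x
    refine ⟨y, ?_⟩
    change (moduleComplex d hd).d 1 0 y = x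
    rw [moduleComplex_d d hd 0]
    exact hy
  | succ k =>
    rw [HomologicalComplex.exactAt_iff' _ (k + 2) (k + 1) k (by simp) (by simp),
      ShortComplex.moduleCat_exact_iff]
    intro x hx
    change (moduleComplex d hd).d (k + 1) k x = 0 at hx
    rw [moduleComplex_d] at hx
    obtain ⟨y, hy⟩ := h k x hx
    refine ⟨y, ?_⟩
    change (moduleComplex d hd).d (k + 2) (k + 1) y = x
    rw [moduleComplex_d]
    exact hy

theorem HasEulerNumber.prod_modules {dM : ∀ n, M (n + 1) →ₗ[R] M n}
    {dN : ∀ n, N (n + 1) →ₗ[R] N n}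
    {hM : ∀ n x, dM n (dM (n + 1) x) = 0} {hN : ∀ n x, dN n (dN (n + 1) x) = 0}
    {a b : ℤ} (ha : HasEulerNumber (moduleHomology dM hM) a)
    (hb : HasEulerNumber (moduleHomology dN hN) b) :
    HasEulerNumber (moduleHomology (fun n => (dM n).prodMap (dN n))
      (fun n x => Prod.ext (hM n x.1) (hN n x.2))) (a + b) :=
  (LongExact.ofModules hM (fun n x => Prod.ext (hM n x.1) (hN n x.2)) hN
    (fun n => LinearMap.inl R (M n) (N n)) (fun n x => by simp)
    (fun n => LinearMap.snd R (M n) (N n)) (fun n x => by simp)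
    (fun n => LinearMap.inl_injective) (fun n => LinearMap.snd_surjective)
    (fun n => Function.Exact.inl_snd)).euler_middle ha hb

end ModuleComplex

/-! ### Mayer–Vietoris for Euler characteristics -/

section MayerVietoris

open Finsupp

variable {X : Type u} [TopologicalSpace X]

/-- The singular homology of `X`, computed from the complex of chains contained in members
of `𝒰`. -/
noncomputable abbrev smallHomology (𝒰 : Set (Set X)) (k : ℕ) : ModuleCat.{u} ℤ :=
  -- The shift drops the augmentation: degree `n` is spanned by simplices with `n + 1` vertices.
  moduleHomology (M := fun n => smallChains 𝒰 (n + 1))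
    (fun _ => singBoundary.restrict fun _ => singBoundary_mem_smallChains)
    (fun _ x => Subtype.ext (singBoundary_singBoundary x.1)) k

variable (X) in
/-- The singular homology of `X`, computed from the complex of finite combinations of singular
simplices. -/
noncomputable abbrev chainHomology (k : ℕ) : ModuleCat.{u} ℤ :=
  moduleHomology (M := fun n => SingChain X (n + 1)) (fun _ => singBoundary)
    (fun _ x => singBoundary_singBoundary x) k

/-- The chain map induced by a continuous map. -/
noncomputable def singMap {Y : Type*} [TopologicalSpace Y] (f : C(X, Y)) (m : ℕ) :
    SingChain X m →ₗ[ℤ] SingChain Y m :=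
  lmapDomain ℤ ℤ fun σ => f.comp σ

theorem singMap_single {Y : Type*} [TopologicalSpace Y] (f : C(X, Y)) {m : ℕ}
    (σ : C(stdSimplex ℝ (Fin m), X)) : singMap f m (single σ 1) = single (f.comp σ) 1 := by
  simp [singMap]

theorem singBoundary_singMap {Y : Type*} [TopologicalSpace Y] (f : C(X, Y)) {m : ℕ}
    (c : SingChain X (m + 1)) :
    singBoundary (singMap f (m + 1) c) = singMap f m (singBoundary c) := by
  induction c using Finsupp.induction_linear with
  | zero => simp
  | add x y hx hy => simp only [map_add, hx, hy]
  | single u r =>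
    rw [← mul_one r, ← smul_eq_mul, ← smul_single]
    simp only [map_smul]
    rw [singMap_single, singBoundary_single, singBoundary_single, map_sum]
    simp_rw [map_smul, singMap_single]
    rfl

/-- The inclusion of a subspace. -/
def subspaceInclusion (U : Set X) : C(U, X) := ⟨Subtype.val, continuous_subtype_val⟩

theorem singMap_subspaceInclusion_injective (U : Set X) (m : ℕ) :
    Function.Injective (singMap (subspaceInclusion U) m) :=
  Finsupp.mapDomain_injective fun σ τ h => by
    ext w : 1
    exact Subtype.ext (congrArg (fun f => f w) h)

theorem range_singMap_subspaceInclusion (U : Set X) (m : ℕ) :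
    LinearMap.range (singMap (subspaceInclusion U) m) = smallChains {U} m := by
  apply le_antisymm
  · rintro _ ⟨c, rfl⟩
    refine linearMap_mem_of_supported (s := Set.univ) _ (fun σ _ => ?_) (by simp)
    rw [singMap_single]
    refine single_mem_smallChains rfl ?_
    rintro _ ⟨p, rfl⟩
    exact (σ p).2
  · intro c hc
    refine linearMap_mem_of_supported LinearMap.id ?_ hc
    rintro σ ⟨V, hV, h⟩
    obtain rfl : V = U := hV
    refine ⟨single ⟨fun p => ⟨σ p, h ⟨p, rfl⟩⟩, by fun_prop⟩ 1, ?_⟩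
    rw [singMap_single]
    rfl

theorem HasEulerNumber.smallHomology_singleton {U : Set X} {χ : ℤ}
    (h : HasEulerNumber (chainHomology U) χ) : HasEulerNumber (smallHomology {U}) χ :=
  h.congr_modules (fun n => (LinearEquiv.ofInjective _
    (singMap_subspaceInclusion_injective U (n + 1))).trans
      (LinearEquiv.ofEq _ _ (range_singMap_subspaceInclusion U (n + 1))))
    (fun _ x => Subtype.ext (singBoundary_singMap (subspaceInclusion U) x))

theorem smallChains_inter (U V : Set X) (m : ℕ) :
    smallChains {U ∩ V} m = smallChains {U} m ⊓ smallChains {V} m := by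
  rw [smallChains, smallChains, smallChains, ← supported_inter]
  congr 1
  ext σ
  simp

theorem smallChains_pair (U V : Set X) (m : ℕ) :
    smallChains {U, V} m = smallChains {U} m ⊔ smallChains {V} m := by
  rw [smallChains, smallChains, smallChains, ← supported_union]
  congr 1
  ext σ
  simp

theorem HasEulerNumber.smallHomology_pair {U V : Set X} {a b c : ℤ}
    (hU : HasEulerNumber (smallHomology {U}) a) (hV : HasEulerNumber (smallHomology {V}) b)
    (hUV : HasEulerNumber (smallHomology {U ∩ V}) c) :
    HasEulerNumber (smallHomology {U, V}) (a + b - c) := by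
  have h1 : ∀ m, smallChains {U ∩ V} m ≤ smallChains {U} m := fun m => by
    rw [smallChains_inter]; exact inf_le_left
  have h2 : ∀ m, smallChains {U ∩ V} m ≤ smallChains {V} m := fun m => by
    rw [smallChains_inter]; exact inf_le_right
  have h3 : ∀ m, smallChains {U} m ≤ smallChains {U, V} m := fun m => by
    rw [smallChains_pair]; exact le_sup_left
  have h4 : ∀ m, smallChains {V} m ≤ smallChains {U, V} m := fun m => by
    rw [smallChains_pair]; exact le_sup_right
  refine (LongExact.ofModules _ _ _
    (fun n => (Submodule.inclusion (h1 (n + 1))).prod (Submodule.inclusion (h2 (n + 1))))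
    (fun n x => rfl)
    -- The minus sign makes the kernel the diagonal copy of the chains in both `U` and `V`.
    (fun n => (Submodule.inclusion (h3 (n + 1))).coprod (-Submodule.inclusion (h4 (n + 1))))
    (fun n x => ?_) (fun n => ?_) (fun n => ?_) (fun n => ?_)).euler_right hUV (hU.prod_modules hV)
  · apply Subtype.ext
    simp
  · intro x y h
    exact Subtype.ext (congrArg (fun z => z.1.1) h)
  · rintro ⟨z, hz⟩
    have hz' := hz
    rw [smallChains_pair, Submodule.mem_sup] at hz'
    obtain ⟨x, hx, y, hy, rfl⟩ := hz'
    refine ⟨(⟨x, hx⟩, -⟨y, hy⟩), Subtype.ext ?_⟩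
    simp
  · rintro ⟨⟨x, hx⟩, ⟨y, hy⟩⟩
    simp only [LinearMap.coprod_apply, LinearMap.neg_apply, Set.mem_range, LinearMap.prod_apply,
      Subtype.ext_iff, Prod.ext_iff]
    constructor
    · intro h
      have hxy : x = y := by
        rw [← sub_eq_zero, sub_eq_add_neg]
        exact h
      subst hxy
      refine ⟨⟨x, ?_⟩, rfl, rfl⟩
      rw [smallChains_inter]
      exact ⟨hx, hy⟩
    · rintro ⟨⟨z, hz⟩, rfl, rfl⟩
      simp

/-- The quotient of all chains by the small ones is acyclic: a relative cycle has small boundary,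
hence is small up to a boundary by `exists_small_add_boundary`. -/
theorem HasEulerNumber.chainHomology_of_smallHomology {𝒰 : Set (Set X)} (hne : 𝒰.Nonempty)
    (ho : ∀ U ∈ 𝒰, IsOpen U) (hc : ⋃₀ 𝒰 = Set.univ) {χ : ℤ}
    (h : HasEulerNumber (smallHomology 𝒰) χ) : HasEulerNumber (chainHomology X) χ := by
  obtain ⟨U, hU⟩ := hne
  have hq : HasEulerNumber (moduleHomology
      (M := fun n => SingChain X (n + 1) ⧸ smallChains 𝒰 (n + 1))
      (fun n => Submodule.mapQ _ _ singBoundary fun _ => singBoundary_mem_smallChains (m := n + 1))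
      (fun n x => by
        induction x using Submodule.Quotient.induction_on with
        | H x =>
          simp only [Submodule.mapQ_apply, singBoundary_singBoundary, Submodule.Quotient.mk_zero])) 0 := by
    refine HasEulerNumber.of_subsingleton (subsingleton_moduleHomology _ ?_ ?_)
    · intro x
      induction x using Submodule.Quotient.induction_on with
      | H x =>
        -- In the bottom degree the boundary lies in the augmentation. The simplex without vertices
        -- has empty range, so it is small as soon as the cover has a member.
        obtain ⟨c, hc, e, rfl⟩ := exists_small_add_boundary (m := 0) ho hc x
          (linearMap_mem_of_supported (s := Set.univ) LinearMap.id (fun σ _ =>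
            single_mem_smallChains hU (by rintro _ ⟨p, rfl⟩; exact absurd p.2.2 (by simp))) (by simp))
        refine ⟨Submodule.Quotient.mk e, ?_⟩
        rw [Submodule.mapQ_apply, Submodule.Quotient.mk_add,
          (Submodule.Quotient.mk_eq_zero _).2 hc]
        exact (zero_add _).symm
    · intro n x hx
      induction x using Submodule.Quotient.induction_on with
      | H x =>
        rw [Submodule.mapQ_apply, Submodule.Quotient.mk_eq_zero] at hx
        obtain ⟨c, hc, e, rfl⟩ := exists_small_add_boundary (m := n + 1) ho hc x hx
        refine ⟨Submodule.Quotient.mk e, ?_⟩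
        rw [Submodule.mapQ_apply, Submodule.Quotient.mk_add,
          (Submodule.Quotient.mk_eq_zero _).2 hc]
        exact (zero_add _).symm
  rw [← add_zero χ]
  exact (LongExact.ofModules _ _ _ (fun n => (smallChains 𝒰 (n + 1)).subtype) (fun _ _ => rfl)
    (fun n => (smallChains 𝒰 (n + 1)).mkQ) (fun _ _ => rfl)
    (fun n => Submodule.subtype_injective _) (fun n => Submodule.mkQ_surjective _)
    (fun n => LinearMap.exact_subtype_mkQ _)).euler_middle h hq

theorem HasEulerNumber.mayerVietoris {U V : Set X} (hU : IsOpen U) (hV : IsOpen V)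
    (hc : U ∪ V = Set.univ) {a b c : ℤ} (ha : HasEulerNumber (chainHomology U) a)
    (hb : HasEulerNumber (chainHomology V) b)
    (hab : HasEulerNumber (chainHomology (U ∩ V : Set X)) c) :
    HasEulerNumber (chainHomology X) (a + b - c) :=
  (ha.smallHomology_singleton.smallHomology_pair hb.smallHomology_singleton
    hab.smallHomology_singleton).chainHomology_of_smallHomology (Set.insert_nonempty _ _)
    (by rintro W (rfl | rfl) <;> assumption) (by rw [Set.sUnion_pair, hc])

end MayerVietoris

/-! ### Comparison with singular homology, homotopy invariance -/

section Comparison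

open CategoryTheory Limits Finsupp Simplicial

variable (X : Type u) [TopologicalSpace X]

/-- The complex of finite combinations of singular simplices. -/
noncomputable abbrev singComplex : ChainComplex (ModuleCat.{u} ℤ) ℕ :=
  moduleComplex (M := fun n => SingChain X (n + 1)) (fun _ => singBoundary)
    (fun _ x => singBoundary_singBoundary x)

/-- The singular chain complex as defined in Mathlib. -/
noncomputable abbrev mathlibSingComplex : ChainComplex (ModuleCat.{u} ℤ) ℕ :=
  (TopCat.toSSet.obj (TopCat.of X)).chainComplex (ModuleCat.of ℤ (ULift.{u} ℤ))

variable {X} in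
/-- The map of coefficients to the chains supported on one simplex. -/
noncomputable def coeffMap {m : ℕ} (σ : C(stdSimplex ℝ (Fin m), X)) :
    ModuleCat.of ℤ (ULift.{u} ℤ) ⟶ ModuleCat.of ℤ (SingChain X m) :=
  ModuleCat.ofHom ((LinearMap.toSpanSingleton ℤ _ (single σ 1)) ∘ₗ
    (ULift.moduleEquiv (R := ℤ)).toLinearMap)

variable {X} in
theorem coeffMap_one {m : ℕ} (σ : C(stdSimplex ℝ (Fin m), X)) :
    (coeffMap σ).hom (ULift.up 1) = single σ 1 := by
  change (LinearMap.toSpanSingleton ℤ _ (single σ (1 : ℤ))) 1 = _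
  simp

theorem coeff_hom_ext {M : ModuleCat.{u} ℤ} {f g : ModuleCat.of ℤ (ULift.{u} ℤ) ⟶ M}
    (h : f.hom (ULift.up 1) = g.hom (ULift.up 1)) : f = g := by
  have : f.hom.comp (ULift.moduleEquiv (R := ℤ) (M := ℤ)).symm.toLinearMap =
      g.hom.comp (ULift.moduleEquiv (R := ℤ) (M := ℤ)).symm.toLinearMap := LinearMap.ext_ring h
  exact ModuleCat.hom_ext (LinearMap.ext fun z => LinearMap.congr_fun this z.down)

/-- The degreewise comparison map. -/
noncomputable def comparisonHom (n : ℕ) :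
    (mathlibSingComplex X).X n ⟶ ModuleCat.of ℤ (SingChain X (n + 1)) :=
  Cofan.IsColimit.desc (SSet.isColimitChainComplexXCofan _ _ n) fun x =>
    coeffMap ((TopCat.of X).toSSetObjEquiv _ x)

theorem ι_comparisonHom (n : ℕ) (x : (TopCat.toSSet.obj (TopCat.of X)) _⦋n⦌) :
    SSet.ιChainComplex _ x ≫ comparisonHom X n = coeffMap ((TopCat.of X).toSSetObjEquiv _ x) :=
  Cofan.IsColimit.fac _ _ _

variable {X} in
/-- The morphism from a free module with prescribed values on the basis. -/
noncomputable def freeDesc {m : ℕ} {M : ModuleCat.{u} ℤ} (v : C(stdSimplex ℝ (Fin m), X) → M) :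
    ModuleCat.of ℤ (SingChain X m) ⟶ M :=
  ModuleCat.ofHom (linearCombination ℤ v)

variable {X} in
theorem freeDesc_single {m : ℕ} {M : ModuleCat.{u} ℤ} (v : C(stdSimplex ℝ (Fin m), X) → M)
    (σ : C(stdSimplex ℝ (Fin m), X)) : (freeDesc v).hom (single σ 1) = v σ :=
  (linearCombination_single ℤ _ _).trans (MulAction.one_smul (self := M.isModule.toMulAction) _)

/-- The inverse of the degreewise comparison map. -/
noncomputable def comparisonInv (n : ℕ) :
    ModuleCat.of ℤ (SingChain X (n + 1)) ⟶ (mathlibSingComplex X).X n :=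
  freeDesc fun σ =>
    ((TopCat.toSSet.obj (TopCat.of X)).ιChainComplex (R := ModuleCat.of ℤ (ULift.{u} ℤ)) (n := n)
      (((TopCat.of X).toSSetObjEquiv (Opposite.op ⦋n⦌)).symm σ)).hom (ULift.up 1)

theorem coeffMap_comparisonInv (n : ℕ) (x : (TopCat.toSSet.obj (TopCat.of X)) _⦋n⦌) :
    coeffMap ((TopCat.of X).toSSetObjEquiv _ x) ≫ comparisonInv X n = SSet.ιChainComplex _ x := by
  refine coeff_hom_ext ?_
  rw [ModuleCat.hom_comp, LinearMap.comp_apply, coeffMap_one]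
  refine (freeDesc_single _ _).trans ?_
  rw [Equiv.symm_apply_apply]

/-- The degreewise comparison isomorphism. -/
noncomputable def comparisonXIso (n : ℕ) :
    (mathlibSingComplex X).X n ≅ ModuleCat.of ℤ (SingChain X (n + 1)) where
  hom := comparisonHom X n
  inv := comparisonInv X n
  hom_inv_id := by
    refine SSet.chainComplex_hom_ext fun x => ?_
    rw [← Category.assoc, ι_comparisonHom, coeffMap_comparisonInv, Category.comp_id]
  inv_hom_id := by
    refine ModuleCat.hom_ext (Finsupp.lhom_ext' fun σ => LinearMap.ext_ring ?_)
    have h := ι_comparisonHom X n (((TopCat.of X).toSSetObjEquiv _).symm σ)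
    rw [Equiv.apply_symm_apply] at h
    have h' := congrArg (fun f => f.hom (ULift.up 1)) h
    rw [coeffMap_one] at h'
    refine Eq.trans (congrArg (comparisonHom X n).hom (freeDesc_single _ _)) h'

/-- The comparison isomorphism of chain complexes. -/
noncomputable def comparisonIso : mathlibSingComplex X ≅ singComplex X :=
  HomologicalComplex.Hom.isoOfComponents (comparisonXIso X) fun i j hij => by
    obtain rfl : j + 1 = i := hij
    rw [moduleComplex_d]
    refine SSet.chainComplex_hom_ext fun x => ?_
    have h1 := ι_comparisonHom X (j + 1) x
    have h2 := SSet.ιChainComplex_d (R := ModuleCat.of ℤ (ULift.{u} ℤ)) _ x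
    change SSet.ιChainComplex _ x ≫ comparisonHom X (j + 1) ≫ _ =
      SSet.ιChainComplex _ x ≫ _ ≫ comparisonHom X j
    rw [← Category.assoc, h1, ← Category.assoc, h2, Preadditive.sum_comp]
    simp_rw [Preadditive.zsmul_comp, ι_comparisonHom]
    refine coeff_hom_ext ?_
    rw [ModuleCat.hom_comp, LinearMap.comp_apply, coeffMap_one, ModuleCat.hom_ofHom,
      singBoundary_single, ModuleCat.hom_sum, LinearMap.sum_apply]
    refine Finset.sum_congr rfl fun i _ => ?_
    rw [ModuleCat.hom_zsmul, LinearMap.smul_apply, coeffMap_one]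
    rfl

/-- The singular homology is computed by the complex of finite combinations of singular
simplices. -/
noncomputable def integralHomologyIso (k : ℕ) :
    (integralHomology k).obj (TopCat.of X) ≅ chainHomology X k :=
  (HomologicalComplex.homologyFunctor _ _ k).mapIso (comparisonIso X)

end Comparison

/-! ### Euler characteristics of spaces -/

section EulerSpaces

open CategoryTheory Limits

/-- The singular homology of the space `X` is finitely generated, vanishes in large degrees, and
has Euler characteristic `χ`. -/
def HasEuler (X : Type u) [TopologicalSpace X] (χ : ℤ) : Prop :=
  HasEulerNumber (chainHomology X) χ

variable {X Y : Type u} [TopologicalSpace X] [TopologicalSpace Y]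

theorem HasEuler.integralHomology {χ : ℤ} (h : HasEuler X χ) :
    HasEulerNumber (fun k => (integralHomology k).obj (TopCat.of X)) χ :=
  HasEulerNumber.congr h fun k => (integralHomologyIso X k).symm.toLinearEquiv

theorem HasEuler.of_integralHomology {χ : ℤ}
    (h : HasEulerNumber (fun k => (_root_.integralHomology k).obj (TopCat.of X)) χ) :
    HasEuler X χ :=
  HasEulerNumber.congr h fun k => (integralHomologyIso X k).toLinearEquiv

theorem integralHomology_map_eq_of_homotopic {f g : C(X, Y)} (h : f.Homotopic g) (k : ℕ) :
    (integralHomology k).map (TopCat.ofHom f) = (integralHomology k).map (TopCat.ofHom g) :=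
  TopCat.Homotopy.congr_homologyMap_singularChainComplexFunctor
    (f := TopCat.ofHom f) (g := TopCat.ofHom g) h.some _ k

theorem HasEuler.congr {χ : ℤ} (h : HasEuler X χ) (e : ContinuousMap.HomotopyEquiv X Y) : HasEuler Y χ := by
  refine HasEuler.of_integralHomology (HasEulerNumber.congr h.integralHomology fun k => ?_)
  refine Iso.toLinearEquiv
    { hom := (_root_.integralHomology k).map (TopCat.ofHom e.toFun)
      inv := (_root_.integralHomology k).map (TopCat.ofHom e.invFun)
      hom_inv_id := ?_
      inv_hom_id := ?_ }
  · rw [← Functor.map_comp, ← TopCat.ofHom_comp,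
      integralHomology_map_eq_of_homotopic e.left_inv, TopCat.ofHom_id, CategoryTheory.Functor.map_id]
  · rw [← Functor.map_comp, ← TopCat.ofHom_comp,
      integralHomology_map_eq_of_homotopic e.right_inv, TopCat.ofHom_id, CategoryTheory.Functor.map_id]

theorem HasEuler.mayerVietoris {U V : Set X} (hU : IsOpen U) (hV : IsOpen V)
    (hc : U ∪ V = Set.univ) {a b c : ℤ} (ha : HasEuler U a) (hb : HasEuler V b)
    (hab : HasEuler (U ∩ V : Set X) c) : HasEuler X (a + b - c) :=
  HasEulerNumber.mayerVietoris hU hV hc ha hb hab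

theorem HasEuler.of_isEmpty [IsEmpty X] : HasEuler X 0 := by
  have h : ∀ m, Subsingleton (SingChain X (m + 1)) := fun m => by
    have : IsEmpty C(stdSimplex ℝ (Fin (m + 1)), X) :=
      ⟨fun σ => isEmptyElim (σ (stdSimplex.vertex 0))⟩
    infer_instance
  refine HasEulerNumber.of_subsingleton (subsingleton_moduleHomology _ (fun x => ?_)
    fun n x _ => ?_)
  · exact ⟨0, (h _).elim _ _⟩
  · exact ⟨0, (h _).elim _ _⟩

theorem isZero_integralHomology_punit {k : ℕ} (hk : k ≠ 0) :
    IsZero ((integralHomology k).obj (TopCat.of PUnit.{u + 1})) :=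
  AlgebraicTopology.isZero_singularHomologyFunctor_of_totallyDisconnectedSpace _ _ _ _ hk

/-- The homology of a point in degree zero. -/
noncomputable def integralHomologyZeroPUnit :
    (integralHomology 0).obj (TopCat.of PUnit.{u + 1}) ≃ₗ[ℤ] ULift.{u} ℤ :=
  Iso.toLinearEquiv
    ((AlgebraicTopology.singularHomologyFunctorZeroOfTotallyDisconnectedSpace
      (ModuleCat.{u} ℤ) (ModuleCat.of ℤ (ULift.{u} ℤ)) (TopCat.of PUnit.{u + 1})).trans
      (Limits.coproductUniqueIso (β := PUnit.{u + 1}) fun _ => ModuleCat.of ℤ (ULift.{u} ℤ)))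

theorem hasEulerNumber_integralHomology_punit :
    HasEulerNumber (fun k => (integralHomology k).obj (TopCat.of PUnit.{u + 1})) 1 := by
  have hs : ∀ k, k ≠ 0 → Subsingleton ((integralHomology k).obj (TopCat.of PUnit.{u + 1})) :=
    fun k hk => ModuleCat.isZero_iff_subsingleton.1 (isZero_integralHomology_punit hk)
  refine ⟨fun k => ?_, 1, fun n hn => ⟨hs n (by omega), ?_⟩⟩
  · by_cases hk : k = 0
    · subst hk
      exact Module.Finite.equiv integralHomologyZeroPUnit.symm
    · have := hs k hk
      infer_instance
  · rw [Finset.sum_eq_single_of_mem 0 (Finset.mem_range.2 hn)]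
    · rw [integralHomologyZeroPUnit.finrank_eq, ULift.moduleEquiv.finrank_eq]
      simp
    · intro k _ hk
      have := hs k hk
      rw [Module.finrank_zero_of_subsingleton]
      simp

theorem HasEuler.punit : HasEuler PUnit.{u + 1} 1 :=
  HasEuler.of_integralHomology hasEulerNumber_integralHomology_punit

theorem HasEuler.of_contractible [ContractibleSpace X] : HasEuler X 1 := by
  obtain ⟨e⟩ := ContractibleSpace.hequiv X PUnit.{u + 1}
  exact HasEuler.punit.congr e.symm

/-- All ℤ-module structures on an abelian group coincide; `inst` is arbitrary so that the lemma fits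
whichever instance a goal contains. -/
theorem finite_submodule_int {A : Type*} [AddCommGroup A] [Module ℤ A] [Module.Finite ℤ A]
    (p : Submodule ℤ A) (inst : Module ℤ p) : Module.Finite ℤ p := by
  obtain rfl : inst = p.module := Subsingleton.elim _ _
  have : IsNoetherian ℤ A := isNoetherian_of_isNoetherianRing_of_finite ℤ _
  infer_instance

theorem finrank_ker_of_surjective {R A B : Type*} [CommRing R] [IsDomain R] [AddCommGroup A]
    [Module R A] [Module.Finite R A] [AddCommGroup B] [Module R B] (f : A →ₗ[R] B)
    (hf : Function.Surjective f) :
    Module.finrank R B + Module.finrank R (LinearMap.ker f) = Module.finrank R A := by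
  rw [← Submodule.finrank_quotient_add_finrank (LinearMap.ker f), f.quotKerEquivRange.finrank_eq,
    LinearMap.range_eq_top.2 hf, finrank_top]

theorem finrank_ker_int {A B : Type*} [AddCommGroup A] [Module ℤ A] [Module.Finite ℤ A]
    [AddCommGroup B] [Module ℤ B] (f : A →ₗ[ℤ] B) (hf : Function.Surjective f)
    (inst : Module ℤ (LinearMap.ker f)) :
    (Module.finrank ℤ (LinearMap.ker f) : ℤ) = Module.finrank ℤ A - Module.finrank ℤ B := by
  obtain rfl : inst = (LinearMap.ker f).module := Subsingleton.elim _ _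
  have h := finrank_ker_of_surjective f hf
  omega

theorem HasEuler.reduced [Nonempty X] {χ : ℤ} (h : HasEuler X χ) :
    HasFiniteReducedHomology X ∧ reducedEulerChar X = χ - 1 := by
  obtain ⟨x⟩ := ‹Nonempty X›
  obtain ⟨hf, N, hN⟩ := h.integralHomology
  obtain ⟨hf', N', hN'⟩ := hasEulerNumber_integralHomology_punit
  have hfin : ∀ k, Module.Finite ℤ (reducedHomology X k) := fun k => by
    have := hf k
    exact finite_submodule_int _ _
  have hbot : ∀ k, N ≤ k → reducedHomology X k = ⊥ := fun k hk => by
    have := (hN k hk).1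
    exact Subsingleton.elim _ _
  refine ⟨⟨hfin, N, hbot⟩, ?_⟩
  have hrank : ∀ k, (Module.finrank ℤ (reducedHomology X k) : ℤ) =
      Module.finrank ℤ ((_root_.integralHomology k).obj (TopCat.of X)) -
      Module.finrank ℤ ((_root_.integralHomology k).obj (TopCat.of PUnit.{u + 1})) := fun k => by
    have := hf k
    -- The inclusion of a point `x` splits the map to the one-point space, which is therefore
    -- surjective on homology.
    refine finrank_ker_int _ (fun z => ?_) _
    refine ⟨((_root_.integralHomology k).map (TopCat.ofHom (ContinuousMap.const PUnit x) :
      TopCat.of PUnit.{u + 1} ⟶ TopCat.of X)).hom z, ?_⟩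
    rw [← LinearMap.comp_apply, ← ModuleCat.hom_comp, ← Functor.map_comp]
    exact LinearMap.congr_fun (congrArg ModuleCat.Hom.hom
      ((_root_.integralHomology k).map_id (TopCat.of PUnit.{u + 1}))) z
  rw [reducedEulerChar, finsum_eq_sum_of_support_subset (s := Finset.range (max N N'))]
  · simp_rw [hrank, mul_sub, Finset.sum_sub_distrib]
    rw [(hN _ (le_max_left _ _)).2, (hN' _ (le_max_right _ _)).2]
  · intro k hk
    rw [Function.mem_support] at hk
    by_contra hk'
    apply hk
    have : reducedHomology X k = ⊥ := hbot k (by simp at hk'; omega)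
    have : Subsingleton (reducedHomology X k) := by rw [this]; infer_instance
    rw [Module.finrank_zero_of_subsingleton]
    simp

end EulerSpaces

/-! ### Euler characteristics of punctured Euclidean spaces and attachment of cells -/

section PuncturedSpace

theorem HasEuler.congr_homeomorph {X Y : Type u} [TopologicalSpace X] [TopologicalSpace Y] {χ : ℤ}
    (h : HasEuler X χ) (e : X ≃ₜ Y) : HasEuler Y χ :=
  h.congr e.toHomotopyEquiv

/-- A subset of a lifted subtype, as a subset of the original space. -/
def liftedSubsetHomeomorph {Z : Type*} [TopologicalSpace Z] {P : Z → Prop}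
    (U : Set (ULift.{u} {z // P z})) (A : Set Z) (h : ∀ z, z ∈ A ↔ ∃ hz : P z, ⟨⟨z, hz⟩⟩ ∈ U) :
    U ≃ₜ A where
  toFun x := ⟨x.1.down.1, (h _).2 ⟨x.1.down.2, x.2⟩⟩
  invFun a := ⟨⟨⟨a.1, ((h _).1 a.2).1⟩⟩, ((h _).1 a.2).2⟩
  left_inv _ := rfl
  right_inv _ := rfl
  continuous_toFun := by fun_prop
  continuous_invFun := by fun_prop

/-- Mayer–Vietoris for the complements of the two closed vertical half-lines from the origin. Each
is star-shaped about a point of the opposite half-line, and the intersection (E ∖ 0) × ℝ retracts to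
E ∖ 0, which gives 1 + 1 - χ. -/
theorem hasEuler_punctured_prod {E : Type} [AddCommGroup E] [TopologicalSpace E] [Module ℝ E]
    [IsTopologicalAddGroup E] [ContinuousSMul ℝ E] [T1Space E] {χ : ℤ}
    (h : ∀ (W : Type u) [TopologicalSpace W], ContinuousMap.HomotopyEquiv W {x : E // x ≠ 0} →
      HasEuler W χ) :
    HasEuler (ULift.{u} {x : E × ℝ // x ≠ 0}) (2 - χ) := by
  let U : Set (ULift.{u} {x : E × ℝ // x ≠ 0}) := {x | x.down.1.1 ≠ 0 ∨ 0 < x.down.1.2}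
  let V : Set (ULift.{u} {x : E × ℝ // x ≠ 0}) := {x | x.down.1.1 ≠ 0 ∨ x.down.1.2 < 0}
  let A : Set (E × ℝ) := {x | x.1 ≠ 0 ∨ 0 < x.2}
  let B : Set (E × ℝ) := {x | x.1 ≠ 0 ∨ x.2 < 0}
  let C : Set (E × ℝ) := {x | x.1 ≠ 0}
  have eU : U ≃ₜ A := liftedSubsetHomeomorph U A fun z => by
    refine ⟨fun hz => ⟨?_, hz⟩, fun ⟨_, hz⟩ => hz⟩
    rintro rfl
    simp [A] at hz
  have eV : V ≃ₜ B := liftedSubsetHomeomorph V B fun z => by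
    refine ⟨fun hz => ⟨?_, hz⟩, fun ⟨_, hz⟩ => hz⟩
    rintro rfl
    simp [B] at hz
  have eUV : (U ∩ V : Set _) ≃ₜ C := liftedSubsetHomeomorph (U ∩ V) C fun z => by
    refine ⟨fun hz => ⟨?_, Or.inl hz, Or.inl hz⟩, fun ⟨_, hz⟩ => ?_⟩
    · rintro rfl
      simp [C] at hz
    · rcases hz with ⟨h1 | h1, h2 | h2⟩
      · exact h1
      · exact h1
      · exact h2
      · exact absurd h1 h2.le.not_gt
  have hA : StarConvex ℝ ((0 : E), (1 : ℝ)) A := by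
    rintro ⟨x, t⟩ hx a b ha hb hab
    simp only [A, Set.mem_ofPred_eq, Prod.smul_mk, Prod.mk_add_mk, smul_zero, zero_add,
      smul_eq_mul, mul_one] at hx ⊢
    rcases hb.eq_or_lt with rfl | hb
    · right
      simp at hab
      simp [hab]
    · rcases hx with hx | hx
      · exact Or.inl (smul_ne_zero hb.ne' hx)
      · exact Or.inr (by positivity)
  have hB : StarConvex ℝ ((0 : E), (-1 : ℝ)) B := by
    rintro ⟨x, t⟩ hx a b ha hb hab
    simp only [B, Set.mem_ofPred_eq, Prod.smul_mk, Prod.mk_add_mk, smul_zero, zero_add,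
      smul_eq_mul] at hx ⊢
    rcases hb.eq_or_lt with rfl | hb
    · right
      simp at hab
      simp [hab]
    · rcases hx with hx | hx
      · exact Or.inl (smul_ne_zero hb.ne' hx)
      · exact Or.inr (by nlinarith [mul_pos_of_neg_of_neg hx (neg_lt_zero.2 hb)])
  have : ContractibleSpace A := hA.contractibleSpace ⟨(0, 1), Or.inr one_pos⟩
  have : ContractibleSpace B := hB.contractibleSpace ⟨(0, -1), Or.inr (by norm_num)⟩
  have : ContractibleSpace U := eU.contractibleSpace
  have : ContractibleSpace V := eV.contractibleSpace
  have hC : ContinuousMap.HomotopyEquiv C {x : E // x ≠ 0} :=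
    { toFun := ⟨fun z => ⟨z.1.1, z.2⟩, by fun_prop⟩
      invFun := ⟨fun x => ⟨(x.1, 0), x.2⟩, by fun_prop⟩
      left_inv := ⟨
        { toFun := fun p => ⟨(p.2.1.1, p.1.1 * p.2.1.2), p.2.2⟩
          continuous_toFun := by fun_prop
          map_zero_left := fun z => by simp
          map_one_left := fun z => by simp }⟩
      right_inv := by
        convert ContinuousMap.Homotopic.refl _
        rfl }
  have h1 : Continuous fun x : ULift.{u} {x : E × ℝ // x ≠ 0} => x.down.1.1 := by fun_prop
  have h2 : Continuous fun x : ULift.{u} {x : E × ℝ // x ≠ 0} => x.down.1.2 := by fun_prop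
  have key := HasEuler.mayerVietoris (U := U) (V := V) (X := ULift.{u} {x : E × ℝ // x ≠ 0})
    ?_ ?_ ?_ HasEuler.of_contractible HasEuler.of_contractible
    (h _ (eUV.toHomotopyEquiv.trans hC))
  · exact key
  · exact (isOpen_ne_fun h1 continuous_const).union (isOpen_lt continuous_const h2)
  · exact (isOpen_ne_fun h1 continuous_const).union (isOpen_lt h2 continuous_const)
  · rw [Set.eq_univ_iff_forall]
    rintro ⟨⟨⟨x, t⟩, hx⟩⟩
    by_cases h0 : x = 0
    · have ht : t ≠ 0 := fun ht => hx (by rw [h0, ht]; rfl)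
      rcases ht.lt_or_gt with ht | ht
      · exact Or.inr (Or.inr ht)
      · exact Or.inl (Or.inr ht)
    · exact Or.inl (Or.inl h0)

/-- The Euler characteristic of a space homotopy equivalent to `ℝⁿ` minus the origin. -/
theorem hasEuler_punctured (n : ℕ) : ∀ (W : Type u) [TopologicalSpace W],
    ContinuousMap.HomotopyEquiv W {x : Fin n → ℝ // x ≠ 0} → HasEuler W (1 - (-1) ^ n) := by
  induction n with
  | zero =>
    intro W _ e
    have : IsEmpty W := ⟨fun w => (e w).2 (Subsingleton.elim _ _)⟩
    simpa using HasEuler.of_isEmpty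
  | succ n ih =>
    intro W _ e
    let e1 : ((Fin n → ℝ) × ℝ) ≃ₜ (Fin (n + 1) → ℝ) :=
      { toFun := fun p => Fin.cons p.2 p.1
        invFun := fun x => (Fin.tail x, x 0)
        left_inv := fun p => by simp
        right_inv := fun x => by simp
        continuous_toFun := Continuous.finCons (A := fun _ => ℝ) continuous_snd continuous_fst
        continuous_invFun := by unfold Fin.tail; fun_prop }
    have e2 : {p : (Fin n → ℝ) × ℝ // p ≠ 0} ≃ₜ {x : Fin (n + 1) → ℝ // x ≠ 0} :=
      e1.subtype fun p => by
        rw [ne_eq, ne_eq, not_iff_not]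
        have h0 : e1 0 = 0 := by
          ext i
          refine Fin.cases rfl (fun i => rfl) i
        rw [← h0, e1.injective.eq_iff]
    have h := (hasEuler_punctured_prod.{u} ih).congr
      ((Homeomorph.ulift.trans e2).toHomotopyEquiv.trans e.symm)
    convert h using 1
    ring

end PuncturedSpace

/-! ### Attaching a cell: retraction of the punctured cell and change of the Euler characteristic.
-/

section CellAttachment

open Metric Topology

variable {A N : Type u} [TopologicalSpace A] [TopologicalSpace N] {n : ℕ}

/-- The space `N` is obtained from `A` by attaching an `n`-cell. -/
structure CellAttachment (A N : Type u) [TopologicalSpace A] [TopologicalSpace N] (n : ℕ) where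
  i : C(A, N)
  j : C(closedBall (0 : Fin n → ℝ) 1, N)
  f : C(sphere (0 : Fin n → ℝ) 1, A)
  isQuotientMap : IsQuotientMap (Sum.elim i j)
  i_f : ∀ s, i (f s) = j ⟨s.1, sphere_subset_closedBall s.2⟩
  injective_i : Function.Injective i
  injective_j : ∀ x y, ‖x.1‖ < 1 → ‖y.1‖ < 1 → j x = j y → x = y
  disjoint : ∀ a x, ‖x.1‖ < 1 → i a ≠ j x

namespace CellAttachment

variable (S : CellAttachment A N n)

/-- Boundary points of the ball land in the image of `A`, which misses the open cell. -/
theorem j_eq_of_norm_lt {x y : closedBall (0 : Fin n → ℝ) 1} (hx : ‖x.1‖ < 1) (h : S.j y = S.j x) :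
    y = x := by
  have hy : ‖y.1‖ ≤ 1 := mem_closedBall_zero_iff.1 y.2
  rcases hy.lt_or_eq with hy | hy
  · exact S.injective_j _ _ hy hx h
  · have := S.i_f ⟨y.1, mem_sphere_zero_iff_norm.2 hy⟩
    exact absurd (this.trans h) (S.disjoint _ _ hx)

/-- The inclusion of the open cell. -/
def openCell (x : ball (0 : Fin n → ℝ) 1) : N := S.j ⟨x.1, ball_subset_closedBall x.2⟩

theorem isOpenEmbedding_openCell : IsOpenEmbedding S.openCell := by
  refine IsOpenEmbedding.of_continuous_injective_isOpenMap ?_ ?_ ?_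
  · exact S.j.continuous.comp (by fun_prop)
  · intro x y h
    exact Subtype.ext (congrArg (fun z => z.1)
      (S.injective_j _ _ (mem_ball_zero_iff.1 x.2) (mem_ball_zero_iff.1 y.2) h))
  · intro O hO
    rw [← S.isQuotientMap.isOpen_preimage, isOpen_sum_iff]
    constructor
    · convert isOpen_empty
      rw [Set.eq_empty_iff_forall_notMem]
      rintro a ⟨x, -, hx⟩
      exact S.disjoint a _ (mem_ball_zero_iff.1 x.2) hx.symm
    · obtain ⟨O', hO', rfl⟩ := isOpen_induced_iff.1 hO
      have : Sum.inr ⁻¹' (Sum.elim S.i S.j ⁻¹' (S.openCell '' (Subtype.val ⁻¹' O'))) =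
          Subtype.val ⁻¹' (O' ∩ ball (0 : Fin n → ℝ) 1) := by
        ext x
        constructor
        · rintro ⟨y, hy, hyx⟩
          have := S.j_eq_of_norm_lt (mem_ball_zero_iff.1 y.2) hyx.symm
          subst this
          exact ⟨hy, y.2⟩
        · rintro ⟨h1, h2⟩
          exact ⟨⟨x.1, h2⟩, h1, rfl⟩
      rw [this]
      exact (hO'.inter isOpen_ball).preimage continuous_subtype_val

/-- The center of the cell. -/
def center : N := S.openCell ⟨0, by simp⟩

/-- The map from the disjoint union of `A` and the punctured cell to the complement of the
center. -/
def puncturedMap : A ⊕ {x : closedBall (0 : Fin n → ℝ) 1 // x.1 ≠ 0} → ({S.center}ᶜ : Set N) :=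
  Sum.elim (fun a => ⟨S.i a, fun h => S.disjoint a _ (by simp) h⟩)
    fun x => ⟨S.j x.1, fun h => x.2 (congrArg Subtype.val (S.j_eq_of_norm_lt (by simp) h))⟩

theorem isOpen_compl_center : IsOpen ({S.center}ᶜ : Set N) := by
  rw [← S.isQuotientMap.isOpen_preimage, isOpen_sum_iff]
  constructor
  · convert isOpen_univ
    rw [Set.eq_univ_iff_forall]
    exact fun a h => S.disjoint a _ (by simp) h
  · have : Sum.inr ⁻¹' (Sum.elim S.i S.j ⁻¹' ({S.center}ᶜ : Set N)) =
        {x : closedBall (0 : Fin n → ℝ) 1 | x.1 ≠ 0} := by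
      ext x
      simp only [Set.mem_preimage, Sum.elim_inr, Set.mem_compl_iff, Set.mem_singleton_iff,
        Set.mem_ofPred_eq, ne_eq, not_iff_not]
      constructor
      · intro h
        exact congrArg Subtype.val (S.j_eq_of_norm_lt (by simp) h)
      · intro h
        exact congrArg S.j (Subtype.ext h)
    rw [this]
    exact isOpen_ne_fun continuous_subtype_val continuous_const

/-- The quotient map from `A` and the closed cell restricts to a quotient map over the open
complement of the center. -/
theorem isQuotientMap_puncturedMap : IsQuotientMap S.puncturedMap := by
  have hcont : Continuous S.puncturedMap :=
    continuous_sumElim.2 ⟨S.i.continuous.subtype_mk _,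
      (S.j.continuous.comp continuous_subtype_val).subtype_mk _⟩
  refine (isQuotientMap_iff _).2 ⟨IsCoinducing.of_isOpen_preimage_iff_isOpen fun s =>
    ⟨fun hs => ?_, fun hs => hs.preimage hcont⟩, ?_⟩
  · rw [S.isOpen_compl_center.isOpenEmbedding_subtypeVal.isOpen_iff_image_isOpen,
      ← S.isQuotientMap.isOpen_preimage]
    rw [isOpen_sum_iff] at hs ⊢
    constructor
    · convert hs.1 using 1
      ext a
      constructor
      · rintro ⟨y, hy, hya⟩
        have : y = S.puncturedMap (Sum.inl a) := Subtype.ext hya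
        rwa [this] at hy
      · exact fun ha => ⟨_, ha, rfl⟩
    · have h0 : IsOpen {x : closedBall (0 : Fin n → ℝ) 1 | x.1 ≠ 0} :=
        isOpen_ne_fun continuous_subtype_val continuous_const
      convert h0.isOpenEmbedding_subtypeVal.isOpenMap _ hs.2 using 1
      ext x
      constructor
      · rintro ⟨y, hy, hyx⟩
        have hx : x.1 ≠ 0 := fun hx => y.2 (by
          rw [hyx]
          exact congrArg S.j (Subtype.ext hx))
        have : y = S.puncturedMap (Sum.inr ⟨x, hx⟩) := Subtype.ext hyx
        rw [this] at hy
        exact ⟨⟨x, hx⟩, hy, rfl⟩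
      · rintro ⟨y, hy, rfl⟩
        exact ⟨_, hy, rfl⟩
  · rintro ⟨y, hy⟩
    obtain ⟨x | x, rfl⟩ := S.isQuotientMap.surjective y
    · exact ⟨Sum.inl x, rfl⟩
    · exact ⟨Sum.inr ⟨x, fun hx => hy (congrArg S.j (Subtype.ext hx))⟩, rfl⟩

/-- The radial retraction of the punctured cell to its boundary. -/
noncomputable def radial (x : {x : closedBall (0 : Fin n → ℝ) 1 // x.1 ≠ 0}) :
    sphere (0 : Fin n → ℝ) 1 :=
  ⟨‖x.1.1‖⁻¹ • x.1.1, by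
    rw [mem_sphere_zero_iff_norm, norm_smul, norm_inv, norm_norm,
      inv_mul_cancel₀ (norm_ne_zero_iff.2 x.2)]⟩

theorem continuous_radial : Continuous (radial (n := n)) := by
  refine Continuous.subtype_mk ?_ _
  have h : Continuous fun x : {x : closedBall (0 : Fin n → ℝ) 1 // x.1 ≠ 0} => x.1.1 := by fun_prop
  exact (h.norm.inv₀ fun x => norm_ne_zero_iff.2 x.2).smul h

theorem radial_eq {x : {x : closedBall (0 : Fin n → ℝ) 1 // x.1 ≠ 0}} (hx : ‖x.1.1‖ = 1) :
    (radial x).1 = x.1.1 := by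
  simp [radial, hx]

/-- The radial homotopy on the punctured cell. -/
noncomputable def radialHomotopy (s : unitInterval)
    (x : {x : closedBall (0 : Fin n → ℝ) 1 // x.1 ≠ 0}) :
    {x : closedBall (0 : Fin n → ℝ) 1 // x.1 ≠ 0} :=
  ⟨⟨(s.1 + (1 - s.1) * ‖x.1.1‖⁻¹) • x.1.1, by
    have h1 : ‖x.1.1‖ ≤ 1 := mem_closedBall_zero_iff.1 x.1.2
    have h2 : 0 < ‖x.1.1‖ := norm_pos_iff.2 x.2
    have h3 := s.2.1
    have h4 := s.2.2
    have h5 : 0 ≤ (s.1 + (1 - s.1) * ‖x.1.1‖⁻¹) :=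
      add_nonneg h3 (mul_nonneg (by linarith) (by positivity))
    rw [mem_closedBall_zero_iff, norm_smul, Real.norm_of_nonneg h5, add_mul, mul_assoc,
      inv_mul_cancel₀ h2.ne']
    nlinarith⟩, by
    have h2 : 0 < ‖x.1.1‖ := norm_pos_iff.2 x.2
    have h3 := s.2.1
    have h4 := s.2.2
    refine smul_ne_zero (ne_of_gt ?_) x.2
    rcases h3.eq_or_lt with h | h
    · rw [← h]
      simpa using x.2
    · have : 0 ≤ (1 - s.1) * ‖x.1.1‖⁻¹ := mul_nonneg (by linarith) (by positivity)
      linarith⟩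

theorem continuous_radialHomotopy :
    Continuous fun p : unitInterval × {x : closedBall (0 : Fin n → ℝ) 1 // x.1 ≠ 0} =>
      radialHomotopy p.1 p.2 := by
  refine Continuous.subtype_mk (Continuous.subtype_mk ?_ _) _
  have h : Continuous fun p : unitInterval × {x : closedBall (0 : Fin n → ℝ) 1 // x.1 ≠ 0} =>
    p.2.1.1 := by fun_prop
  have h' : Continuous fun p : unitInterval × {x : closedBall (0 : Fin n → ℝ) 1 // x.1 ≠ 0} =>
    p.1.1 := by fun_prop
  exact (h'.add ((continuous_const.sub h').mul
    (h.norm.inv₀ fun x => norm_ne_zero_iff.2 x.2.2))).smul h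

theorem radialHomotopy_of_norm_eq_one (s : unitInterval)
    {x : {x : closedBall (0 : Fin n → ℝ) 1 // x.1 ≠ 0}} (hx : ‖x.1.1‖ = 1) :
    radialHomotopy s x = x := by
  refine Subtype.ext (Subtype.ext ?_)
  simp [radialHomotopy, hx]

/-- The retraction of the complement of the center to `A`, on representatives. -/
noncomputable def retractRep : C(A ⊕ {x : closedBall (0 : Fin n → ℝ) 1 // x.1 ≠ 0}, A) where
  toFun := Sum.elim id fun x => S.f (radial x)
  continuous_toFun := continuous_sumElim.2 ⟨continuous_id, S.f.continuous.comp continuous_radial⟩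

/-- The homotopy from the retraction to the identity, on representatives. -/
noncomputable def homotopyRep (s : unitInterval) :
    A ⊕ {x : closedBall (0 : Fin n → ℝ) 1 // x.1 ≠ 0} →
      A ⊕ {x : closedBall (0 : Fin n → ℝ) 1 // x.1 ≠ 0} :=
  Sum.map id (radialHomotopy s)

/-- Two representatives of one point can differ only outside the open cell. There the homotopy does
nothing and the retraction is determined by the image in `N`, so both descend to the complement of
the center (`rep_congr`). -/
theorem rep_dichotomy (p : A ⊕ {x : closedBall (0 : Fin n → ℝ) 1 // x.1 ≠ 0}) :
    (∃ x : {x : closedBall (0 : Fin n → ℝ) 1 // x.1 ≠ 0}, ‖x.1.1‖ < 1 ∧ p = Sum.inr x) ∨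
    (S.i (S.retractRep p) = S.puncturedMap p ∧
      ∀ s, S.puncturedMap (homotopyRep s p) = S.puncturedMap p) := by
  rcases p with a | x
  · exact Or.inr ⟨rfl, fun s => rfl⟩
  · have hx : ‖x.1.1‖ ≤ 1 := mem_closedBall_zero_iff.1 x.1.2
    rcases hx.lt_or_eq with hx | hx
    · exact Or.inl ⟨x, hx, rfl⟩
    · refine Or.inr ⟨?_, fun s => ?_⟩
      · refine (S.i_f (radial x)).trans (congrArg S.j (Subtype.ext (radial_eq hx)))
      · simp only [homotopyRep, Sum.map_inr, radialHomotopy_of_norm_eq_one s hx]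

theorem rep_congr {p q : A ⊕ {x : closedBall (0 : Fin n → ℝ) 1 // x.1 ≠ 0}}
    (h : S.puncturedMap p = S.puncturedMap q) :
    S.retractRep p = S.retractRep q ∧
      ∀ s, S.puncturedMap (homotopyRep s p) = S.puncturedMap (homotopyRep s q) := by
  rcases S.rep_dichotomy p with ⟨x, hx, rfl⟩ | ⟨h1, h2⟩
  · rcases S.rep_dichotomy q with ⟨y, hy, rfl⟩ | ⟨h3, h4⟩
    · have : x = y := Subtype.ext (S.injective_j _ _ hx hy (congrArg Subtype.val h))
      rw [this]
      exact ⟨rfl, fun _ => rfl⟩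
    · exact absurd (h3.trans (congrArg Subtype.val h).symm) (S.disjoint _ _ hx)
  · rcases S.rep_dichotomy q with ⟨y, hy, rfl⟩ | ⟨h3, h4⟩
    · exact absurd (h1.trans (congrArg Subtype.val h)) (S.disjoint _ _ hy)
    · refine ⟨S.injective_i (h1.trans ((congrArg Subtype.val h).trans h3.symm)), fun s => ?_⟩
      rw [h2, h4, h]

theorem retractRep_factorsThrough : Function.FactorsThrough S.retractRep S.puncturedMap :=
  fun _ _ h => (S.rep_congr h).1

/-- The retraction of the complement of the center to `A`. -/
noncomputable def retraction : C(({S.center}ᶜ : Set N), A) :=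
  IsQuotientMap.lift (f := ⟨S.puncturedMap, S.isQuotientMap_puncturedMap.continuous⟩)
    S.isQuotientMap_puncturedMap S.retractRep S.retractRep_factorsThrough

theorem retraction_puncturedMap (p : A ⊕ {x : closedBall (0 : Fin n → ℝ) 1 // x.1 ≠ 0}) :
    S.retraction (S.puncturedMap p) = S.retractRep p :=
  ContinuousMap.congr_fun
    (IsQuotientMap.lift_comp (f := ⟨S.puncturedMap, S.isQuotientMap_puncturedMap.continuous⟩)
      S.isQuotientMap_puncturedMap S.retractRep S.retractRep_factorsThrough) p

/-- The homotopy on the complement of the center. -/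
noncomputable def complHomotopy (p : unitInterval × ({S.center}ᶜ : Set N)) :
    ({S.center}ᶜ : Set N) :=
  S.puncturedMap (homotopyRep p.1 (Function.surjInv S.isQuotientMap_puncturedMap.surjective p.2))

theorem complHomotopy_mk (s : unitInterval)
    (p : A ⊕ {x : closedBall (0 : Fin n → ℝ) 1 // x.1 ≠ 0}) :
    S.complHomotopy (s, S.puncturedMap p) = S.puncturedMap (homotopyRep s p) :=
  (S.rep_congr (Function.surjInv_eq S.isQuotientMap_puncturedMap.surjective _)).2 s

/-- The interval is locally compact, so its product with a quotient map is again a quotient map and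
continuity can be tested on representatives. -/
theorem continuous_complHomotopy : Continuous S.complHomotopy := by
  refine S.isQuotientMap_puncturedMap.continuous_lift_prod_right ?_
  simp_rw [complHomotopy_mk]
  refine S.isQuotientMap_puncturedMap.continuous.comp ?_
  rw [← (Homeomorph.prodSumDistrib (X := unitInterval)).symm.comp_continuous_iff']
  refine continuous_sum_dom.2 ⟨?_, ?_⟩
  · exact continuous_inl.comp continuous_snd
  · exact continuous_inr.comp continuous_radialHomotopy

/-- The complement of the center of the cell deformation retracts to `A`. -/
noncomputable def complHomotopyEquiv : ContinuousMap.HomotopyEquiv A ({S.center}ᶜ : Set N) where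
  toFun := ⟨fun a => S.puncturedMap (Sum.inl a),
    S.isQuotientMap_puncturedMap.continuous.comp continuous_inl⟩
  invFun := S.retraction
  left_inv := by
    convert ContinuousMap.Homotopic.refl _
    ext a
    exact (S.retraction_puncturedMap (Sum.inl a)).symm
  right_inv := ⟨
    { toFun := S.complHomotopy
      continuous_toFun := S.continuous_complHomotopy
      map_zero_left := fun y => by
        obtain ⟨p, rfl⟩ := S.isQuotientMap_puncturedMap.surjective y
        rw [complHomotopy_mk]
        have h := S.retraction_puncturedMap p
        refine Eq.trans ?_ (congrArg (fun a => S.puncturedMap (Sum.inl a)) h).symm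
        rcases p with a | x
        · rfl
        · refine Subtype.ext (Eq.trans (congrArg S.j (Subtype.ext ?_)) (S.i_f (radial x)).symm)
          simp [radialHomotopy, radial]
      map_one_left := fun y => by
        obtain ⟨p, rfl⟩ := S.isQuotientMap_puncturedMap.surjective y
        rw [complHomotopy_mk]
        rcases p with a | x
        · rfl
        · refine Subtype.ext (congrArg S.j (Subtype.ext ?_))
          simp [radialHomotopy] }⟩

include S in
/-- Attaching an `n`-cell changes the Euler characteristic by `(-1)ⁿ`. -/
theorem hasEuler {χ : ℤ} (h : HasEuler A χ) : HasEuler N (χ + (-1) ^ n) := by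
  have e1 : ball (0 : Fin n → ℝ) 1 ≃ₜ Set.range S.openCell :=
    S.isOpenEmbedding_openCell.isEmbedding.toHomeomorph
  have : ContractibleSpace (ball (0 : Fin n → ℝ) 1) :=
    (convex_ball _ _).contractibleSpace ⟨0, by simp⟩
  have : ContractibleSpace (Set.range S.openCell) := e1.symm.contractibleSpace
  let c : {y : ball (0 : Fin n → ℝ) 1 // y.1 ≠ 0} → N := fun y => S.openCell y.1
  have hc : IsEmbedding c := S.isOpenEmbedding_openCell.isEmbedding.comp .subtypeVal
  have hrange : Set.range c = ({S.center}ᶜ : Set N) ∩ Set.range S.openCell := by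
    ext y
    constructor
    · rintro ⟨x, rfl⟩
      exact ⟨fun h => x.2 (congrArg Subtype.val (S.isOpenEmbedding_openCell.injective h)), _, rfl⟩
    · rintro ⟨hy, x, rfl⟩
      exact ⟨⟨x, fun hx => hy (congrArg S.openCell (Subtype.ext hx))⟩, rfl⟩
  have e2 : {x : Fin n → ℝ // x ≠ 0} ≃ₜ {y : ball (0 : Fin n → ℝ) 1 // y.1 ≠ 0} :=
    Homeomorph.unitBall.subtype fun x => by
      rw [ne_eq, ne_eq, not_iff_not]
      constructor
      · rintro rfl
        simp
      · intro h
        apply Homeomorph.unitBall.injective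
        apply Subtype.ext
        rw [h]
        simp
  have e3 : (({S.center}ᶜ : Set N) ∩ Set.range S.openCell : Set N) ≃ₜ {x : Fin n → ℝ // x ≠ 0} :=
    (e2.trans (hc.toHomeomorph.trans (Homeomorph.setCongr hrange))).symm
  -- The complement of the center contributes χ, the open cell 1, and their intersection, a
  -- punctured ball, 1 - (-1)ⁿ.
  have key := HasEuler.mayerVietoris S.isOpen_compl_center S.isOpenEmbedding_openCell.isOpen_range
    (by
      rw [Set.eq_univ_iff_forall]
      intro y
      by_cases hy : y = S.center
      · exact Or.inr ⟨_, hy.symm⟩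
      · exact Or.inl hy)
    (h.congr S.complHomotopyEquiv) HasEuler.of_contractible
    (hasEuler_punctured n _ e3.toHomotopyEquiv)
  convert key using 1
  ring

end CellAttachment

end CellAttachment

/-! ### Quotients of realizations of simplicial complexes -/

section SolidSimplex

open Metric Topology

/-- The simplex spanned by the origin and the standard basis vectors. -/
def solidSimplex (n : ℕ) : Set (Fin n → ℝ) := {w | (∀ i, 0 ≤ w i) ∧ ∑ i, w i ≤ 1}

theorem isClosed_solidSimplex (n : ℕ) : IsClosed (solidSimplex n) := by
  have : solidSimplex n = (⋂ i, {w | 0 ≤ w i}) ∩ {w | ∑ i, w i ≤ 1} := by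
    ext w
    simp [solidSimplex]
  rw [this]
  exact (isClosed_iInter fun i => isClosed_le continuous_const (continuous_apply i)).inter
    (isClosed_le (by fun_prop) continuous_const)

theorem convex_solidSimplex (n : ℕ) : Convex ℝ (solidSimplex n) := by
  rintro x ⟨hx1, hx2⟩ y ⟨hy1, hy2⟩ a b ha hb hab
  refine ⟨fun i => add_nonneg (mul_nonneg ha (hx1 i)) (mul_nonneg hb (hy1 i)), ?_⟩
  simp only [Pi.add_apply, Pi.smul_apply, smul_eq_mul, Finset.sum_add_distrib, ← Finset.mul_sum]
  nlinarith

theorem isBounded_solidSimplex (n : ℕ) : Bornology.IsBounded (solidSimplex n) := by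
  refine (isBounded_closedBall (x := (0 : Fin n → ℝ)) (r := 1)).subset fun w hw => ?_
  rw [mem_closedBall_zero_iff, pi_norm_le_iff_of_nonneg zero_le_one]
  intro i
  rw [Real.norm_of_nonneg (hw.1 i)]
  exact (Finset.single_le_sum (fun i _ => hw.1 i) (Finset.mem_univ i)).trans hw.2

/-- Coordinates and, for n > 0, the coordinate sum are continuous open maps, so passing to the
interior makes their inequalities strict. For n = 0 the sum is not open, but its inequality reads 0
< 1. -/
theorem interior_solidSimplex (n : ℕ) :
    interior (solidSimplex n) = {w | (∀ i, 0 < w i) ∧ ∑ i, w i < 1} := by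
  apply subset_antisymm
  · intro w hw
    have hpos : ∀ i, 0 < w i := fun i => by
      have h1 : interior (solidSimplex n) ⊆ interior (Function.eval i ⁻¹' Set.Ici (0 : ℝ)) :=
        interior_mono fun w hw => hw.1 i
      rw [← (isOpenMap_eval i).preimage_interior_eq_interior_preimage (continuous_apply i),
        interior_Ici] at h1
      exact h1 hw
    refine ⟨hpos, ?_⟩
    rcases n with _ | n
    · simp
    · let S : (Fin (n + 1) → ℝ) →ₗ[ℝ] ℝ := ∑ i, LinearMap.proj i
      have hS : ∀ w, S w = ∑ i, w i := fun w => by simp [S]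
      have hsurj : Function.Surjective S := fun t => ⟨Pi.single 0 t, by simp [hS]⟩
      have hcont : Continuous S := S.continuous_of_finiteDimensional
      have h1 : interior (solidSimplex (n + 1)) ⊆ interior (S ⁻¹' Set.Iic (1 : ℝ)) :=
        interior_mono fun w hw => by
          rw [Set.mem_preimage, hS]
          exact hw.2
      rw [← (S.isOpenMap_of_finiteDimensional hsurj).preimage_interior_eq_interior_preimage hcont,
        interior_Iic] at h1
      have := h1 hw
      rwa [Set.mem_preimage, hS] at this
  · refine interior_maximal (fun w hw => ⟨fun i => (hw.1 i).le, hw.2.le⟩) ?_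
    have : {w : Fin n → ℝ | (∀ i, 0 < w i) ∧ ∑ i, w i < 1} =
        (⋂ i, {w | 0 < w i}) ∩ {w | ∑ i, w i < 1} := by
      ext w
      simp
    rw [this]
    exact (isOpen_iInter_of_finite fun i => isOpen_lt continuous_const (continuous_apply i)).inter
      (isOpen_lt (by fun_prop) continuous_const)

/-- A bounded convex set with nonempty interior is carried to the unit ball by an ambient
homeomorphism that respects interiors. -/
theorem exists_homeomorph_closedBall_solidSimplex (n : ℕ) :
    ∃ ψ : closedBall (0 : Fin n → ℝ) 1 ≃ₜ solidSimplex n,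
      ∀ x, ‖x.1‖ < 1 ↔ (∀ i, 0 < (ψ x).1 i) ∧ ∑ i, (ψ x).1 i < 1 := by
  obtain ⟨h, h1, h2, -⟩ := exists_homeomorph_image_interior_closure_frontier_eq_unitBall
    (convex_solidSimplex n) (by
      rw [interior_solidSimplex]
      -- The barycenter, with coordinate sum n / (n + 1).
      refine ⟨fun _ => ((n : ℝ) + 1)⁻¹, fun i => by positivity, ?_⟩
      simp only [Finset.sum_const, Finset.card_univ, Fintype.card_fin, nsmul_eq_mul]
      rw [← div_eq_mul_inv, div_lt_one (by positivity)]
      linarith) (isBounded_solidSimplex n)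
  rw [(isClosed_solidSimplex n).closure_eq] at h2
  have hmem : ∀ x, x ∈ solidSimplex n ↔ h x ∈ closedBall (0 : Fin n → ℝ) 1 := fun x => by
    rw [← h2, h.injective.mem_set_image]
  refine ⟨(h.subtype hmem).symm, fun x => ?_⟩
  obtain ⟨y, rfl⟩ := (h.subtype hmem).surjective x
  rw [Homeomorph.symm_apply_apply]
  have h3 : y.1 ∈ interior (solidSimplex n) ↔ h y.1 ∈ ball (0 : Fin n → ℝ) 1 := by
    rw [← h1, h.injective.mem_set_image]
  rw [interior_solidSimplex, mem_ball_zero_iff] at h3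
  exact h3.symm

end SolidSimplex

/-! ### Closed simplices of a realization as balls. -/

section Realization

variable {V : Type u} {K K' L : PreAbstractSimplicialComplex V} {σ : Finset V}

theorem PreAbstractSimplicialComplex.nonempty_of_mem (hσ : σ ∈ K) : σ.Nonempty :=
  (K.isRelLowerSet_faces hσ).1

theorem PreAbstractSimplicialComplex.mem_of_subset (hσ : σ ∈ K) {τ : Finset V} (h : τ ⊆ σ)
    (hne : τ.Nonempty) : τ ∈ K :=
  (K.isRelLowerSet_faces hσ).2 h hne

theorem continuous_closedSimplex_val (hσ : σ ∈ K) :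
    Continuous fun x : ClosedSimplex K σ => x.1 :=
  continuous_iSup_rng (i := (⟨σ, hσ⟩ : {σ : Finset V // σ ∈ K})) continuous_coinduced_rng

theorem continuous_realization_iff {Z : Type*} [TopologicalSpace Z] {g : Realization K → Z} :
    Continuous g ↔ ∀ σ ∈ K, Continuous fun x : ClosedSimplex K σ => g x.1 := by
  rw [continuous_iSup_dom]
  simp only [continuous_coinduced_dom, Subtype.forall]
  rfl

theorem isOpen_realization_iff {s : Set (Realization K)} :
    IsOpen s ↔ ∀ σ ∈ K, IsOpen ((fun x : ClosedSimplex K σ => x.1) ⁻¹' s) := by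
  rw [isOpen_iSup_iff]
  simp only [isOpen_coinduced, Subtype.forall]

theorem continuous_closedSimplex_iff {Z : Type*} [TopologicalSpace Z]
    {g : Z → ClosedSimplex K σ} : Continuous g ↔ ∀ v, Continuous fun z => (g z).1.1 v :=
  continuous_induced_rng.trans continuous_pi_iff

theorem continuous_closedSimplex_apply (v : V) :
    Continuous fun x : ClosedSimplex K σ => x.1.1 v :=
  continuous_closedSimplex_iff.1 continuous_id v

theorem Realization.support_nonempty (x : Realization K) : x.1.support.Nonempty :=
  PreAbstractSimplicialComplex.nonempty_of_mem x.2.1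

theorem ClosedSimplex.sum_eq_one (x : ClosedSimplex K σ) : ∑ v ∈ σ, x.1.1 v = 1 :=
  (Finsupp.sum_of_support_subset _ x.2 _ fun _ _ => rfl).symm.trans x.1.2.2.2

/-- The barycentric coordinates of a point in a closed simplex with enumerated vertices. -/
noncomputable def simplexCoordinates {n : ℕ} (e : Fin (n + 1) ≃ σ) (w : Fin n → ℝ) : V →₀ ℝ :=
  Finsupp.onFinset σ (fun v => by
    classical exact if h : v ∈ σ then
      -- Vertex 0 corresponds to the origin of the solid simplex and takes the remaining weight.
      (Fin.cons (1 - ∑ i, w i) w : Fin (n + 1) → ℝ) (e.symm ⟨v, h⟩) else 0) fun v hv => by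
    by_contra h
    exact hv (dif_neg h)

theorem simplexCoordinates_apply {n : ℕ} (e : Fin (n + 1) ≃ σ) (w : Fin n → ℝ) (i : Fin (n + 1)) :
    simplexCoordinates e w (e i) = (Fin.cons (1 - ∑ i, w i) w : Fin (n + 1) → ℝ) i := by
  simp [simplexCoordinates]

theorem support_simplexCoordinates {n : ℕ} (e : Fin (n + 1) ≃ σ) (w : Fin n → ℝ) :
    (simplexCoordinates e w).support ⊆ σ :=
  Finsupp.support_onFinset_subset

theorem simplexCoordinates_sum {n : ℕ} (e : Fin (n + 1) ≃ σ) (w : Fin n → ℝ) :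
    (simplexCoordinates e w).sum (fun _ r => r) = 1 := by
  rw [Finsupp.sum_of_support_subset _ (support_simplexCoordinates e w) _ fun _ _ => rfl,
    ← Finset.sum_coe_sort, ← e.sum_comp]
  simp_rw [simplexCoordinates_apply]
  rw [Fin.sum_univ_succ]
  simp

theorem simplexCoordinates_nonneg {n : ℕ} (e : Fin (n + 1) ≃ σ) {w : Fin n → ℝ}
    (hw : w ∈ solidSimplex n) (v : V) : 0 ≤ simplexCoordinates e w v := by
  by_cases h : v ∈ σ
  · obtain ⟨i, hi⟩ := e.surjective ⟨v, h⟩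
    have := simplexCoordinates_apply e w i
    rw [hi] at this
    rw [this]
    refine Fin.cases ?_ (fun i => ?_) i
    · simpa using hw.2
    · simpa using hw.1 i
  · exact (Finsupp.notMem_support_iff.1 fun h' => h (support_simplexCoordinates e w h')).ge

/-- A closed simplex is homeomorphic to the standard solid simplex. -/
noncomputable def solidSimplexHomeomorph {n : ℕ} (hσ : σ ∈ K) (e : Fin (n + 1) ≃ σ) :
    solidSimplex n ≃ₜ ClosedSimplex K σ where
  toFun w := ⟨⟨simplexCoordinates e w.1,
    PreAbstractSimplicialComplex.mem_of_subset hσ (support_simplexCoordinates e w.1) (by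
      rw [Finset.nonempty_iff_ne_empty, ne_eq, Finsupp.support_eq_empty]
      intro h
      have := simplexCoordinates_sum e w.1
      rw [h] at this
      simp at this),
    simplexCoordinates_nonneg e w.2, simplexCoordinates_sum e w.1⟩,
    support_simplexCoordinates e w.1⟩
  invFun x := ⟨fun i => x.1.1 (e i.succ), fun i => x.1.2.2.1 _, by
    have h := x.sum_eq_one
    rw [← Finset.sum_coe_sort, ← e.sum_comp, Fin.sum_univ_succ] at h
    have := x.1.2.2.1 (e 0)
    linarith⟩
  left_inv w := by
    apply Subtype.ext
    ext i
    exact (simplexCoordinates_apply e w.1 i.succ).trans (Fin.cons_succ _ _ i)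
  right_inv x := by
    refine Subtype.ext (Subtype.ext (Finsupp.ext fun v => ?_))
    by_cases h : v ∈ σ
    · obtain ⟨i, hi⟩ := e.surjective ⟨v, h⟩
      obtain rfl : (e i : V) = v := congrArg Subtype.val hi
      refine (simplexCoordinates_apply e _ i).trans ?_
      refine Fin.cases ?_ (fun i => ?_) i
      · have h := x.sum_eq_one
        rw [← Finset.sum_coe_sort, ← e.sum_comp, Fin.sum_univ_succ] at h
        rw [Fin.cons_zero]
        linarith
      · rw [Fin.cons_succ]
    · rw [Finsupp.notMem_support_iff.1 fun h' => h (x.2 h')]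
      exact Finsupp.notMem_support_iff.1 fun h' => h (support_simplexCoordinates e _ h')
  continuous_toFun := by
    refine continuous_closedSimplex_iff.2 fun v => ?_
    change Continuous fun w : solidSimplex n => simplexCoordinates e w.1 v
    by_cases h : v ∈ σ
    · obtain ⟨i, hi⟩ := e.surjective ⟨v, h⟩
      obtain rfl : (e i : V) = v := congrArg Subtype.val hi
      simp_rw [simplexCoordinates_apply]
      refine Fin.cases ?_ (fun i => ?_) i
      · simp_rw [Fin.cons_zero]
        fun_prop
      · simp_rw [Fin.cons_succ]
        exact (continuous_apply i).comp continuous_subtype_val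
    · have : ∀ w : solidSimplex n, simplexCoordinates e w.1 v = 0 := fun w =>
        Finsupp.notMem_support_iff.1 fun h' => h (support_simplexCoordinates e _ h')
      simp_rw [this]
      exact continuous_const
  continuous_invFun := by
    refine Continuous.subtype_mk (continuous_pi fun i => ?_) _
    exact continuous_closedSimplex_apply _

theorem support_solidSimplexHomeomorph {n : ℕ} (hσ : σ ∈ K) (e : Fin (n + 1) ≃ σ)
    (w : solidSimplex n) : (solidSimplexHomeomorph hσ e w).1.1.support = σ ↔
      (∀ i, 0 < w.1 i) ∧ ∑ i, w.1 i < 1 := by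
  change (simplexCoordinates e w.1).support = σ ↔ _
  have h1 : (simplexCoordinates e w.1).support = σ ↔
      ∀ i, (Fin.cons (1 - ∑ i, w.1 i) w.1 : Fin (n + 1) → ℝ) i ≠ 0 := by
    rw [← (support_simplexCoordinates e w.1).ge_iff_eq]
    constructor
    · intro h i
      have := Finsupp.mem_support_iff.1 (h (e i).2)
      rwa [simplexCoordinates_apply] at this
    · intro h v hv
      obtain ⟨i, hi⟩ := e.surjective ⟨v, hv⟩
      obtain rfl : (e i : V) = v := congrArg Subtype.val hi
      rw [Finsupp.mem_support_iff, simplexCoordinates_apply]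
      exact h i
  rw [h1, Fin.forall_fin_succ, and_comm]
  simp only [Fin.cons_zero, Fin.cons_succ]
  refine and_congr (forall_congr' fun i => ?_) ?_
  · exact ((w.2.1 i).lt_iff_ne').symm
  · rw [w.2.2.lt_iff_ne, sub_ne_zero, ne_comm]

theorem exists_homeomorph_closedBall_closedSimplex {n : ℕ} (hσ : σ ∈ K) (hn : σ.card = n + 1) :
    ∃ ψ : Metric.closedBall (0 : Fin n → ℝ) 1 ≃ₜ ClosedSimplex K σ,
      ∀ x, ‖x.1‖ < 1 ↔ (ψ x).1.1.support = σ := by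
  obtain ⟨ψ, h⟩ := exists_homeomorph_closedBall_solidSimplex n
  refine ⟨ψ.trans (solidSimplexHomeomorph hσ (σ.equivFinOfCardEq hn).symm), fun x => ?_⟩
  rw [h]
  exact (support_solidSimplexHomeomorph hσ _ _).symm

end Realization

/-! ### Cell structure and Euler characteristic of a quotient of realizations. -/

section RealizationQuotient

open Metric Topology

variable {V : Type u} {K K' L : PreAbstractSimplicialComplex V} {σ : Finset V}

/-- The complex with a maximal face removed. -/
def PreAbstractSimplicialComplex.eraseFace (K : PreAbstractSimplicialComplex V) (σ : Finset V)
    (hσ : ∀ τ ∈ K, σ ⊆ τ → τ = σ) : PreAbstractSimplicialComplex V where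
  faces := {τ | τ ∈ K ∧ τ ≠ σ}
  isRelLowerSet_faces := fun {τ} hτ => ⟨K.nonempty_of_mem hτ.1, fun _ hρ hne =>
    ⟨K.mem_of_subset hτ.1 hρ hne, fun h => hτ.2 (hσ τ hτ.1 (h ▸ hρ))⟩⟩

theorem continuous_of_support_subset {Z : Type*} [TopologicalSpace Z] {g : Z → Realization K}
    (hσ : σ ∈ K) (hsub : ∀ z, (g z).1.support ⊆ σ) (hg : ∀ v, Continuous fun z => (g z).1 v) :
    Continuous g :=
  (continuous_closedSimplex_val hσ).comp
    (continuous_closedSimplex_iff (g := fun z => ⟨g z, hsub z⟩) |>.2 hg)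

/-- The inclusion of the realization of a subcomplex. -/
def Realization.inclusion (h : K' ≤ K) (x : Realization K') : Realization K :=
  ⟨x.1, h x.2.1, x.2.2⟩

theorem Realization.continuous_inclusion (h : K' ≤ K) : Continuous (Realization.inclusion h) := by
  rw [continuous_realization_iff]
  intro σ hσ
  exact continuous_of_support_subset (h hσ) (fun x => x.2) fun v => continuous_closedSimplex_apply v

namespace RealizationQuotient

/-- The projection to the quotient. -/
def mk (L : PreAbstractSimplicialComplex V) (x : Realization K) : RealizationQuotient K L :=
  Quot.mk _ (Sum.inl x)

/-- The base point of the quotient. -/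
def base (K L : PreAbstractSimplicialComplex V) : RealizationQuotient K L :=
  Quot.mk _ (Sum.inr ())

theorem continuous_mk : Continuous (mk L : Realization K → RealizationQuotient K L) :=
  continuous_quot_mk.comp continuous_inl

theorem mk_eq_base {x : Realization K} (hx : x.1.support ∈ L) : mk L x = base K L :=
  Quot.sound (.collapse x hx)

theorem eq_base_or_mk (p : RealizationQuotient K L) :
    p = base K L ∨ ∃ x : Realization K, x.1.support ∉ L ∧ p = mk L x := by
  induction p using Quot.ind with
  | mk p =>
  rcases p with x | ⟨⟩
  · by_cases hx : x.1.support ∈ L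
    · exact Or.inl (mk_eq_base hx)
    · exact Or.inr ⟨x, hx, rfl⟩
  · exact Or.inl rfl

instance : Nonempty (RealizationQuotient K L) := ⟨base K L⟩

open Classical in
/-- The barycentric coordinates of a point different from the base point. -/
noncomputable def coordinates : RealizationQuotient K L → Option (V →₀ ℝ) :=
  Quot.lift (Sum.elim (fun x => if x.1.support ∈ L then none else some x.1) fun _ => none) (by
    rintro _ _ ⟨x, hx⟩
    simp [hx])

theorem coordinates_base : coordinates (base K L) = none := rfl

theorem coordinates_mk {x : Realization K} (hx : x.1.support ∉ L) :
    coordinates (mk L x) = some x.1 :=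
  if_neg hx

/-- The quotient is by a generated equivalence relation; this invariant decides which points stay
distinct. -/
theorem coordinates_injective :
    Function.Injective (coordinates : RealizationQuotient K L → Option (V →₀ ℝ)) := by
  intro p q h
  rcases eq_base_or_mk p with rfl | ⟨x, hx, rfl⟩ <;> rcases eq_base_or_mk q with rfl | ⟨y, hy, rfl⟩
  · rfl
  · rw [coordinates_base, coordinates_mk hy] at h
    cases h
  · rw [coordinates_base, coordinates_mk hx] at h
    cases h
  · rw [coordinates_mk hx, coordinates_mk hy] at h
    rw [show x = y from Subtype.ext (Option.some.inj h)]

theorem isOpen_iff {s : Set (RealizationQuotient K L)} :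
    IsOpen s ↔ ∀ σ ∈ K, IsOpen ((fun x : ClosedSimplex K σ => mk L x.1) ⁻¹' s) := by
  change IsOpen (Quot.mk _ ⁻¹' s) ↔ _
  rw [isOpen_sum_iff, isOpen_realization_iff]
  exact and_iff_left (isOpen_discrete _)

/-- The map of quotients induced by the inclusion of a subcomplex. -/
def map (h : K' ≤ K) : C(RealizationQuotient K' L, RealizationQuotient K L) where
  toFun := Quot.map (Sum.map (Realization.inclusion h) id) (by
    rintro _ _ ⟨x, hx⟩
    exact .collapse _ hx)
  continuous_toFun := continuous_quot_lift _
    (continuous_quot_mk.comp ((Realization.continuous_inclusion h).sumMap continuous_id))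

theorem coordinates_map (h : K' ≤ K) (p : RealizationQuotient K' L) :
    coordinates (map h p) = coordinates p := by
  induction p using Quot.ind with
  | mk p => rcases p with x | x <;> rfl

/-- The face `σ` is attached as a cell to the complex without this face. -/
theorem exists_cellAttachment (hσ : ∀ τ ∈ K, σ ⊆ τ → τ = σ) (hK : σ ∈ K) (hL : σ ∉ L) :
    Nonempty (CellAttachment (RealizationQuotient (K.eraseFace σ hσ) L)
      (RealizationQuotient K L) (σ.card - 1)) := by
  classical
  have hle : K.eraseFace σ hσ ≤ K := fun τ hτ => hτ.1
  have hcard : σ.card = σ.card - 1 + 1 :=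
    (Nat.succ_pred_eq_of_pos (K.nonempty_of_mem hK).card_pos).symm
  generalize σ.card - 1 = n at hcard
  obtain ⟨ψ, hψ⟩ := exists_homeomorph_closedBall_closedSimplex hK hcard
  let b : sphere (0 : Fin n → ℝ) 1 → closedBall (0 : Fin n → ℝ) 1 :=
    fun s => ⟨s.1, sphere_subset_closedBall s.2⟩
  have hb : ∀ s, (ψ (b s)).1.1.support ≠ σ := fun s h => by
    have := (hψ (b s)).2 h
    rw [show ‖(b s).1‖ = 1 from mem_sphere_zero_iff_norm.1 s.2] at this
    exact this.false
  let g : sphere (0 : Fin n → ℝ) 1 → Realization (K.eraseFace σ hσ) :=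
    fun s => ⟨(ψ (b s)).1.1, ⟨(ψ (b s)).1.2.1, hb s⟩, (ψ (b s)).1.2.2⟩
  have hψb : ∀ v, Continuous fun s => (ψ (b s)).1.1 v := fun v =>
    (continuous_closedSimplex_apply v).comp (ψ.continuous.comp (by fun_prop))
  -- The sphere is the union of the finitely many closed sets on which one coordinate vanishes. Each
  -- is mapped into a single proper face, where continuity is checked coordinatewise.
  have hg : Continuous g := by
    refine (locallyFinite_of_finite fun v : σ => {s | (ψ (b s)).1.1 v = 0}).continuous ?_
      (fun v => isClosed_eq (hψb v) continuous_const) fun v => ?_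
    · rw [Set.eq_univ_iff_forall]
      intro s
      obtain ⟨v, hv, hv'⟩ := Finset.exists_of_ssubset ((ψ (b s)).2.ssubset_of_ne (hb s))
      exact Set.mem_iUnion.2 ⟨⟨v, hv⟩, Finsupp.notMem_support_iff.1 hv'⟩
    · rw [continuousOn_iff_continuous_domRestrict]
      have hsub : ∀ s : {s | (ψ (b s)).1.1 v = 0}, (g s.1).1.support ⊆ σ.erase v :=
        fun s => Finset.subset_erase.2 ⟨(ψ (b s.1)).2, Finsupp.notMem_support_iff.2 s.2⟩
      -- If `σ` is a single vertex, there is no opposite face, and the set in question is empty.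
      by_cases hne : (σ.erase v).Nonempty
      · have hmem : σ.erase v.1 ∈ K.eraseFace σ hσ :=
          ⟨K.mem_of_subset hK (Finset.erase_subset _ _) hne, (Finset.erase_ssubset v.2).ne⟩
        exact continuous_of_support_subset hmem hsub fun w => (hψb w).comp continuous_subtype_val
      · have : IsEmpty {s | (ψ (b s)).1.1 v = 0} :=
          ⟨fun s => hne ((g s.1).support_nonempty.mono (hsub s))⟩
        exact continuous_of_discreteTopology
  have hj : Continuous fun x => mk L (ψ x).1 :=
    continuous_mk.comp ((continuous_closedSimplex_val hK).comp ψ.continuous)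
  have hcj : ∀ x, ‖x.1‖ < 1 → coordinates (mk L (ψ x).1) = some (ψ x).1.1 := fun x hx =>
    coordinates_mk (by rwa [(hψ x).1 hx])
  refine ⟨⟨map hle, ⟨_, hj⟩, ⟨_, continuous_mk.comp hg⟩, ?_, fun s => rfl, ?_, ?_, ?_⟩⟩
  · refine (isQuotientMap_iff _).2 ⟨IsCoinducing.of_isOpen_preimage_iff_isOpen fun s =>
      ⟨fun h => ?_, fun h => h.preimage (continuous_sumElim.2 ⟨(map hle).continuous, hj⟩)⟩,
      fun p => ?_⟩
    rotate_left
    · rcases eq_base_or_mk p with rfl | ⟨x, hx, rfl⟩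
      · exact ⟨Sum.inl (base _ _), rfl⟩
      · by_cases h : x.1.support = σ
        · exact ⟨Sum.inr (ψ.symm ⟨x, h.le⟩), congrArg (fun y : ClosedSimplex K σ => mk L y.1) (ψ.apply_symm_apply ⟨x, h.le⟩)⟩
        · exact ⟨Sum.inl (mk L ⟨x.1, ⟨x.2.1, h⟩, x.2.2⟩), rfl⟩
    · rw [isOpen_sum_iff] at h
      rw [isOpen_iff]
      intro τ hτ
      by_cases hτσ : τ = σ
      · subst hτσ
        have := h.2.preimage ψ.symm.continuous
        convert this using 1
        ext x
        simp
      -- By maximality of `σ`, no point of another closed simplex has support `σ`, so that simplex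
      -- already lies in the smaller complex.
      · have hmem : τ ∈ K.eraseFace σ hσ := ⟨hτ, hτσ⟩
        have hsub : ∀ x : ClosedSimplex K τ, x.1.1.support ≠ σ := fun x hx =>
          hτσ (hσ τ hτ (hx ▸ x.2))
        let r : ClosedSimplex K τ → Realization (K.eraseFace σ hσ) :=
          fun x => ⟨x.1.1, ⟨x.1.2.1, hsub x⟩, x.1.2.2⟩
        have h1 : Continuous r :=
          continuous_of_support_subset hmem (fun x => x.2) fun v => continuous_closedSimplex_apply v
        exact h.1.preimage (continuous_mk.comp h1)
  · intro p q h
    apply coordinates_injective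
    rw [← coordinates_map hle p, ← coordinates_map hle q]
    exact congrArg _ h
  · intro x y hx hy h
    have := congrArg coordinates h
    change coordinates (mk L (ψ x).1) = coordinates (mk L (ψ y).1) at this
    rw [hcj x hx, hcj y hy] at this
    exact ψ.injective (Subtype.ext (Subtype.ext (Option.some.inj this)))
  · intro p x hx h
    have := congrArg coordinates h
    change coordinates (map hle p) = coordinates (mk L (ψ x).1) at this
    rw [hcj x hx, coordinates_map] at this
    rcases eq_base_or_mk p with rfl | ⟨y, hy, rfl⟩
    · cases this
    · rw [coordinates_mk hy] at this
      refine y.2.1.2 ?_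
      rw [Option.some.inj this]
      exact (hψ x).1 hx

/-- The Euler characteristic of a quotient of complexes with finitely many cells. -/
theorem hasEuler (S : Finset (Finset V)) (hLK : L ≤ K) (hS : ∀ σ, σ ∈ S ↔ σ ∈ K ∧ σ ∉ L) :
    HasEuler (RealizationQuotient K L) (1 + ∑ σ ∈ S, (-1) ^ (σ.card - 1)) := by
  classical
  induction S using Finset.strongInduction generalizing K with
  | H S ih =>
  rcases S.eq_empty_or_nonempty with rfl | hne
  · have : Subsingleton (RealizationQuotient K L) := by
      refine ⟨fun p q => ?_⟩
      have h : ∀ p : RealizationQuotient K L, p = base K L := fun p => by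
        rcases eq_base_or_mk p with h | ⟨x, hx, -⟩
        · exact h
        · exact absurd ((hS _).2 ⟨x.2.1, hx⟩) (Finset.notMem_empty _)
      rw [h p, h q]
    have : Inhabited (RealizationQuotient K L) := ⟨base K L⟩
    have := Unique.mk' (RealizationQuotient K L)
    simpa using HasEuler.punit.congr_homeomorph
      (Homeomorph.homeomorphOfUnique PUnit (RealizationQuotient K L))
  -- A face containing one outside `L` is itself outside `L`, so a largest element of `S` is a
  -- maximal face of `K`.
  · obtain ⟨σ, hσS, hmax⟩ := S.exists_max_image Finset.card hne
    obtain ⟨hK, hL⟩ := (hS σ).1 hσS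
    have hσ : ∀ τ ∈ K, σ ⊆ τ → τ = σ := fun τ hτ hsub =>
      (Finset.eq_of_subset_of_card_le hsub (hmax τ ((hS τ).2 ⟨hτ, fun h =>
        hL (L.mem_of_subset h hsub (K.nonempty_of_mem hK))⟩))).symm
    obtain ⟨A⟩ := exists_cellAttachment hσ hK hL
    have h := ih (S.erase σ) (Finset.erase_ssubset hσS) (K := K.eraseFace σ hσ)
      (fun τ hτ => ⟨hLK hτ, fun h => hL (h ▸ hτ)⟩) fun τ => by
        rw [Finset.mem_erase, hS]
        change _ ↔ (τ ∈ K ∧ τ ≠ σ) ∧ τ ∉ L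
        tauto
    have := A.hasEuler h
    rwa [add_assoc, Finset.sum_erase_add _ _ hσS] at this

end RealizationQuotient

end RealizationQuotient

/-! ### Coefficients of the magnitude as signed counts of paths. -/

section MagnitudeCoefficients

theorem exists_pos_le_nndist (X : Type*) [MetricSpace X] [Finite X] :
    ∃ δ : ℝ≥0, 0 < δ ∧ ∀ x y : X, x ≠ y → δ ≤ nndist x y := by
  rcases isEmpty_or_nonempty {p : X × X // p.1 ≠ p.2} with h | h
  · exact ⟨1, one_pos, fun x y hxy => (h.false ⟨(x, y), hxy⟩).elim⟩
  · obtain ⟨p, hp⟩ := Finite.exists_min fun p : {p : X × X // p.1 ≠ p.2} => nndist p.1.1 p.1.2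
    exact ⟨nndist p.1.1 p.1.2, pos_iff_ne_zero.2 fun h => p.2 (nndist_eq_zero.1 h),
      fun x y hxy => hp ⟨(x, y), hxy⟩⟩

theorem HahnSeries.coeff_single_one_mul (a ℓ : ℝ≥0) (f : HahnSeries ℝ≥0 ℂ) :
    (HahnSeries.single a (1 : ℂ) * f).coeff ℓ = if a ≤ ℓ then f.coeff (ℓ - a) else 0 := by
  split_ifs with h
  · conv_lhs => rw [← tsub_add_cancel_of_le h]
    rw [HahnSeries.coeff_single_mul_add, one_mul]
  · rw [HahnSeries.coeff_mul]
    refine Finset.sum_eq_zero fun ij hij => ?_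
    have hij := (Finset.mem_antidiagonal.1 hij)
    rw [HahnSeries.coeff_single_of_ne, zero_mul]
    rintro h'
    exact h (h' ▸ hij.2.2 ▸ le_self_add)

/-- The row sums of the inverse matrix form a weighting, which trades the inverse for a linear
system. -/
theorem magnitude_eq_sum_weighting (X : Type*) [MetricSpace X] [Fintype X] :
    ∃ w : X → HahnSeries ℝ≥0 ℂ, magnitude X = ∑ x, w x ∧
      ∀ x, ∑ y, HahnSeries.single (nndist x y) (1 : ℂ) * w y = 1 := by
  classical
  refine ⟨(zetaMatrix X)⁻¹.mulVec 1, ?_, fun x => ?_⟩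
  · rw [magnitude]
    simp only [Matrix.mulVec, dotProduct, Pi.one_apply, mul_one]
    convert rfl
  · have h := (Matrix.isUnit_iff_isUnit_det _).1 (isUnit_zetaMatrix X)
    have h1 : (zetaMatrix X).mulVec ((zetaMatrix X)⁻¹.mulVec 1) = 1 := by
      rw [Matrix.mulVec_mulVec, Matrix.mul_nonsing_inv _ h, Matrix.one_mulVec]
    exact congrFun h1 x

/-- The paths from `x` of length `ℓ` in `X`, with consecutive points distinct, where the first
point is omitted. -/
def pathsFrom {X : Type u} [MetricSpace X] (x : X) (ℓ : ℝ) : Set (List X) :=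
  {l | (x :: l).IsChain (· ≠ ·) ∧ seqLength (x :: l) = ℓ}

variable {X : Type u} [MetricSpace X]

theorem nil_mem_pathsFrom {x : X} {ℓ : ℝ} : [] ∈ pathsFrom x ℓ ↔ ℓ = 0 := by
  simp [pathsFrom, seqLength, eq_comm]

theorem cons_mem_pathsFrom {x y : X} {l : List X} {ℓ : ℝ} :
    y :: l ∈ pathsFrom x ℓ ↔ x ≠ y ∧ l ∈ pathsFrom y (ℓ - dist x y) := by
  simp only [pathsFrom, Set.mem_ofPred_eq, List.isChain_cons_cons, seqLength, eq_sub_iff_add_eq',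
    and_assoc]

theorem seqLength_nonneg (l : List X) : 0 ≤ seqLength l := by
  simpa [seqLength] using seqLength_sublist (List.nil_sublist l)

/-- Solving the equation at `x` gives w(x) = 1 - ∑_{y ≠ x} q^{d(x,y)} w(y). In degree ℓ this is the
recursion for paths: stop, if ℓ = 0, or step to some y ≠ x with sign -1 and continue with length ℓ -
d(x,y). -/
theorem exists_finset_pathsFrom [Fintype X] {w : X → HahnSeries ℝ≥0 ℂ}
    (hw : ∀ x, ∑ y, HahnSeries.single (nndist x y) (1 : ℂ) * w y = 1) (ℓ : ℝ≥0) (x : X) :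
    ∃ S : Finset (List X), (∀ l, l ∈ S ↔ l ∈ pathsFrom x ℓ) ∧
      ∑ l ∈ S, (-1 : ℂ) ^ l.length = (w x).coeff ℓ := by
  classical
  obtain ⟨δ, hδ, hdist⟩ := exists_pos_le_nndist X
  -- Each step costs at least `δ`, so `n` bounds the number of steps and drives the induction.
  obtain ⟨n, hn⟩ : ∃ n : ℕ, ℓ < n * δ := by
    obtain ⟨n, hn⟩ := exists_lt_nsmul hδ ℓ
    exact ⟨n, by rwa [nsmul_eq_mul] at hn⟩
  induction n generalizing ℓ x with
  | zero => simp at hn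
  | succ n ih =>
  have key : ∀ y, ∃ S : Finset (List X), y ≠ x → nndist x y ≤ ℓ →
      (∀ l, l ∈ S ↔ l ∈ pathsFrom y (ℓ - nndist x y : ℝ≥0)) ∧
      ∑ l ∈ S, (-1 : ℂ) ^ l.length = (w y).coeff (ℓ - nndist x y) := fun y => by
    by_cases h : y ≠ x ∧ nndist x y ≤ ℓ
    · obtain ⟨S, hS⟩ := ih (ℓ - nndist x y) y (by
        rw [tsub_lt_iff_right h.2]
        refine hn.trans_le ?_
        push_cast
        rw [add_mul, one_mul]
        exact add_le_add_right (hdist x y h.1.symm) _)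
      exact ⟨S, fun _ _ => hS⟩
    · exact ⟨∅, fun h1 h2 => (h ⟨h1, h2⟩).elim⟩
  choose S hS using key
  let T : Finset X := Finset.univ.filter fun y => y ≠ x ∧ nndist x y ≤ ℓ
  have hT : ∀ y, y ∈ T ↔ y ≠ x ∧ nndist x y ≤ ℓ := fun y => by simp [T]
  have hcons : ∀ y : X, Function.Injective (List.cons y) := fun y => List.cons_injective
  refine ⟨(if ℓ = 0 then {[]} else ∅) ∪ T.biUnion fun y => (S y).image (List.cons y), ?_, ?_⟩
  · rintro (_ | ⟨y, l⟩)
    · rw [nil_mem_pathsFrom, NNReal.coe_eq_zero]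
      split_ifs with h <;> simp [h]
    · have h1 : y :: l ∉ (if ℓ = 0 then {[]} else ∅ : Finset (List X)) := by
        split_ifs <;> simp
      rw [cons_mem_pathsFrom, Finset.mem_union, or_iff_right h1]
      simp only [Finset.mem_biUnion, Finset.mem_image, List.cons.injEq]
      constructor
      · rintro ⟨y, hy, l, hl, rfl, rfl⟩
        rw [hT] at hy
        rw [(hS y hy.1 hy.2).1, NNReal.coe_sub hy.2] at hl
        exact ⟨hy.1.symm, hl⟩
      · rintro ⟨hxy, hl⟩
        have hle : nndist x y ≤ ℓ := by
          have := seqLength_nonneg (y :: l)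
          rw [hl.2, sub_nonneg] at this
          exact this
        refine ⟨y, (hT y).2 ⟨hxy.symm, hle⟩, l, ?_, rfl, rfl⟩
        rw [(hS y hxy.symm hle).1, NNReal.coe_sub hle]
        exact hl
  · rw [Finset.sum_union, Finset.sum_biUnion]
    · have h1 := congrArg (fun f => HahnSeries.coeff f ℓ) (hw x)
      simp only [HahnSeries.coeff_sum, HahnSeries.coeff_single_one_mul] at h1
      rw [← Finset.add_sum_erase _ _ (Finset.mem_univ x)] at h1
      simp only [nndist_self, zero_le, if_true, tsub_zero] at h1
      rw [← Finset.sum_filter] at h1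
      have h2 : (Finset.univ.erase x).filter (fun y => nndist x y ≤ ℓ) = T := by
        ext y
        simp [hT]
      rw [h2] at h1
      rw [eq_sub_of_add_eq h1, sub_eq_add_neg, ← Finset.sum_neg_distrib]
      congr 1
      · rw [HahnSeries.coeff_one]
        split_ifs <;> simp
      · refine Finset.sum_congr rfl fun y hy => ?_
        rw [hT] at hy
        rw [Finset.sum_image (hcons y).injOn, ← (hS y hy.1 hy.2).2, ← Finset.sum_neg_distrib]
        simp [pow_succ]
    · intro y _ z _ hyz
      rw [Function.onFun, Finset.disjoint_left]
      simp only [Finset.mem_image]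
      rintro _ ⟨l, -, rfl⟩ ⟨l', -, h⟩
      exact hyz (List.cons.inj h).1.symm
    · rw [Finset.disjoint_left]
      intro l hl hl'
      simp only [Finset.mem_biUnion, Finset.mem_image] at hl'
      obtain ⟨y, -, l, -, rfl⟩ := hl'
      split_ifs at hl <;> simp at hl

/-- The paths of length `ℓ` in `X` with consecutive points distinct. -/
def pathsOfLength (X : Type u) [MetricSpace X] (ℓ : ℝ) : Set (List X) :=
  {l | l ≠ [] ∧ l.IsChain (· ≠ ·) ∧ seqLength l = ℓ}

/-- The coefficients of the magnitude count paths with signs. -/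
theorem exists_finset_pathsOfLength (X : Type u) [MetricSpace X] [Finite X] (ℓ : ℝ≥0) :
    ∃ S : Finset (List X), (∀ l, l ∈ S ↔ l ∈ pathsOfLength X ℓ) ∧
      ∑ l ∈ S, (-1 : ℂ) ^ (l.length - 1) = (magnitude X).coeff ℓ := by
  classical
  have := Fintype.ofFinite X
  obtain ⟨w, hsum, hw⟩ := magnitude_eq_sum_weighting X
  choose S hS using exists_finset_pathsFrom hw ℓ
  refine ⟨Finset.univ.biUnion fun x => (S x).image (List.cons x), ?_, ?_⟩
  · rintro (_ | ⟨x, l⟩)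
    · simp [pathsOfLength]
    · simp [(hS _).1, pathsOfLength, pathsFrom]
  · rw [Finset.sum_biUnion, hsum, HahnSeries.coeff_sum]
    · refine Finset.sum_congr rfl fun x _ => ?_
      rw [Finset.sum_image List.cons_injective.injOn, ← (hS x).2]
      simp
    · intro y _ z _ hyz
      rw [Function.onFun, Finset.disjoint_left]
      simp only [Finset.mem_image]
      rintro _ ⟨l, -, rfl⟩ ⟨l', -, h⟩
      exact hyz (List.cons.inj h).1.symm

end MagnitudeCoefficients

/-! ### Simplices outside the short subcomplex as lightlike paths. -/

section LongSimplices

variable {X : Type u} [MetricSpace X]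

theorem Spacetime.le_def {p q : Spacetime X} :
    p ≤ q ↔ dist p.point q.point ≤ q.time - p.time := Iff.rfl

/-- The lightlike path in spacetime through the points `x :: l`, starting at time `t`. -/
def lightlikePath : ℝ → X → List X → List (Spacetime X)
  | t, x, [] => [⟨x, t⟩]
  | t, x, y :: l => ⟨x, t⟩ :: lightlikePath (t + dist x y) y l

theorem map_point_lightlikePath (t : ℝ) (x : X) (l : List X) :
    (lightlikePath t x l).map Spacetime.point = x :: l := by
  induction l generalizing t x with
  | nil => rfl
  | cons y l ih => simp [lightlikePath, ih]

theorem exists_lightlikePath_eq_cons (t : ℝ) (x : X) (l : List X) :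
    ∃ c, lightlikePath t x l = ⟨x, t⟩ :: c := by
  cases l <;> exact ⟨_, rfl⟩

theorem mem_lightlikePath {t : ℝ} {x : X} {l : List X} {p : Spacetime X}
    (hp : p ∈ lightlikePath t x l) :
    (⟨x, t⟩ : Spacetime X) ≤ p ∧ p ≤ ⟨l.getLastD x, t + seqLength (x :: l)⟩ := by
  induction l generalizing t x p with
  | nil =>
    obtain rfl := List.mem_singleton.1 hp
    simp [seqLength]
  | cons y l ih =>
    have h1 : (⟨x, t⟩ : Spacetime X) ≤ ⟨y, t + dist x y⟩ := by simp [Spacetime.le_def]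
    simp only [List.getLastD_cons, seqLength, ← add_assoc]
    rcases List.mem_cons.1 hp with rfl | hp
    · obtain ⟨c, hc⟩ := exists_lightlikePath_eq_cons (t + dist x y) y l
      have h2 : (⟨y, t + dist x y⟩ : Spacetime X) ∈ lightlikePath (t + dist x y) y l := by
        rw [hc]
        exact List.mem_cons_self
      exact ⟨le_rfl, h1.trans (ih h2).2⟩
    · exact ⟨h1.trans (ih hp).1, (ih hp).2⟩

theorem isChain_lightlikePath {t : ℝ} {x : X} {l : List X} :
    (lightlikePath t x l).IsChain (· < ·) ↔ (x :: l).IsChain (· ≠ ·) := by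
  induction l generalizing t x with
  | nil => simp [lightlikePath]
  | cons y l ih =>
    obtain ⟨c, hc⟩ := exists_lightlikePath_eq_cons (t + dist x y) y l
    have h := ih (t := t + dist x y) (x := y)
    rw [hc] at h
    rw [lightlikePath, hc, List.isChain_cons_cons, List.isChain_cons_cons, h]
    refine and_congr_left fun _ => ?_
    rw [lt_iff_le_and_ne, and_iff_right (by simp [Spacetime.le_def])]
    refine not_congr ⟨fun h => congrArg Spacetime.point h, ?_⟩
    rintro rfl
    simp

/-- Along a causal chain each distance is bounded by the elapsed time, and the times telescope. -/
theorem seqLength_map_point_le {p q : Spacetime X} {c : List (Spacetime X)}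
    (hc : (p :: c).IsChain (· < ·)) (hq : ∀ s ∈ p :: c, s ≤ q) :
    seqLength ((p :: c).map Spacetime.point) ≤ q.time - p.time := by
  induction c generalizing p with
  | nil => exact dist_nonneg.trans (hq p List.mem_cons_self)
  | cons r c ih =>
    rw [List.isChain_cons_cons] at hc
    have h1 := ih hc.2 fun s hs => hq s (List.mem_cons_of_mem _ hs)
    have h2 := Spacetime.le_def.1 hc.1.le
    simp only [List.map_cons, seqLength] at h1 ⊢
    linarith

/-- The equality case of `seqLength_map_point_le`: no step has slack, so the times are forced by the
points, and no distance remains to be covered to `q`. -/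
theorem eq_lightlikePath {p q : Spacetime X} {c : List (Spacetime X)}
    (hc : (p :: c).IsChain (· < ·)) (hq : ∀ s ∈ p :: c, s ≤ q)
    (hlen : q.time - p.time ≤ seqLength ((p :: c).map Spacetime.point)) :
    p :: c = lightlikePath p.time p.point (c.map Spacetime.point) ∧
      (c.map Spacetime.point).getLastD p.point = q.point := by
  induction c generalizing p with
  | nil =>
    refine ⟨rfl, dist_le_zero.1 ?_⟩
    exact (Spacetime.le_def.1 (hq p List.mem_cons_self)).trans hlen
  | cons r c ih =>
    rw [List.isChain_cons_cons] at hc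
    have hq' : ∀ s ∈ r :: c, s ≤ q := fun s hs => hq s (List.mem_cons_of_mem _ hs)
    have h1 := seqLength_map_point_le hc.2 hq'
    have h2 := Spacetime.le_def.1 hc.1.le
    simp only [List.map_cons, seqLength] at hlen h1
    obtain ⟨h3, h4⟩ := ih hc.2 hq' (by
      simp only [List.map_cons]
      linarith)
    rw [List.map_cons, lightlikePath, List.getLastD_cons,
      show p.time + dist p.point r.point = r.time by linarith, ← h3]
    exact ⟨rfl, h4⟩

variable {ℓ : ℝ}

/-- The inclusion of a causal interval into the total causal poset. -/
def TotalCausalPoset.mk (a b : X) (p : causalInterval X ℓ a b) : TotalCausalPoset X ℓ :=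
  ⟨(a, b), p⟩

theorem TotalCausalPoset.mk_lt_mk_iff {a b : X} {p q : causalInterval X ℓ a b} :
    mk a b p < mk a b q ↔ p.1 < q.1 :=
  Sigma.mk_lt_mk_iff

/-- The chain `c` of the total causal poset lies on the lightlike path through `x :: l`. -/
def IsLightlikeLift (ℓ : ℝ) (x : X) (l : List X) (c : List (TotalCausalPoset X ℓ)) : Prop :=
  -- The endpoints are variables tied by equations because the type of `c'` depends on them.
  ∃ (a b : X) (c' : List (causalInterval X ℓ a b)), a = x ∧ b = l.getLastD x ∧
    c'.map Subtype.val = lightlikePath 0 x l ∧ c = c'.map (TotalCausalPoset.mk a b)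

theorem exists_isLightlikeLift {x : X} {l : List X} (hℓ : seqLength (x :: l) = ℓ) :
    ∃ c, IsLightlikeLift ℓ x l c := by
  have : lightlikePath 0 x l ∈ Set.range
      (List.map (Subtype.val : causalInterval X ℓ x (l.getLastD x) → Spacetime X)) := by
    rw [Set.range_list_map]
    intro s hs
    have := mem_lightlikePath hs
    rw [hℓ, zero_add] at this
    exact ⟨⟨s, this⟩, rfl⟩
  obtain ⟨c', hc'⟩ := this
  exact ⟨_, _, _, c', rfl, rfl, hc', rfl⟩

namespace IsLightlikeLift

variable {x : X} {l : List X} {c d : List (TotalCausalPoset X ℓ)}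

theorem unique (hc : IsLightlikeLift ℓ x l c) (hd : IsLightlikeLift ℓ x l d) : c = d := by
  obtain ⟨_, _, c', rfl, rfl, hc', rfl⟩ := hc
  obtain ⟨_, _, d', rfl, rfl, hd', rfl⟩ := hd
  rw [List.map_injective_iff.2 Subtype.val_injective (hc'.trans hd'.symm)]

theorem map_point (hc : IsLightlikeLift ℓ x l c) : c.map TotalCausalPoset.point = x :: l := by
  obtain ⟨_, _, c', rfl, rfl, hc', rfl⟩ := hc
  rw [← map_point_lightlikePath 0 _ l, ← hc', List.map_map, List.map_map]
  rfl

theorem pairwise (hc : IsLightlikeLift ℓ x l c) (hl : (x :: l).IsChain (· ≠ ·)) :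
    c.Pairwise (· < ·) := by
  obtain ⟨_, _, c', rfl, rfl, hc', rfl⟩ := hc
  have h := (isChain_lightlikePath (t := 0)).2 hl
  rw [← hc', List.isChain_iff_pairwise, List.pairwise_map] at h
  rw [List.pairwise_map]
  exact h.imp TotalCausalPoset.mk_lt_mk_iff.2

end IsLightlikeLift

/-- Different summands of the disjoint union are incomparable, so a chain stays in one causal
interval. -/
theorem exists_eq_map_mk {p : TotalCausalPoset X ℓ} {c : List (TotalCausalPoset X ℓ)}
    (hc : (p :: c).Pairwise (· < ·)) :
    ∃ (a b : X) (c' : List (causalInterval X ℓ a b)),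
      p :: c = c'.map (TotalCausalPoset.mk a b) := by
  obtain ⟨⟨a, b⟩, p⟩ := p
  have : (⟨(a, b), p⟩ :: c : List (TotalCausalPoset X ℓ)) ∈
      Set.range (List.map (TotalCausalPoset.mk (ℓ := ℓ) a b)) := by
    rw [Set.range_list_map]
    intro s hs
    have hle : (⟨(a, b), p⟩ : TotalCausalPoset X ℓ) ≤ s := by
      rcases List.mem_cons.1 hs with rfl | hs
      · exact le_rfl
      · exact ((List.pairwise_cons.1 hc).1 s hs).le
    obtain ⟨j, s⟩ := s
    cases hle
    exact ⟨_, rfl⟩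
  obtain ⟨c', hc'⟩ := this
  exact ⟨a, b, c', hc'.symm⟩

/-- Only time ℓ is available, so length ℓ leaves no slack before, between or after the points: the
chain starts at (a, 0), is lightlike, and ends over b. -/
theorem exists_isLightlikeLift_of_le {c : List (TotalCausalPoset X ℓ)} (hne : c ≠ [])
    (hc : c.Pairwise (· < ·)) (hlen : ℓ ≤ seqLength (c.map TotalCausalPoset.point)) :
    ∃ x l, x :: l ∈ pathsOfLength X ℓ ∧ IsLightlikeLift ℓ x l c := by
  obtain ⟨p, c, rfl⟩ := List.exists_cons_of_ne_nil hne
  obtain ⟨a, b, c', hc'⟩ := exists_eq_map_mk hc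
  rw [hc'] at hc hlen hne ⊢
  rw [List.pairwise_map] at hc
  obtain ⟨s, d, rfl⟩ := List.exists_cons_of_ne_nil (l := c') (by simpa using hne)
  have hchain : (s.1 :: d.map Subtype.val).IsChain (· < ·) := by
    rw [← List.map_cons, List.isChain_iff_pairwise, List.pairwise_map]
    exact hc.imp TotalCausalPoset.mk_lt_mk_iff.1
  have hq : ∀ r ∈ s.1 :: d.map Subtype.val, r ≤ ⟨b, ℓ⟩ := fun r hr => by
    rw [← List.map_cons] at hr
    obtain ⟨r, -, rfl⟩ := List.mem_map.1 hr
    exact r.2.2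
  have hpt : ((s :: d).map (TotalCausalPoset.mk a b)).map
      TotalCausalPoset.point = (s.1 :: d.map Subtype.val).map Spacetime.point := by
    rw [← List.map_cons (f := Subtype.val), List.map_map, List.map_map]
    rfl
  rw [hpt] at hlen
  have h1 := seqLength_map_point_le hchain hq
  have h2 := Spacetime.le_def.1 s.2.1
  have h3 := dist_nonneg (x := a) (y := s.1.point)
  dsimp only at h1 h2
  obtain ⟨h4, h5⟩ := eq_lightlikePath hchain hq (by dsimp only; linarith)
  have h6 : s.1.time = 0 := by linarith
  have h7 : a = s.1.point := dist_le_zero.1 (by linarith)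
  refine ⟨s.1.point, (d.map Subtype.val).map Spacetime.point, ⟨List.cons_ne_nil _ _, ?_, ?_⟩,
    a, b, s :: d, h7, h5.symm, ?_, rfl⟩
  · rw [← isChain_lightlikePath, ← h4]
    exact hchain
  · rw [List.map_cons] at hlen h1
    linarith
  · rw [List.map_cons, h4, h6]

theorem exists_enumeration {P : Type u} [PartialOrder P] {σ : Finset P}
    (hσ : IsChain (· ≤ ·) (σ : Set P)) :
    ∃ c : List P, c.Pairwise (· < ·) ∧ ∀ p, p ∈ c ↔ p ∈ σ := by
  classical
  induction σ using Finset.strongInduction with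
  | H σ ih =>
  rcases σ.eq_empty_or_nonempty with rfl | hne
  · exact ⟨[], by simp, by simp⟩
  · obtain ⟨m, hm⟩ := σ.exists_minimal hne
    obtain ⟨c, hc, hmem⟩ := ih (σ.erase m) (Finset.erase_ssubset hm.1)
      (hσ.mono (Finset.coe_subset.2 (Finset.erase_subset _ _)))
    refine ⟨m :: c, List.pairwise_cons.2 ⟨fun p hp => ?_, hc⟩, fun p => ?_⟩
    · rw [hmem, Finset.mem_erase] at hp
      rcases hσ.total hm.1 hp.2 with h | h
      · exact h.lt_of_ne' hp.1
      · exact (hp.1 (hm.eq_of_le hp.2 h)).elim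
    · rw [List.mem_cons, hmem, Finset.mem_erase]
      by_cases h : p = m
      · simp [h, hm.1]
      · simp [h]

/-- A path lifts uniquely to a lightlike chain and is recovered from it by forgetting times, while a
simplex is recovered from its increasing enumeration. This bijection preserves the number of
vertices. -/
theorem exists_finset_longSimplices {S : Finset (List X)}
    (hS : ∀ l, l ∈ S ↔ l ∈ pathsOfLength X ℓ) :
    ∃ T : Finset (Finset (TotalCausalPoset X ℓ)),
      (∀ σ, σ ∈ T ↔ σ ∈ orderComplex (TotalCausalPoset X ℓ) ∧ σ ∉ shortComplex X ℓ) ∧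
      ∑ σ ∈ T, (-1 : ℤ) ^ (σ.card - 1) = ∑ l ∈ S, (-1) ^ (l.length - 1) := by
  classical
  have key : ∀ l : List X, ∃ c : List (TotalCausalPoset X ℓ), l ∈ S →
      ∃ x l', l = x :: l' ∧ IsLightlikeLift ℓ x l' c := fun l => by
    by_cases h : l ∈ S
    · obtain ⟨hne, h1, h2⟩ := (hS l).1 h
      obtain ⟨x, l, rfl⟩ := List.exists_cons_of_ne_nil hne
      obtain ⟨c, hc⟩ := exists_isLightlikeLift h2
      exact ⟨c, fun _ => ⟨x, l, rfl, hc⟩⟩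
    · exact ⟨[], fun h' => (h h').elim⟩
  choose c hc using key
  have hpt : ∀ l ∈ S, (c l).map TotalCausalPoset.point = l := fun l hl => by
    obtain ⟨x, l', rfl, h⟩ := hc l hl
    exact h.map_point
  have hpw : ∀ l ∈ S, (c l).Pairwise (· < ·) := fun l hl => by
    obtain ⟨x, l', rfl, h⟩ := hc l hl
    exact h.pairwise ((hS _).1 hl).2.1
  have huniq : ∀ {d e : List (TotalCausalPoset X ℓ)}, d.Pairwise (· < ·) → e.Pairwise (· < ·) →
      (∀ p, p ∈ d ↔ p ∈ e) → d = e := fun hd he h =>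
    ((List.perm_ext_iff_of_nodup (hd.imp ne_of_lt) (he.imp ne_of_lt)).2 h).eq_of_pairwise
      (fun a b _ _ h1 h2 => (h1.asymm h2).elim) hd he
  refine ⟨S.image fun l => (c l).toFinset, fun σ => ?_, ?_⟩
  · rw [Finset.mem_image]
    constructor
    · rintro ⟨l, hl, rfl⟩
      have hmem : ∀ p, p ∈ c l ↔ p ∈ (c l).toFinset := fun p => List.mem_toFinset.symm
      have hne : (c l).toFinset.Nonempty := by
        rw [List.toFinset_nonempty_iff]
        intro h
        have := hpt l hl
        rw [h] at this
        exact ((hS l).1 hl).1 this.symm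
      refine ⟨⟨hne, fun p hp q hq _ => ?_⟩, ?_⟩
      · have : Std.Symm (fun a b : TotalCausalPoset X ℓ => a ≤ b ∨ b ≤ a) := ⟨fun _ _ h => h.symm⟩
        exact List.Pairwise.forall_of_forall
          (R := fun a b : TotalCausalPoset X ℓ => a ≤ b ∨ b ≤ a) (fun _ _ => Or.inl le_rfl)
          ((hpw l hl).imp fun h => Or.inl h.le) ((hmem p).2 hp) ((hmem q).2 hq)
      · rintro ⟨-, d, hd, hdmem, hlen⟩
        rw [huniq hd (hpw l hl) fun p => (hdmem p).trans (hmem p).symm, hpt l hl] at hlen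
        exact hlen.ne ((hS l).1 hl).2.2
    · rintro ⟨hσ, hσ'⟩
      obtain ⟨d, hd, hmem⟩ := exists_enumeration hσ.2
      have hne : d ≠ [] := by
        rintro rfl
        obtain ⟨p, hp⟩ := hσ.1
        simpa using (hmem p).2 hp
      obtain ⟨x, l, hl, hlift⟩ := exists_isLightlikeLift_of_le hne hd
        (not_lt.1 fun h => hσ' ⟨hσ.1, d, hd, hmem, h⟩)
      refine ⟨x :: l, (hS _).2 hl, ?_⟩
      obtain ⟨x', l', h, hlift'⟩ := hc _ ((hS _).2 hl)
      cases h
      rw [hlift'.unique hlift]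
      ext p
      rw [List.mem_toFinset, hmem]
  · rw [Finset.sum_image]
    · refine Finset.sum_congr rfl fun l hl => ?_
      rw [List.toFinset_card_of_nodup ((hpw l hl).imp ne_of_lt), ← List.length_map, hpt l hl]
    · intro l hl l' hl' h
      have h' : c l = c l' := huniq (hpw l hl) (hpw l' hl') fun p => by
        rw [← List.mem_toFinset, ← List.mem_toFinset]
        exact Finset.ext_iff.1 h p
      rw [← hpt l hl, ← hpt l' hl', h']

/-- The reduced Euler characteristics of the magnitude homotopy types are the coefficients of the
magnitude. -/
theorem reducedEulerChar_magnitudeHomotopyType (X : Type u) [MetricSpace X] [Finite X] {ℓ : ℝ}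
    (hℓ : 0 ≤ ℓ) : HasFiniteReducedHomology (MagnitudeHomotopyType X ℓ) ∧
      (reducedEulerChar (MagnitudeHomotopyType X ℓ) : ℂ) = (magnitude X).coeff ⟨ℓ, hℓ⟩ := by
  obtain ⟨S, hS, hsum⟩ := exists_finset_pathsOfLength X ⟨ℓ, hℓ⟩
  obtain ⟨T, hT, hTsum⟩ := exists_finset_longSimplices (ℓ := ℓ) hS
  obtain ⟨h1, h2⟩ := (RealizationQuotient.hasEuler T (shortComplex_le X ℓ) hT).reduced
  refine ⟨h1, ?_⟩
  rw [h2, ← hsum, hTsum]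
  push_cast
  ring

end LongSimplices

/-! ### Transport of a weighting across the twist, as linear algebra. -/

section Gluing

theorem magnitude_eq_sum_of_weighting {X : Type*} [MetricSpace X] [Fintype X]
    {w : X → HahnSeries ℝ≥0 ℂ}
    (hw : ∀ x, ∑ y, HahnSeries.single (nndist x y) (1 : ℂ) * w y = 1) :
    magnitude X = ∑ x, w x := by
  classical
  obtain ⟨v, h, hv⟩ := magnitude_eq_sum_weighting X
  rw [h, Matrix.mulVec_injective_of_isUnit (isUnit_zetaMatrix X)
    (show (zetaMatrix X).mulVec v = (zetaMatrix X).mulVec w from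
      funext fun x => (hv x).trans (hw x).symm)]

/-- The transformation of weightings under a sycamore twist. -/
theorem exists_twisted_weighting {G Q R : Type*} [Fintype G] [Fintype Q] [CommRing R]
    {a : G → G → R} {z z' : G → Q → R} {h : Q → Q → R} {t : Q → R} {p p' : Q → G}
    (hz : ∀ g b, z g b - z' g b = (a g (p b) - a g (p' b)) * t b)
    (hQ : ∀ b, (∀ g, z g b = z' g b ∧ ∀ c, z (p c) b = z (p' c) b) ∨
      ∀ g, z g b = a (p b) g * t b ∧ z' g b = a (p' b) g * t b)
    (hp : ∀ b c, z (p b) c = z' (p' b) c) {u : G → R} {v : Q → R}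
    (h1 : ∀ g, ∑ g', a g g' * u g' + ∑ b, z g b * v b = 1)
    (h2 : ∀ b, ∑ g, z g b * u g + ∑ c, h b c * v c = 1) :
    ∃ u' : G → R, ∑ g, u' g = ∑ g, u g ∧
      (∀ g, ∑ g', a g g' * u' g' + ∑ b, z' g b * v b = 1) ∧
      ∀ b, ∑ g, z' g b * u' g + ∑ c, h b c * v c = 1 := by
  classical
  -- For each `b` the mass `t b * v b` is moved from `p' b` to `p b`. The total is unchanged, and by
  -- `hz` this compensates the change from `z` to `z'` in the equations on `G`.
  let u' : G → R := fun g =>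
    u g + ∑ b, ((if g = p b then 1 else 0) - if g = p' b then 1 else 0) * (t b * v b)
  have hu' : ∀ f : G → R,
      ∑ g, f g * u' g = ∑ g, f g * u g + ∑ b, (f (p b) - f (p' b)) * (t b * v b) := fun f => by
    simp only [u', mul_add, Finset.sum_add_distrib, Finset.mul_sum]
    rw [Finset.sum_comm]
    refine congrArg _ (Finset.sum_congr rfl fun b _ => ?_)
    simp only [← mul_assoc, mul_sub]
    rw [← Finset.sum_mul, ← Finset.sum_mul]
    simp [Finset.sum_sub_distrib]
  have h1' : ∀ g, ∑ g', a g g' * u' g' + ∑ b, z' g b * v b = 1 := fun g => by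
    rw [← h1 g, hu', add_assoc, ← Finset.sum_add_distrib]
    refine congrArg _ (Finset.sum_congr rfl fun b _ => ?_)
    rw [← mul_assoc, ← hz]
    ring
  refine ⟨u', ?_, h1', fun b => ?_⟩
  · simpa using hu' fun _ => 1
  · rw [← h2 b]
    refine congrArg (· + _) ?_
    rcases hQ b with hb | hb
    -- Neutral case: the column of `b` is the same before and after and does not distinguish `p c`
    -- from `p' c`, so moving mass between them has no effect.
    · rw [hu', Finset.sum_eq_zero (f := fun c => (z' (p c) b - z' (p' c) b) * (t c * v c)), add_zero]
      · simp only [(hb _).1]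
      · intro c _
        rw [← (hb _).1, ← (hb _).1, (hb (p c)).2 c, sub_self, zero_mul]
    -- Biased case: the old equation at `p b` and the new one at `p' b` have the same contribution
    -- from `Q`, hence the same one from `G`; multiplying by `t b` gives the claim.
    · have h3 := (h1 (p b)).trans (h1' (p' b)).symm
      simp only [hp b, add_left_inj] at h3
      simp only [(hb _).1, (hb _).2]
      have e : ∀ x y : R, x * t b * y = x * y * t b := fun x y => by ring
      simp only [e, ← Finset.sum_mul, h3]

end Gluing

/-! ### Distances in glued spaces and invariance of the magnitude. -/

section GlueSpace

open Metric

variable {G H K : Type*} [MetricSpace G] [MetricSpace H] [MetricSpace K] [Nonempty K]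
  {iG : K → G} {iH : K → H}

/-- The summand 0 in the proof is the gap parameter of the general gluing construction, which is
zero here. -/
theorem dist_toGlueL_toGlueR (hG : Isometry iG) (hH : Isometry iH) (x : G) (y : H) :
    dist (toGlueL hG hH x) (toGlueR hG hH y) = ⨅ k, dist x (iG k) + dist y (iH k) :=
  (show _ = (⨅ k, dist x (iG k) + dist y (iH k)) + 0 from rfl).trans (add_zero _)

theorem dist_toGlueL_apply_toGlueR (hG : Isometry iG) (hH : Isometry iH) (k : K) (y : H) :
    dist (toGlueL hG hH (iG k)) (toGlueR hG hH y) = dist (iH k) y := by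
  rw [show toGlueL hG hH (iG k) = toGlueR hG hH (iH k) from congrFun (toGlue_commute hG hH) k,
    (toGlueR_isometry hG hH).dist_eq]

/-- The infimum is attained at the projection: a detour through any other `k` is no shorter, by the
triangle inequality in `G`. -/
theorem dist_toGlueL_toGlueR_of_projects (hG : Isometry iG) (hH : Isometry iH) {k₀ : K} {y : H}
    (h : ∀ k, dist (iH k) y = dist k k₀ + dist (iH k₀) y) (x : G) :
    dist (toGlueL hG hH x) (toGlueR hG hH y) = dist (iG k₀) x + dist (iH k₀) y := by
  rw [dist_toGlueL_toGlueR]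
  apply le_antisymm
  · rw [dist_comm (iG k₀), dist_comm (iH k₀)]
    exact ciInf_le ⟨0, by
      rintro _ ⟨k, rfl⟩
      positivity⟩ k₀
  · refine le_ciInf fun k => ?_
    rw [dist_comm y, h k, ← hG.dist_eq]
    have := dist_triangle (iG k₀) (iG k) x
    rw [dist_comm (iG k₀) (iG k), dist_comm (iG k) x] at this
    linarith

/-- A glued space consists of the points of `G` and the points of `H` outside the glued part. -/
theorem bijective_sumElim_toGlue [Finite K] (hG : Isometry iG) (hH : Isometry iH) {S : Set H}
    (hS : S = Set.range iH) :
    Function.Bijective (Sum.elim (toGlueL hG hH) fun y : {y // y ∉ S} => toGlueR hG hH y.1) := by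
  subst hS
  constructor
  · refine Function.Injective.sumElim (toGlueL_isometry hG hH).injective
      ((toGlueR_isometry hG hH).injective.comp Subtype.val_injective) fun x y h => y.2 ?_
    have h0 := dist_eq_zero.2 h
    rw [dist_toGlueL_toGlueR] at h0
    -- As `K` is finite the infimum is attained, so distance zero would put `y` into the glued part.
    obtain ⟨k, hk⟩ := exists_eq_ciInf_of_finite (f := fun k => dist x (iG k) + dist y.1 (iH k))
    rw [h0] at hk
    have h1 := dist_nonneg (x := x) (y := iG k)
    have h2 := dist_nonneg (x := y.1) (y := iH k)
    exact ⟨k, (dist_le_zero.1 (by linarith)).symm⟩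
  · rintro ⟨x | y⟩
    · exact ⟨Sum.inl x, rfl⟩
    · by_cases hy : y ∈ Set.range iH
      · obtain ⟨k, rfl⟩ := hy
        exact ⟨Sum.inl (iG k), congrFun (toGlue_commute hG hH) k⟩
      · exact ⟨Sum.inr ⟨y, hy⟩, rfl⟩

/-- Allowing any `S` equal to the range lets both gluings be indexed by the same complement,
although their embeddings `iH` and `iH ∘ α` differ. -/
theorem sum_glueSpace [Fintype G] [Finite K] (hG : Isometry iG) (hH : Isometry iH) {S : Set H}
    (hS : S = Set.range iH) [Fintype {y // y ∉ S}] [Fintype (GlueSpace hG hH)] {R : Type*}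
    [AddCommMonoid R] (f : GlueSpace hG hH → R) :
    ∑ x, f x = ∑ g, f (toGlueL hG hH g) + ∑ y : {y // y ∉ S}, f (toGlueR hG hH y.1) := by
  rw [← (bijective_sumElim_toGlue hG hH hS).sum_comp, Fintype.sum_sum_type]
  rfl

/-- Sycamore twists preserve the magnitude. -/
theorem magnitude_sycamoreTwist [Finite G] [Finite H] (hG : Isometry iG) (hH : Isometry iH)
    {α : K → K} (hα : Isometry α)
    (hneutral : ∀ h ∈ neutralPoints (Set.range iH), ∀ k : K,
      dist h (iH k) = dist h (iH (α k))) :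
    magnitude (GlueSpace hG hH) = magnitude (GlueSpace hG (hH.comp hα)) := by
  classical
  have := Fintype.ofFinite G
  have := Fintype.ofFinite {y // y ∉ Set.range iH}
  have := Fintype.ofFinite (GlueSpace hG hH)
  have := Fintype.ofFinite (GlueSpace hG (hH.comp hα))
  have : Finite K := Finite.of_injective iG hG.injective
  -- An isometry of the finite space `K` is onto. Its inverse `β` locates glued points: after the
  -- twist, `iH k` is identified with `iG (β k)`.
  have hαb : Function.Surjective α := Finite.surjective_of_injective hα.injective
  choose β hβ using hαb
  have hS : Set.range iH = Set.range (iH ∘ α) := (Function.Surjective.range_comp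
    (fun k => ⟨β k, hβ k⟩) iH).symm
  let q : ℝ≥0 → HahnSeries ℝ≥0 ℂ := fun r => HahnSeries.single r 1
  have hq : ∀ r s, q (r + s) = q r * q s := fun r s => by
    simp [q, HahnSeries.single_mul_single]
  let L := toGlueL hG hH
  let R := toGlueR hG hH
  let L' := toGlueL hG (hH.comp hα)
  let R' := toGlueR hG (hH.comp hα)
  have hLR : ∀ k y, nndist (L (iG k)) (R y) = nndist (iH k) y := fun k y =>
    NNReal.eq (dist_toGlueL_apply_toGlueR hG hH k y)
  have hLR' : ∀ k y, nndist (L' (iG k)) (R' y) = nndist (iH (α k)) y := fun k y =>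
    NNReal.eq (dist_toGlueL_apply_toGlueR hG (hH.comp hα) k y)
  -- The data for `exists_twisted_weighting`. A biased point gets its projection `k` and t =
  -- q^{d(k,b)}; a neutral point gets t = 0, so that it moves no mass.
  have key : ∀ b : {y // y ∉ Set.range iH}, ∃ (k : K) (t : HahnSeries ℝ≥0 ℂ),
      (t = 0 ∧ ∀ g, nndist (L g) (R b.1) = nndist (L' g) (R' b.1) ∧
        ∀ j, nndist (iH j) b.1 = nndist (iH (β j)) b.1) ∨
      ∀ g, q (nndist (L g) (R b.1)) = q (nndist (iG k) g) * t ∧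
        q (nndist (L' g) (R' b.1)) = q (nndist (iG (β k)) g) * t := fun b => by
    by_cases hb : ProjectsTo (Set.range iH) b.1
    · obtain ⟨_, ⟨k, rfl⟩, hk⟩ := hb
      have h1 : ∀ j, dist (iH j) b.1 = dist j k + dist (iH k) b.1 := fun j => by
        rw [hk _ ⟨j, rfl⟩, hH.dist_eq]
      refine ⟨k, q (nndist (iH k) b.1), Or.inr fun g => ⟨?_, ?_⟩⟩
      · rw [← hq]
        exact congrArg q (NNReal.eq (dist_toGlueL_toGlueR_of_projects hG hH h1 g))
      · rw [← hq]
        refine congrArg q (NNReal.eq ((dist_toGlueL_toGlueR_of_projects hG (hH.comp hα)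
          (k₀ := β k) (fun j => ?_) g).trans ?_))
        · simp only [Function.comp_apply, hβ]
          rw [h1 (α j), ← hα.dist_eq j, hβ]
        · simp [hβ]
    · have hn := hneutral b.1 fun h => h.elim b.2 fun h => hb h.2
      -- With t = 0 the choice of the point of `K` is immaterial.
      refine ⟨Classical.arbitrary K, 0, Or.inl ⟨rfl, fun g => ⟨NNReal.eq ?_, fun j => ?_⟩⟩⟩
      · refine (dist_toGlueL_toGlueR hG hH g b.1).trans
          (.trans ?_ (dist_toGlueL_toGlueR hG (hH.comp hα) g b.1).symm)
        exact congrArg _ (funext fun k => congrArg _ (hn k))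
      · rw [nndist_comm, nndist_comm (iH (β j))]
        refine NNReal.eq ((hn (β j)).trans ?_).symm
        rw [hβ]
        rfl
  choose κ t hκ using key
  obtain ⟨w, hwsum, hw⟩ := magnitude_eq_sum_weighting (GlueSpace hG hH)
  simp only [sum_glueSpace hG hH rfl] at hw hwsum
  refine Exists.elim (exists_twisted_weighting (R := HahnSeries ℝ≥0 ℂ)
    (a := fun g g' => q (nndist g g'))
    (z := fun g (b : {y // y ∉ Set.range iH}) => q (nndist (L g) (R b.1)))
    (z' := fun g b => q (nndist (L' g) (R' b.1))) (h := fun b c => q (nndist b.1 c.1)) (t := t)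
    (p := fun b => iG (κ b)) (p' := fun b => iG (β (κ b)))
    (u := fun g => w (L g)) (v := fun b => w (R b.1)) ?_ ?_ ?_ ?_ ?_) ?_
  · intro g b
    rcases hκ b with ⟨h0, hb⟩ | hb
    · rw [h0, (hb g).1, mul_zero, sub_self]
    · rw [(hb g).1, (hb g).2, nndist_comm g, nndist_comm g]
      ring
  · intro b
    refine (hκ b).imp (fun hb g => ⟨congrArg q (hb.2 g).1, fun c => ?_⟩) id
    rw [hLR, hLR, (hb.2 g).2]
  · intro b c
    rw [hLR, hLR', hβ]
  · intro g
    refine .trans ?_ (hw (L g))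
    refine congrArg₂ _ (Finset.sum_congr rfl fun g' _ => ?_) rfl
    exact congrArg (fun r => q r * _) ((toGlueL_isometry hG hH).nndist_eq g g').symm
  · intro b
    refine .trans ?_ (hw (R b.1))
    refine congrArg₂ _ (Finset.sum_congr rfl fun g _ => ?_) (Finset.sum_congr rfl fun c _ => ?_)
    · exact congrArg (fun r => q r * _) (nndist_comm _ _)
    · exact congrArg (fun r => q r * _) ((toGlueR_isometry hG hH).nndist_eq _ _).symm
  · rintro u' ⟨hu', h1, h2⟩
    -- The weighting of the twisted space takes the corrected values on `G` and the old ones on the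
    -- rest of `H`.
    let e := Equiv.ofBijective _ (bijective_sumElim_toGlue hG (hH.comp hα) hS)
    let w' : GlueSpace hG (hH.comp hα) → HahnSeries ℝ≥0 ℂ :=
      fun x => Sum.elim u' (fun b => w (R b.1)) (e.symm x)
    have hwL : ∀ g, w' (L' g) = u' g := fun g => by
      simp only [w', show e.symm (L' g) = Sum.inl g from e.symm_apply_apply (Sum.inl g),
        Sum.elim_inl]
    have hwR : ∀ b : {y // y ∉ Set.range iH}, w' (R' b.1) = w (R b.1) := fun b => by
      simp only [w', show e.symm (R' b.1) = Sum.inr b from e.symm_apply_apply (Sum.inr b),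
        Sum.elim_inr]
    rw [hwsum, magnitude_eq_sum_of_weighting (w := w'), sum_glueSpace hG (hH.comp hα) hS]
    · simp only [L', R'] at hwL hwR
      simp only [hwL, hwR, hu']
      rfl
    · intro x
      obtain ⟨x, rfl⟩ := e.surjective x
      rw [sum_glueSpace hG (hH.comp hα) hS]
      simp only [L', R'] at hwL hwR
      simp only [hwL, hwR]
      rcases x with g | b
      · refine .trans ?_ (h1 g)
        refine congrArg₂ _ (Finset.sum_congr rfl fun g' _ => ?_) rfl
        exact congrArg (fun r => q r * _) ((toGlueL_isometry hG (hH.comp hα)).nndist_eq g g')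
      · refine .trans ?_ (h2 b)
        refine congrArg₂ _ (Finset.sum_congr rfl fun g _ => ?_) (Finset.sum_congr rfl fun c _ => ?_)
        · exact congrArg (fun r => q r * _) (nndist_comm _ _)
        · exact congrArg (fun r => q r * _) ((toGlueR_isometry hG (hH.comp hα)).nndist_eq _ _)

end GlueSpace

theorem mainTheorem2 {G H K : Type*} [MetricSpace G] [MetricSpace H] [MetricSpace K]
    [Nonempty K] [Finite G] [Finite H]
    {iG : K → G} {iH : K → H} (hG : Isometry iG) (hH : Isometry iH)
    {α : K → K} (hα : Isometry α)
    (hneutral : ∀ h ∈ neutralPoints (Set.range iH), ∀ k : K,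
      dist h (iH k) = dist h (iH (α k))) :
    (∀ ℓ : ℝ, 0 ≤ ℓ →
      HasFiniteReducedHomology (MagnitudeHomotopyType (Metric.GlueSpace hG hH) ℓ) ∧
      HasFiniteReducedHomology
        (MagnitudeHomotopyType (Metric.GlueSpace hG (hH.comp hα)) ℓ) ∧
      reducedEulerChar (MagnitudeHomotopyType (Metric.GlueSpace hG hH) ℓ) =
        reducedEulerChar (MagnitudeHomotopyType (Metric.GlueSpace hG (hH.comp hα)) ℓ)) ∧
    magnitude (Metric.GlueSpace hG hH) = magnitude (Metric.GlueSpace hG (hH.comp hα)) := by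
  have h := magnitude_sycamoreTwist hG hH hα hneutral
  refine ⟨fun ℓ hℓ => ?_, h⟩
  obtain ⟨h1, h2⟩ := reducedEulerChar_magnitudeHomotopyType (Metric.GlueSpace hG hH) hℓ
  obtain ⟨h3, h4⟩ :=
    reducedEulerChar_magnitudeHomotopyType (Metric.GlueSpace hG (hH.comp hα)) hℓ
  refine ⟨h1, h3, ?_⟩
  -- Both Euler characteristics are the same coefficient in ℂ, and integers embed in ℂ.
  rw [← h, ← h2] at h4
  exact_mod_cast h4.symm
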